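/- **Scheme.** Let $c_1=\frac12-\frac{\sqrt{15}}{10}$, $c_2=\frac12$, $c_3=\frac12+\frac{\sqrt{15}}{10}$. For $i\,u'=(T+V(t))u$, a time $s$ and a step $\tau$, write $V_j=V(s+c_j\tau)$ and $$\alpha_1=-i\tau(T+V_2),\qquad \alpha_2=-i\tau\tfrac{\sqrt{15}}3(V_3-V_1),\qquad \alpha_3=-i\tau\tfrac{10}{3}(V_3-2V_2+V_1),$$ $[\alpha_2,\alpha_1,\alpha_2]=[\alpha_2,[\alpha_1,\alpha_2]]$, $x_{1,2}=-\frac1{60}$, $x_{1,3}=\frac1{60}$, $x_{2,1}=\frac12$, $x_{2,2}=-\frac2{15}$, $x_{2,3}=\frac1{40}$, $z=\frac1{21600}$ and $y=\frac z2=\frac1{43200}$. The scheme is $$\Upsilon_2^{[6]}(s,\tau)=e^{-x_{1,2}\alpha_2+x_{1,3}\alpha_3+y[\alpha_2,\alpha_1,\alpha_2]}\;e^{x_{2,1}\alpha_1-x_{2,2}\alpha_2+x_{2,3}\alpha_3}\;e^{x_{2,1}\alpha_1+x_{2,2}\alpha_2+x_{2,3}\alpha_3}\;e^{x_{1,2}\alpha_2+x_{1,3}\alpha_3+y[\alpha_2,\alpha_1,\alpha_2]}.$$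 **(A) Sixth order for the semi-discretized equation.** Let $T$ be a Hermitian $N\times N$ matrix, let $V(t)$ be real diagonal $N\times N$ matrices of class $C^6$ in $t\in\mathbb R$, and let $U(t,s)$ be the exact propagator: $\partial_tU(t,s)=-i(T+V(t))U(t,s)$, $U(s,s)=I$. Then for every interval $[a,b]$ there are $C$ and $\delta>0$ such that $$\|\Upsilon_2^{[6]}(s,\tau)-U(s+\tau,s)\|\le C\tau^7\qquad\text{for all } s\in[a,b],\ 0<\tau\le\delta.$$ **(B) Coordinates.** Let $\mu>0$, $T=-\frac{\Delta}{2\mu}$, and let $V(x,t)$ be real, smooth on $\mathbb R^d\times\mathbb R$ and $L_i$-periodic in $x_i$ ($L_i>0$), acting by multiplication. As operators on smooth complex $L$-periodic functions of $x\in\mathbb R^d$, $$[\alpha_2,\alpha_1,\alpha_2]=-i\tau\cdot\tau^2\Bigl(-\frac{5}{3\mu}\,|\nabla V_3-\nabla V_1|^2\Bigr),$$ so the double commutator is diagonal (a multiplication operator), and the four exponents of $\Upsilon_2^{[6]}$ are equal to those of $$e^{-i\tau(\bar V_4+\tau^2\widetilde V)}\;e^{-i\frac\tau2(T+\bar V_3)}\;e^{-i\frac\tau2(T+\bar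 V_2)}\;e^{-i\tau(\bar V_1+\tau^2\widetilde V)},\qquad \widetilde V=-\frac{5y}{3\mu}\,|\nabla V_3-\nabla V_1|^2,$$ where $\bar V_1=a_{11}V_1+a_{12}V_2+a_{13}V_3$, $\bar V_2=a_{21}V_1+a_{22}V_2+a_{23}V_3$, $\bar V_3=a_{23}V_1+a_{22}V_2+a_{21}V_3$, $\bar V_4=a_{13}V_1+a_{12}V_2+a_{11}V_3$, with $a_{11}=\frac{10+\sqrt{15}}{180}$, $a_{12}=-\frac19$, $a_{13}=\frac{10-\sqrt{15}}{180}$, $a_{21}=\frac{15+8\sqrt{15}}{90}$, $a_{22}=\frac23$, $a_{23}=\frac{15-8\sqrt{15}}{90}$. **(C) Sixth order in coordinates.** In the setting of (B), let $e^{X}\psi$ denote the value at $r=1$ of the smooth periodic solution of $\partial_r\varphi=X\varphi$, $\varphi(0)=\psi$. Let $u(x,t)$ be a smooth $L$-periodic solution of $i\,\partial_tu=\bigl(-\frac{\Delta}{2\mu}+V(x,t)\bigr)u$, $t\in\mathbb R$. Then for every $[a,b]$ there are $C$ and $\delta>0$ such that, with the $L^2$ norm over a period cell, $$\|\Upsilon_2^{[6]}(s,\tau)u(s)-u(s+\tau)\|_{L^2}\le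 C\tau^7\qquad\text{for all } s\in[a,b],\ 0<\tau\le\delta .$$ -/

import Mathlib

open scoped ContDiff Matrix.Norms.L2Operator

noncomputable section

namespace ExpPropagator

/-! ### The three-point Gauss-Legendre nodes -/

/-- The node `c₁ = 1/2 - √15/10`. -/
def c₁ : ℝ := 1 / 2 - √15 / 10

/-- The node `c₂ = 1/2`. -/
def c₂ : ℝ := 1 / 2

/-- The node `c₃ = 1/2 + √15/10`. -/
def c₃ : ℝ := 1 / 2 + √15 / 10

/-! ### Coefficients of the scheme -/

def x₁₂ : ℝ := -(1 / 60)
def x₁₃ : ℝ := 1 / 60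
def x₂₁ : ℝ := 1 / 2
def x₂₂ : ℝ := -(2 / 15)
def x₂₃ : ℝ := 1 / 40

/-- The defect coefficient `z` of the fourth-order scheme. -/
def zCoef : ℝ := 1 / 21600

/-- The coefficient of the double commutator. -/
def yCoef : ℝ := zCoef / 2

def a₁₁ : ℝ := (10 + √15) / 180
def a₁₂ : ℝ := -(1 / 9)
def a₁₃ : ℝ := (10 - √15) / 180
def a₂₁ : ℝ := (15 + 8 * √15) / 90
def a₂₂ : ℝ := 2 / 3
def a₂₃ : ℝ := (15 - 8 * √15) / 90

/-! ### The exponents, over an arbitrary complex algebra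

`T` is the kinetic energy and `V₁ V₂ V₃` are the potential at the three nodes. The factor `-i`
of the equation `u' = -i (T + V(t)) u` is part of the `α`s. -/

section Exponents

variable {A : Type*} [Ring A] [Algebra ℂ A]

/-- `α₁ = -i τ (T + V₂)`. -/
def α₁ (τ : ℝ) (T V₂ : A) : A := (-(Complex.I * (τ : ℂ))) • (T + V₂)

/-- `α₂ = -i τ (√15/3) (V₃ - V₁)`. -/
def α₂ (τ : ℝ) (V₁ V₃ : A) : A :=
  (-(Complex.I * (τ : ℂ))) • (((√15 / 3 : ℝ) : ℂ) • (V₃ - V₁))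

/-- `α₃ = -i τ (10/3) (V₃ - 2 V₂ + V₁)`. -/
def α₃ (τ : ℝ) (V₁ V₂ V₃ : A) : A :=
  (-(Complex.I * (τ : ℂ))) • (((10 / 3 : ℝ) : ℂ) • (V₃ - (2 : ℂ) • V₂ + V₁))

/-- The double commutator `[b, a, b] = [b, [a, b]]`. -/
def doubleComm (b a : A) : A := ⁅b, ⁅a, b⁆⁆

/-- The four exponents of the scheme in terms of `α₁, α₂, α₃` and `[α₂, α₁, α₂]`.
Index `0` is the rightmost factor, the one applied first. -/
def commutatorExponent (τ : ℝ) (T V₁ V₂ V₃ : A) : Fin 4 → A :=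
  ![(x₁₂ : ℂ) • α₂ τ V₁ V₃ + (x₁₃ : ℂ) • α₃ τ V₁ V₂ V₃
      + (yCoef : ℂ) • doubleComm (α₂ τ V₁ V₃) (α₁ τ T V₂),
    (x₂₁ : ℂ) • α₁ τ T V₂ + (x₂₂ : ℂ) • α₂ τ V₁ V₃ + (x₂₃ : ℂ) • α₃ τ V₁ V₂ V₃,
    (x₂₁ : ℂ) • α₁ τ T V₂ - (x₂₂ : ℂ) • α₂ τ V₁ V₃ + (x₂₃ : ℂ) • α₃ τ V₁ V₂ V₃,
    -((x₁₂ : ℂ) • α₂ τ V₁ V₃) + (x₁₃ : ℂ) • α₃ τ V₁ V₂ V₃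
      + (yCoef : ℂ) • doubleComm (α₂ τ V₁ V₃) (α₁ τ T V₂)]

/-- The four exponents
`-iτ(V̄₁ + τ²W), -i(τ/2)(T + V̄₂), -i(τ/2)(T + V̄₃), -iτ(V̄₄ + τ²W)`,
where `V̄₁, …, V̄₄` are the linear combinations of `V₁, V₂, V₃` with the coefficients `a`.
Index `0` is the rightmost factor, the one applied first. -/
def coordinateExponent (τ : ℝ) (T V₁ V₂ V₃ W : A) : Fin 4 → A :=
  ![(-(Complex.I * (τ : ℂ))) •
      (((a₁₁ : ℂ) • V₁ + (a₁₂ : ℂ) • V₂ + (a₁₃ : ℂ) • V₃) + ((τ : ℂ) ^ 2) • W),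
    (-(Complex.I * ((τ : ℂ) / 2))) •
      (T + ((a₂₁ : ℂ) • V₁ + (a₂₂ : ℂ) • V₂ + (a₂₃ : ℂ) • V₃)),
    (-(Complex.I * ((τ : ℂ) / 2))) •
      (T + ((a₂₃ : ℂ) • V₁ + (a₂₂ : ℂ) • V₂ + (a₂₁ : ℂ) • V₃)),
    (-(Complex.I * (τ : ℂ))) •
      (((a₁₃ : ℂ) • V₁ + (a₁₂ : ℂ) • V₂ + (a₁₁ : ℂ) • V₃) + ((τ : ℂ) ^ 2) • W)]

end Exponents

/-! ### The semi-discretized equation `i u' = (T + V(t)) u` in `ℂᴺ` -/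

section Discrete

variable {N : ℕ}

/-- The diagonal matrix of the potential at time `t`. -/
def potMatrix (V : ℝ → Fin N → ℝ) (t : ℝ) : Matrix (Fin N) (Fin N) ℂ :=
  Matrix.diagonal fun k => (V t k : ℂ)

/-- `U t s` is the exact propagator from time `s` to time `t`. -/
def IsPropagator (T : Matrix (Fin N) (Fin N) ℂ) (V : ℝ → Fin N → ℝ)
    (U : ℝ → ℝ → Matrix (Fin N) (Fin N) ℂ) : Prop :=
  ∀ s, U s s = 1 ∧
    ∀ t, HasDerivAt (fun r => U r s) (-(Complex.I • ((T + potMatrix V t) * U t s))) t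

/-- One step of length `τ` from time `s`: the product of the four matrix exponentials. -/
def matrixStep (T : Matrix (Fin N) (Fin N) ℂ) (V : ℝ → Fin N → ℝ) (s τ : ℝ) :
    Matrix (Fin N) (Fin N) ℂ :=
  let X := commutatorExponent τ T (potMatrix V (s + c₁ * τ)) (potMatrix V (s + c₂ * τ))
    (potMatrix V (s + c₃ * τ))
  NormedSpace.exp (X 3) * NormedSpace.exp (X 2) * NormedSpace.exp (X 1) * NormedSpace.exp (X 0)

end Discrete

/-! ### The Schrödinger equation with periodic boundary conditions -/

section Continuous

variable {d : ℕ}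

/-- Smooth functions on `ℝᵈ` that are `L i`-periodic in the `i`-th coordinate. -/
def smoothPeriodic (𝕜 : Type*) [RCLike 𝕜] (L : Fin d → ℝ) :
    Submodule 𝕜 (EuclideanSpace ℝ (Fin d) → 𝕜) where
  carrier := {f | ContDiff ℝ ∞ f ∧ ∀ i x, f (x + EuclideanSpace.single i (L i)) = f x}
  add_mem' := by
    rintro f g ⟨hf, hf'⟩ ⟨hg, hg'⟩
    exact ⟨hf.add hg, fun i x => by simp [hf', hg']⟩
  zero_mem' := ⟨contDiff_const, fun _ _ => rfl⟩
  smul_mem' := by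
    rintro c f ⟨hf, hf'⟩
    exact ⟨contDiff_const.mul hf, fun i x => by simp [hf']⟩

/-- Joint smoothness in time and space of a time-dependent function. -/
def JointlySmooth {𝕜 : Type*} [RCLike 𝕜] {L : Fin d → ℝ} (f : ℝ → smoothPeriodic 𝕜 L) : Prop :=
  ContDiff ℝ ∞ fun p : ℝ × EuclideanSpace ℝ (Fin d) => (f p.1).1 p.2

/-- The operator of multiplication by a real function. -/
def mulOp {L : Fin d → ℝ} (w : smoothPeriodic ℝ L) : Module.End ℂ (smoothPeriodic ℂ L) where
  toFun ψ := ⟨fun x => (w.1 x : ℂ) * ψ.1 x,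
    (Complex.ofRealCLM.contDiff.comp w.2.1).mul ψ.2.1, fun i x => by
      simp only [w.2.2 i x, ψ.2.2 i x]⟩
  map_add' ψ φ := by
    ext x
    simp [mul_add]
  map_smul' c ψ := by
    ext x
    simp [mul_left_comm]

theorem contDiff_laplacian {F : Type*} [NormedAddCommGroup F] [NormedSpace ℝ F]
    {f : EuclideanSpace ℝ (Fin d) → F} (hf : ContDiff ℝ ∞ f) :
    ContDiff ℝ ∞ (Laplacian.laplacian f) := by
  rw [InnerProductSpace.laplacian_eq_iteratedFDeriv_orthonormalBasis f
    (EuclideanSpace.basisFun (Fin d) ℝ)]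
  refine ContDiff.sum fun i _ => ?_
  have h : ContDiff ℝ ∞ (iteratedFDeriv ℝ 2 f) :=
    hf.iteratedFDeriv_right (m := ∞) (i := 2) (by norm_cast)
  exact (ContinuousMultilinearMap.apply ℝ (fun _ : Fin 2 => EuclideanSpace ℝ (Fin d)) F
    ![EuclideanSpace.basisFun (Fin d) ℝ i, EuclideanSpace.basisFun (Fin d) ℝ i]).contDiff.comp h

theorem laplacian_add_right {F : Type*} [NormedAddCommGroup F] [NormedSpace ℝ F]
    {f : EuclideanSpace ℝ (Fin d) → F} {v : EuclideanSpace ℝ (Fin d)}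
    (hf : ∀ x, f (x + v) = f x) (x : EuclideanSpace ℝ (Fin d)) :
    Laplacian.laplacian f (x + v) = Laplacian.laplacian f x := by
  have hf' : (fun x => f (x + v)) = f := funext hf
  have h := iteratedFDeriv_comp_add_right (𝕜 := ℝ) (f := f) 2 v x
  rw [hf'] at h
  simp only [InnerProductSpace.laplacian_eq_iteratedFDeriv_orthonormalBasis f
    (EuclideanSpace.basisFun (Fin d) ℝ), ← h]

/-- The kinetic energy `-Δ / (2μ)`. -/
def kineticOp (L : Fin d → ℝ) (μ : ℝ) : Module.End ℂ (smoothPeriodic ℂ L) where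
  toFun ψ := ⟨fun x => (-(1 / (2 * μ) : ℝ) : ℂ) * Laplacian.laplacian ψ.1 x,
    contDiff_const.mul (contDiff_laplacian ψ.2.1), fun i x => by
      simp only [laplacian_add_right (ψ.2.2 i)]⟩
  map_add' ψ φ := by
    ext x
    have h := (ψ.2.1.of_le (by norm_cast)).contDiffAt (x := x) |>.laplacian_add
      ((φ.2.1.of_le (by norm_cast)).contDiffAt (x := x))
    simp [h, mul_add]
  map_smul' c ψ := by
    ext x
    have h := InnerProductSpace.laplacian_smul c
      ((ψ.2.1.of_le (by norm_cast)).contDiffAt (x := x) : ContDiffAt ℝ 2 ψ.1 x)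
    simp [h, mul_left_comm]

/-- The function `|∇w₃ - ∇w₁|²`. -/
def gradDiffSq {L : Fin d → ℝ} (w₁ w₃ : smoothPeriodic ℝ L) : smoothPeriodic ℝ L :=
  ⟨fun x => ‖gradient w₃.1 x - gradient w₁.1 x‖ ^ 2, by
    have h : ∀ w : smoothPeriodic ℝ L, ContDiff ℝ ∞ (gradient w.1) := fun w =>
      (InnerProductSpace.toDual ℝ (EuclideanSpace ℝ (Fin d))).symm.contDiff.comp
        (w.2.1.fderiv_right (m := ∞) (by norm_cast))
    have h' : ∀ (w : smoothPeriodic ℝ L) (i : Fin d) (x : EuclideanSpace ℝ (Fin d)),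
        gradient w.1 (x + EuclideanSpace.single i (L i)) = gradient w.1 x := fun w i x => by
      have hw : (fun x => w.1 (x + EuclideanSpace.single i (L i))) = w.1 := funext (w.2.2 i)
      have := fderiv_comp_add_right (𝕜 := ℝ) (f := w.1) (x := x) (EuclideanSpace.single i (L i))
      rw [hw] at this
      simp only [gradient, this]
    exact ⟨((h w₃).sub (h w₁)).norm_sq ℝ, fun i x => by simp only [h']⟩⟩

/-- The modified potential `-(5 yCoef / (3μ)) |∇V₃ - ∇V₁|²`. -/
def modifiedPotential {L : Fin d → ℝ} (μ : ℝ) (w₁ w₃ : smoothPeriodic ℝ L) : smoothPeriodic ℝ L :=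
  (-(5 * yCoef / (3 * μ))) • gradDiffSq w₁ w₃

/-- `u` is a smooth solution of `i ∂u/∂t = (-Δ/(2μ) + V(x,t)) u`, for all times. -/
def IsSolution {L : Fin d → ℝ} (μ : ℝ) (V : ℝ → smoothPeriodic ℝ L)
    (u : ℝ → smoothPeriodic ℂ L) : Prop :=
  JointlySmooth u ∧ ∀ t x, HasDerivAt (fun r => (u r).1 x)
    (-(Complex.I * ((kineticOp L μ + mulOp (V t)) (u t)).1 x)) t

/-- `ψ' = e^X ψ`: the path `φ(r) = e^{rX} ψ`, which is the smooth solution of `φ' = X φ`,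
`φ(0) = ψ`, takes the value `ψ'` at `r = 1`. -/
def ExpMaps {L : Fin d → ℝ} (X : Module.End ℂ (smoothPeriodic ℂ L))
    (ψ ψ' : smoothPeriodic ℂ L) : Prop :=
  ∃ φ : ℝ → smoothPeriodic ℂ L, JointlySmooth φ ∧ φ 0 = ψ ∧ φ 1 = ψ' ∧
    ∀ r x, HasDerivAt (fun r' => (φ r').1 x) ((X (φ r)).1 x) r

/-- `ψ' = e^{X 3} e^{X 2} e^{X 1} e^{X 0} ψ`. -/
def StepMaps {L : Fin d → ℝ} (X : Fin 4 → Module.End ℂ (smoothPeriodic ℂ L))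
    (ψ ψ' : smoothPeriodic ℂ L) : Prop :=
  ∃ ψ₁ ψ₂ ψ₃, ExpMaps (X 0) ψ ψ₁ ∧ ExpMaps (X 1) ψ₁ ψ₂ ∧ ExpMaps (X 2) ψ₂ ψ₃ ∧
    ExpMaps (X 3) ψ₃ ψ'

/-- The `L²` norm over one period cell. -/
def cellNorm {L : Fin d → ℝ} (ψ : smoothPeriodic ℂ L) : ℝ :=
  √(∫ x in {x : EuclideanSpace ℝ (Fin d) | ∀ i, x i ∈ Set.Ico 0 (L i)}, ‖ψ.1 x‖ ^ 2)

end Continuous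

end ExpPropagator

end

open ExpPropagator

/-! Everything is expanded at the midpoint `m = s + τ/2` of the step. Let `a j` be the scaled time
derivatives of the generator `-i(T + V)` at `m`, and let `Uₖ` be the polynomials in them for which
`Uₖ u` is the `k`-th scaled derivative of a solution `u`. With `F(h) = ∑_{k ≤ 6} (hτ)ᵏ Uₖ`, the
exact solution satisfies `u(s) = F(-1/2) u(m) + O(τ⁷)` and `u(s + τ) = F(1/2) u(m) + O(τ⁷)`. Sixth
order therefore amounts to `S · F(-1/2) = F(1/2)` modulo `τ⁷`, where `S` is the product of the four
exponentials; no inverse and no logarithm is needed.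

The congruence is an identity in noncommuting letters `τ^(j+1) a j` of weight `j + 1`, cut off above
weight six. The only relation used is that the letters with `j ≥ 1` commute, being derivatives of
the potential. The nodes lie symmetrically about `m` and `(√15/10)² = 3/20`, so all coefficients are
rational and `WordPoly.orderDefect_eq_zero` settles the identity by a finite computation.
`dvd_truncatedStep_sub_flowSum` moves it to any complex algebra with a central element `t`, as
divisibility by `t⁷`.

That algebra is chosen so that divisibility carries the analysis. For matrices it consists of
bounded families in `(m, τ)`, where divisibility by the `n`-th power of the step is the estimate
`O(τⁿ)`; Taylor remainders and the unitarity of the propagator finish the proof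
(`matrixStep_order_six`).

In coordinates `T` is unbounded, and the algebra consists of operator families that preserve smooth
families of functions. Each such family applied to `u(m)` is smooth, hence bounded for `(m, τ)` in a
compact set: the smoothness of `u` pays for the derivatives. An exponential is compared with its
Taylor polynomial by an `L²` energy estimate that needs only the skewness of the true exponent
(`ExpMaps.sqNorm_sub_expSum_le`). Truncating the expansions of the potential changes the exponents
by multiplication operators of size `O(τ⁷)` (`exists_pointwiseBound_sub_truncatedExponent`), because
the double commutator contains no derivatives: `[w, [T, w]] = |∇w|²/μ`. That formula also gives the
coordinate form of the scheme. -/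

noncomputable section

namespace ExpPropagator

/-! ### Noncommutative polynomials of weight at most six

A polynomial is a list of words with rational coefficients. The letter `i` has weight `i + 1`, and the
letters other than `0` commute with each other. -/

abbrev WordPoly := List (List ℕ × ℚ)

namespace WordPoly

def weight : List ℕ → ℕ
  | [] => 0
  | l :: w => (l + 1) + weight w

/-- The letter `0` acts as a barrier: it is never moved and nothing passes it. Normalizing a word
thus sorts each maximal block of nonzero letters. -/
def insertLetter (l : ℕ) : List ℕ → List ℕ
  | [] => [l]
  | m :: w => if l = 0 ∨ m = 0 ∨ l ≤ m then l :: m :: w else m :: insertLetter l w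

def normalForm : List ℕ → List ℕ
  | [] => []
  | l :: w => insertLetter l (normalForm w)

/-- Like terms are merged, but a word whose coefficient cancels stays in the list. A polynomial is
therefore tested for zero by its coefficients, not by emptiness. -/
def addTerm (w : List ℕ) (c : ℚ) : WordPoly → WordPoly
  | [] => [(w, c)]
  | (v, d) :: p => if w = v then (v, c + d) :: p else (v, d) :: addTerm w c p

def add : WordPoly → WordPoly → WordPoly
  | [], q => q
  | (w, c) :: p, q => addTerm w c (add p q)

def smul (c : ℚ) : WordPoly → WordPoly
  | [] => []
  | (w, d) :: p => (w, c * d) :: smul c p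

def mulTerm (w : List ℕ) (c : ℚ) : WordPoly → WordPoly
  | [] => []
  | (v, d) :: p =>
    if weight w + weight v ≤ 6 then addTerm (normalForm (w ++ v)) (c * d) (mulTerm w c p)
    else mulTerm w c p

def mul : WordPoly → WordPoly → WordPoly
  | [], _ => []
  | (w, c) :: p, q => add (mulTerm w c q) (mul p q)

def one : WordPoly := [([], 1)]

def letter (i : ℕ) : WordPoly := [([i], 1)]

def comm (p q : WordPoly) : WordPoly := add (mul p q) (smul (-1) (mul q p))

/-- The exponential sum up to degree six, in Horner form, started at degree `k`. -/
def expHorner (p : WordPoly) : ℕ → ℕ → WordPoly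
  | 0, _ => one
  | n + 1, k => add one (smul (1 / (k + 1)) (mul p (expHorner p n (k + 1))))

/-- `∑ j, (letter (i + j)) * l j`. -/
def convLetters : ℕ → List WordPoly → WordPoly
  | _, [] => []
  | i, p :: l => add (mul (letter i) p) (convLetters (i + 1) l)

/-- The list `[Uₙ, …, U₀]` of the coefficients of the flow generated by the letters. -/
def flowList : ℕ → List WordPoly
  | 0 => [one]
  | n + 1 => smul (1 / (n + 1)) (convLetters 0 (flowList n)) :: flowList n

/-- `∑ h ^ k Uₖ` from the list `[Uₙ, …, U₀]`. -/
def flowSum (h : ℚ) : List WordPoly → WordPoly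
  | [] => []
  | p :: l => add (smul (h ^ l.length) p) (flowSum h l)

variable {Q : Type*} [Ring Q] [Algebra ℂ Q] (y : ℕ → Q)

def eval : WordPoly → Q
  | [] => 0
  | (w, c) :: p => (c : ℂ) • (w.map y).prod + eval p

section

variable {y}

omit [Algebra ℂ Q] in
theorem prod_insertLetter (hc : ∀ i j, i ≠ 0 → j ≠ 0 → Commute (y i) (y j)) (l : ℕ) (w : List ℕ) :
    ((insertLetter l w).map y).prod = y l * (w.map y).prod := by
  induction w with
  | nil => simp [insertLetter]
  | cons m w ih =>
    simp only [insertLetter]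
    split_ifs with h
    · simp
    · push Not at h
      simp only [List.map_cons, List.prod_cons, ih]
      rw [← mul_assoc, ← mul_assoc, (hc m l h.2.1 h.1).eq]

omit [Algebra ℂ Q] in
theorem prod_normalForm (hc : ∀ i j, i ≠ 0 → j ≠ 0 → Commute (y i) (y j)) (w : List ℕ) :
    ((normalForm w).map y).prod = (w.map y).prod := by
  induction w with
  | nil => rfl
  | cons l w ih => simp [normalForm, prod_insertLetter hc, ih]

theorem eval_addTerm (w : List ℕ) (c : ℚ) (p : WordPoly) :
    eval y (addTerm w c p) = (c : ℂ) • (w.map y).prod + eval y p := by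
  induction p with
  | nil => rfl
  | cons a p ih =>
    obtain ⟨v, d⟩ := a
    simp only [addTerm]
    split_ifs with h
    · subst h
      simp only [eval, Rat.cast_add, add_smul]
      abel
    · simp only [eval, ih]
      abel

theorem eval_add (p q : WordPoly) : eval y (add p q) = eval y p + eval y q := by
  induction p with
  | nil => simp [add, eval]
  | cons a p ih =>
    simp only [add, eval, eval_addTerm, ih]
    abel

theorem eval_smul (c : ℚ) (p : WordPoly) : eval y (smul c p) = (c : ℂ) • eval y p := by
  induction p with
  | nil => simp [smul, eval]
  | cons a p ih => simp [smul, eval, ih, smul_smul]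

theorem eval_one : eval y one = 1 := by simp [one, eval]

theorem eval_letter (i : ℕ) : eval y (letter i) = y i := by simp [letter, eval]

theorem weight_append (w v : List ℕ) : weight (w ++ v) = weight w + weight v := by
  induction w with
  | nil => simp [weight]
  | cons l w ih => simp [weight, ih, add_assoc]

/-- The letters satisfy the relations that the computation uses. -/
structure Admissible (y : ℕ → Q) : Prop where
  commute : ∀ i j, i ≠ 0 → j ≠ 0 → Commute (y i) (y j)
  nil : ∀ w, 7 ≤ weight w → (w.map y).prod = 0

variable (hy : Admissible y)
include hy

/-- Sorting the product word is harmless by `commute`, and a discarded word has weight at least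
seven, so it vanishes by `nil`. -/
theorem Admissible.eval_mulTerm (w : List ℕ) (c : ℚ) (p : WordPoly) :
    eval y (mulTerm w c p) = ((c : ℂ) • (w.map y).prod) * eval y p := by
  induction p with
  | nil => simp [mulTerm, eval]
  | cons a p ih =>
    obtain ⟨v, d⟩ := a
    have hwv : (w.map y).prod * (v.map y).prod = ((w ++ v).map y).prod := by simp
    simp only [mulTerm]
    split_ifs with h
    · simp only [eval, eval_addTerm, prod_normalForm hy.commute, ih, mul_add, smul_mul_smul_comm, hwv,
        Rat.cast_mul]
    · rw [ih, eval, mul_add, smul_mul_smul_comm, hwv, hy.nil (w ++ v) (by rw [weight_append]; omega)]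
      simp

theorem Admissible.eval_mul (p q : WordPoly) : eval y (mul p q) = eval y p * eval y q := by
  induction p with
  | nil => simp [mul, eval]
  | cons a p ih => simp only [mul, eval, eval_add, hy.eval_mulTerm, ih, add_mul]

theorem Admissible.eval_comm (p q : WordPoly) : eval y (comm p q) = ⁅eval y p, eval y q⁆ := by
  simp [comm, eval_add, eval_smul, hy.eval_mul, Ring.lie_def, sub_eq_add_neg]

end

end WordPoly

/-- The exponential sum up to degree six. -/
def expSum {R : Type*} [Ring R] [Algebra ℂ R] (X : R) : R :=
  ∑ k ∈ Finset.range 7, ((k.factorial : ℂ)⁻¹) • X ^ k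

/-- The Taylor coefficients of the flow of `u' = (∑ hʲ aⱼ) u`. -/
def flowCoeff {R : Type*} [Ring R] [Algebra ℂ R] (a : ℕ → R) : ℕ → R
  | 0 => 1
  | k + 1 => ((k + 1 : ℂ)⁻¹) • ∑ j : Fin (k + 1), a j * flowCoeff a (k - j)

/-- The Taylor polynomial of degree six of the flow, at the scaled time `h • t`. -/
def flowSum {R : Type*} [Ring R] [Algebra ℂ R] (a : ℕ → R) (t : R) (h : ℂ) : R :=
  ∑ k ∈ Finset.range 7, h ^ k • (t ^ k * flowCoeff a k)

namespace WordPoly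

variable {Q : Type*} [Ring Q] [Algebra ℂ Q] {y : ℕ → Q} (hy : Admissible y)
include hy

theorem Admissible.eval_expHorner (p : WordPoly) :
    eval y (expHorner p 6 0) = expSum (eval y p) := by
  simp only [expHorner, eval_add, eval_smul, hy.eval_mul, eval_one, expSum, Finset.sum_range_succ,
    Finset.sum_range_zero, Nat.factorial]
  generalize eval y p = X
  push_cast
  simp only [mul_add, smul_add, mul_smul_comm, smul_smul, mul_one, pow_succ, pow_zero, one_mul,
    mul_assoc]
  norm_num
  abel

theorem Admissible.eval_convLetters (i : ℕ) (l : List WordPoly) :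
    eval y (convLetters i l) = ∑ j : Fin l.length, y (i + j) * eval y (l.get j) := by
  induction l generalizing i with
  | nil => simp [convLetters, eval]
  | cons p l ih =>
    simp only [convLetters, eval_add, hy.eval_mul, eval_letter, ih, List.length_cons,
      Fin.sum_univ_succ]
    simp [add_assoc, add_comm 1]

omit hy in
theorem length_flowList (n : ℕ) : (flowList n).length = n + 1 := by
  induction n with
  | zero => rfl
  | succ n ih => simp [flowList, ih]

theorem Admissible.eval_flowList (n : ℕ) (j : ℕ) (hj : j < (flowList n).length) :
    eval y ((flowList n)[j]) = flowCoeff y (n - j) := by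
  induction n generalizing j with
  | zero =>
    have : j = 0 := by simp [flowList] at hj; exact hj
    subst this
    simp [flowList, eval_one, flowCoeff]
  | succ n ih =>
    cases j with
    | zero =>
      simp only [flowList, List.getElem_cons_zero, eval_smul, hy.eval_convLetters, flowCoeff,
        Nat.sub_zero]
      push_cast
      rw [one_div]
      congr 1
      rw [← Fin.sum_congr' _ (length_flowList n)]
      refine Finset.sum_congr rfl fun j _ => ?_
      simp [ih]
    | succ j =>
      simp only [flowList, List.getElem_cons_succ, ih, Nat.succ_sub_succ_eq_sub]

theorem Admissible.eval_flowSum (h : ℚ) :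
    eval y (flowSum h (flowList 6)) = ∑ k ∈ Finset.range 7, (h : ℂ) ^ k • flowCoeff y k := by
  have key : ∀ n, eval y (flowSum h (flowList n)) =
      ∑ k ∈ Finset.range (n + 1), (h : ℂ) ^ k • flowCoeff y k := by
    intro n
    induction n with
    | zero =>
      simp [flowList, flowSum, eval_add, eval_smul, eval_one, flowCoeff, eval]
    | succ n ih =>
      have h0 := hy.eval_flowList (n + 1) 0 (by simp [flowList])
      simp only [flowList, List.getElem_cons_zero, Nat.sub_zero] at h0
      rw [Finset.sum_range_succ, ← ih]
      simp only [flowList, flowSum, eval_add, eval_smul (h ^ _), h0, length_flowList]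
      push_cast
      rw [add_comm]
  exact key 6

end WordPoly

namespace WordPoly

/-- The generators `α₁, α₂, α₃` as words, for the Taylor expansion of the potential at the midpoint. -/
def alpha₁ : WordPoly := letter 0
-- The coefficients are powers of `(√15/10)² = 3/20`. The prefactor `√15/3` of the odd difference
-- and `10/3` of the even one normalize the leading coefficients to `1`, here and in `alpha₃`. The
-- next letters would have weight eight and seven.
def alpha₂ : WordPoly := add (letter 1) (add (smul (3 / 20) (letter 3)) (smul (9 / 400) (letter 5)))
def alpha₃ : WordPoly := add (letter 2) (smul (3 / 20) (letter 4))

/-- The outer exponents, with `ε = 1` for the factor applied first and `ε = -1` for the last. -/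
def outer (ε : ℚ) : WordPoly :=
  add (add (smul (-(1 / 60) * ε) alpha₂) (smul (1 / 60) alpha₃))
    (smul (1 / 43200) (comm alpha₂ (comm alpha₁ alpha₂)))

/-- The inner exponents. -/
def inner (ε : ℚ) : WordPoly :=
  add (add (smul (1 / 2) alpha₁) (smul (-(2 / 15) * ε) alpha₂)) (smul (1 / 40) alpha₃)

/-- The scheme is applied to the flow from the midpoint back to the start of the step and compared
with the flow from the midpoint to the end. -/
def orderDefect : WordPoly :=
  add (mul (expHorner (outer (-1)) 6 0) (mul (expHorner (inner (-1)) 6 0)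
    (mul (expHorner (inner 1) 6 0) (mul (expHorner (outer 1) 6 0)
      (flowSum (-(1 / 2)) (flowList 6))))))
    (smul (-1) (flowSum (1 / 2) (flowList 6)))

/-- These are all the order conditions through weight six, for the given rational coefficients and
modulo commutation of the nonzero letters. -/
theorem orderDefect_eq_zero : (orderDefect.all fun p => p.2 == 0) = true := by
  decide +kernel

end WordPoly

/-! ### The truncated scheme -/

theorem WordPoly.eval_eq_zero {Q : Type*} [Ring Q] [Algebra ℂ Q] (y : ℕ → Q) (p : WordPoly)
    (hp : (p.all fun q => q.2 == 0) = true) : p.eval y = 0 := by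
  induction p with
  | nil => rfl
  | cons a p ih =>
    simp only [List.all_cons, Bool.and_eq_true, beq_iff_eq] at hp
    simp [WordPoly.eval, hp.1, ih hp.2]

/-- The exponents of the scheme as functions of `α₁, α₂, α₃`. -/
def schemeExponent {A : Type*} [Ring A] [Algebra ℂ A] (α₁ α₂ α₃ : A) : Fin 4 → A :=
  ![(x₁₂ : ℂ) • α₂ + (x₁₃ : ℂ) • α₃ + (yCoef : ℂ) • doubleComm α₂ α₁,
    (x₂₁ : ℂ) • α₁ + (x₂₂ : ℂ) • α₂ + (x₂₃ : ℂ) • α₃,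
    (x₂₁ : ℂ) • α₁ - (x₂₂ : ℂ) • α₂ + (x₂₃ : ℂ) • α₃,
    -((x₁₂ : ℂ) • α₂) + (x₁₃ : ℂ) • α₃ + (yCoef : ℂ) • doubleComm α₂ α₁]

theorem commutatorExponent_eq {A : Type*} [Ring A] [Algebra ℂ A] (τ : ℝ) (T V₁ V₂ V₃ : A) :
    commutatorExponent τ T V₁ V₂ V₃ =
      schemeExponent (α₁ τ T V₂) (α₂ τ V₁ V₃) (α₃ τ V₁ V₂ V₃) := rfl

/-- The truncated expansion of `α₂` at the midpoint, for `a j` the Taylor coefficients of the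
generator. -/
def midpointAlpha₂ {R : Type*} [Ring R] [Algebra ℂ R] (t : R) (a : ℕ → R) : R :=
  t ^ 2 * a 1 + ((3 / 20 : ℂ) • (t ^ 4 * a 3) + (9 / 400 : ℂ) • (t ^ 6 * a 5))

/-- The truncated expansion of `α₃` at the midpoint. -/
def midpointAlpha₃ {R : Type*} [Ring R] [Algebra ℂ R] (t : R) (a : ℕ → R) : R :=
  t ^ 3 * a 2 + (3 / 20 : ℂ) • (t ^ 5 * a 4)

/-- The scheme with exponentials replaced by their sums up to degree six, applied to `Y`. -/
def truncatedStep {R : Type*} [Ring R] [Algebra ℂ R] (X : Fin 4 → R) (Y : R) : R :=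
  expSum (X 3) * (expSum (X 2) * (expSum (X 1) * (expSum (X 0) * Y)))

section Hom

variable {R Q : Type*} [Ring R] [Algebra ℂ R] [Ring Q] [Algebra ℂ Q] (f : R →ₐ[ℂ] Q)

theorem map_expSum (X : R) : f (expSum X) = expSum (f X) := by
  simp [expSum, map_sum]

theorem map_schemeExponent (α₁ α₂ α₃ : R) (i : Fin 4) :
    f (schemeExponent α₁ α₂ α₃ i) = schemeExponent (f α₁) (f α₂) (f α₃) i := by
  fin_cases i <;> simp [schemeExponent, doubleComm, Ring.lie_def, -Complex.coe_smul]

theorem map_truncatedStep (X : Fin 4 → R) (Y : R) :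
    f (truncatedStep X Y) = truncatedStep (fun i => f (X i)) (f Y) := by
  simp [truncatedStep, map_expSum]

theorem map_flowCoeff (a : ℕ → R) (k : ℕ) : f (flowCoeff a k) = flowCoeff (fun j => f (a j)) k := by
  induction k using Nat.strong_induction_on with
  | _ k ih =>
    cases k with
    | zero => simp [flowCoeff]
    | succ k =>
      simp only [flowCoeff, map_smul, map_sum, map_mul]
      congr 1
      exact Finset.sum_congr rfl fun j _ => by rw [ih _ (by omega)]

end Hom

/-- The `k`-th flow coefficient is homogeneous of weight `k` when `a j` has weight `j + 1`, so
powers of a central element can be absorbed into the letters. -/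
theorem flowCoeff_scale {R : Type*} [Ring R] [Algebra ℂ R] (t : R) (ht : ∀ r, Commute t r)
    (a : ℕ → R) (k : ℕ) :
    t ^ k * flowCoeff a k = flowCoeff (fun j => t ^ (j + 1) * a j) k := by
  induction k using Nat.strong_induction_on with
  | _ k ih =>
    cases k with
    | zero => simp [flowCoeff]
    | succ k =>
      simp only [flowCoeff, mul_smul_comm, Finset.mul_sum]
      congr 1
      refine Finset.sum_congr rfl fun j _ => ?_
      rw [← ih (k - j) (by omega), mul_assoc, ← mul_assoc (a j), ← ((ht (a j)).pow_left _).eq,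
        ← mul_assoc, ← mul_assoc, ← mul_assoc, ← pow_add]
      congr 3
      have := j.2
      omega

/-- In a ring with a central nilpotent element, the scheme reproduces the flow. -/
theorem WordPoly.Admissible.truncatedStep_eq {Q : Type*} [Ring Q] [Algebra ℂ Q] {y : ℕ → Q}
    (hy : WordPoly.Admissible y) :
    truncatedStep (schemeExponent (y 0) (y 1 + ((3 / 20 : ℂ) • y 3 + (9 / 400 : ℂ) • y 5))
        (y 2 + (3 / 20 : ℂ) • y 4)) (∑ k ∈ Finset.range 7, (-(1 / 2) : ℂ) ^ k • flowCoeff y k) =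
      ∑ k ∈ Finset.range 7, (1 / 2 : ℂ) ^ k • flowCoeff y k := by
  have h := WordPoly.eval_eq_zero y _ WordPoly.orderDefect_eq_zero
  have h1 : (WordPoly.alpha₁).eval y = y 0 := WordPoly.eval_letter 0
  have h2 : (WordPoly.alpha₂).eval y = y 1 + ((3 / 20 : ℂ) • y 3 + (9 / 400 : ℂ) • y 5) := by
    simp [WordPoly.alpha₂, WordPoly.eval_add, WordPoly.eval_smul, WordPoly.eval_letter]
  have h3 : (WordPoly.alpha₃).eval y = y 2 + (3 / 20 : ℂ) • y 4 := by
    simp [WordPoly.alpha₃, WordPoly.eval_add, WordPoly.eval_smul, WordPoly.eval_letter]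
  simp only [WordPoly.orderDefect, WordPoly.eval_add, WordPoly.eval_smul, hy.eval_mul,
    hy.eval_expHorner, hy.eval_flowSum, WordPoly.outer, WordPoly.inner, hy.eval_comm, h1, h2, h3] at h
  push_cast at h
  rw [← sub_eq_zero, ← h]
  generalize y 1 + ((3 / 20 : ℂ) • y 3 + (9 / 400 : ℂ) • y 5) = β₂
  generalize y 2 + (3 / 20 : ℂ) • y 4 = β₃
  simp only [truncatedStep, schemeExponent, Matrix.cons_val, x₁₂, x₁₃, x₂₁, x₂₂, x₂₃, yCoef, zCoef,
    doubleComm]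
  push_cast
  rw [neg_one_smul, ← sub_eq_add_neg]
  norm_num [sub_eq_add_neg, neg_smul]

/-- Divisibility by `t ^ 7` is equality in the quotient by the ideal of `t ^ 7`. There the images of
`t ^ (j + 1) * a j` are admissible letters and the generators coincide with their truncated
expansions, so the word identity applies. -/
theorem dvd_truncatedStep_sub_flowSum {R : Type*} [Ring R] [Algebra ℂ R] (t : R)
    (ht : ∀ r, Commute t r) (a : ℕ → R) (ha : ∀ i j, i ≠ 0 → j ≠ 0 → Commute (a i) (a j))
    {α₁ α₂ α₃ : R} (h₁ : t ^ 7 ∣ α₁ - t * a 0) (h₂ : t ^ 7 ∣ α₂ - midpointAlpha₂ t a)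
    (h₃ : t ^ 7 ∣ α₃ - midpointAlpha₃ t a) :
    t ^ 7 ∣ truncatedStep (schemeExponent α₁ α₂ α₃) (flowSum a t (-(1 / 2)))
      - flowSum a t (1 / 2) := by
  let I : Ideal R := Ideal.span {t ^ 7}
  have hmem : ∀ x, x ∈ I ↔ t ^ 7 ∣ x := fun x => by
    rw [Ideal.mem_span_singleton']
    exact ⟨fun ⟨c, hc⟩ => ⟨c, by rw [← hc, ((ht c).pow_left 7).eq]⟩,
      fun ⟨c, hc⟩ => ⟨c, by rw [hc, ((ht c).pow_left 7).eq]⟩⟩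
  -- The span is a left ideal; centrality of `t` makes it two-sided, so that the quotient is a ring.
  have : I.IsTwoSided := ⟨fun {x} b hx => by
    rw [hmem] at hx ⊢
    exact hx.mul_right b⟩
  let f : R →ₐ[ℂ] R ⧸ I := Ideal.Quotient.mkₐ ℂ I
  have hf : ∀ x y, t ^ 7 ∣ x - y ↔ f x = f y := fun x y => by
    rw [← hmem]
    exact Ideal.Quotient.eq.symm
  have hft : f t ^ 7 = 0 := by
    have := (hf (t ^ 7) 0).1 (by simp)
    simpa using this
  have hc : ∀ r, Commute (f t) (f r) := fun r => (ht r).map f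
  set y : ℕ → R ⧸ I := fun j => f (t ^ (j + 1) * a j) with hyd
  have hy : WordPoly.Admissible y := by
    refine ⟨fun i j hi hj => ?_, fun w hw => ?_⟩
    · refine Commute.map ?_ f
      exact (((ht _).pow_left _)).mul_left (((ht _).pow_left _).symm.mul_right (ha i j hi hj))
    -- Each letter `l` contributes `l + 1` factors of the central element, which collect at the
    -- front; from weight seven on they kill the word.
    · have key : ∀ w : List ℕ, ∃ c, (w.map y).prod = f t ^ WordPoly.weight w * c := by
        intro w
        induction w with
        | nil => exact ⟨1, by simp [WordPoly.weight]⟩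
        | cons l w ih =>
          obtain ⟨c, hc'⟩ := ih
          refine ⟨f (a l) * c, ?_⟩
          have hl : y l = f t ^ (l + 1) * f (a l) := by simp [hyd]
          rw [List.map_cons, List.prod_cons, hc', WordPoly.weight, hl, pow_add _ (l + 1), mul_assoc, mul_assoc, ← mul_assoc (f (a l)), ← ((hc (a l)).pow_left _).eq,
            mul_assoc]
      obtain ⟨c, hc'⟩ := key w
      rw [hc', ← Nat.add_sub_cancel' hw, pow_add, hft]
      simp
  rw [hf] at h₁ h₂ h₃ ⊢
  have hs : ∀ h : ℂ, f (flowSum a t h) = ∑ k ∈ Finset.range 7, h ^ k • flowCoeff y k := fun h => by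
    simp only [flowSum, map_sum, map_smul, flowCoeff_scale t ht, map_flowCoeff, hyd]
  rw [map_truncatedStep, hs, hs, ← hy.truncatedStep_eq]
  congr 1
  funext i
  rw [map_schemeExponent, h₁, h₂, h₃]
  simp [midpointAlpha₂, midpointAlpha₃, hyd]

/-- The exponents of the scheme are divisible by the step. -/
theorem dvd_schemeExponent {R : Type*} [Ring R] [Algebra ℂ R] {t α₁ α₂ α₃ : R}
    (h₁ : t ∣ α₁) (h₂ : t ∣ α₂) (h₃ : t ∣ α₃) (i : Fin 4) :
    t ∣ schemeExponent α₁ α₂ α₃ i := by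
  have hs : ∀ (c : ℂ) {x : R}, t ∣ x → t ∣ c • x := by
    rintro c _ ⟨x, rfl⟩
    exact ⟨c • x, by rw [mul_smul_comm]⟩
  have hd : t ∣ doubleComm α₂ α₁ := by
    simp only [doubleComm, Ring.lie_def]
    exact dvd_sub (h₂.mul_right _) ((dvd_sub (h₁.mul_right _) (h₂.mul_right _)).mul_right _)
  fin_cases i
  · exact dvd_add (dvd_add (hs _ h₂) (hs _ h₃)) (hs _ hd)
  · exact dvd_add (dvd_add (hs _ h₁) (hs _ h₂)) (hs _ h₃)
  · exact dvd_add (dvd_sub (hs _ h₁) (hs _ h₂)) (hs _ h₃)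
  · exact dvd_add (dvd_add ((hs _ h₂).neg_right) (hs _ h₃)) (hs _ hd)

/-! ### Taylor expansions -/

/-- Taylor's formula with remainder, for a sequence `f` of scaled derivatives. -/
theorem norm_sub_sum_pow_smul_le {F : Type*} [NormedAddCommGroup F] [NormedSpace ℝ F] (n : ℕ)
    (f : ℕ → ℝ → F) (hf : ∀ k < n, ∀ s, HasDerivAt (f k) ((k + 1 : ℝ) • f (k + 1) s) s)
    {m h C : ℝ} (hC : ∀ s ∈ Set.uIcc m (m + h), ‖f n s‖ ≤ C) :
    ‖f 0 (m + h) - ∑ k ∈ Finset.range n, h ^ k • f k m‖ ≤ n.factorial * C * |h| ^ n := by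
  induction n generalizing f h C with
  | zero => simpa using hC (m + h) Set.right_mem_uIcc
  | succ n ih =>
    have hC0 : 0 ≤ C := (norm_nonneg _).trans (hC m Set.left_mem_uIcc)
    -- The derivative of this remainder is the remainder one degree lower for the sequence `(k + 1)
    -- • f (k + 1)`. The mean value inequality then gains one power of `h`, at the price of the
    -- factorial in the bound.
    set g : ℝ → F := fun s => f 0 (m + s) - ∑ k ∈ Finset.range (n + 1), s ^ k • f k m
    have hg : ∀ s, HasDerivAt g ((fun (k : ℕ) s => (k + 1 : ℝ) • f (k + 1) s) 0 (m + s)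
        - ∑ k ∈ Finset.range n, s ^ k • ((k + 1 : ℝ) • f (k + 1) m)) s := by
      intro s
      refine HasDerivAt.sub ?_ ?_
      · simpa using (hf 0 (by omega) (m + s)).comp_const_add m s
      · simp only [Finset.sum_range_succ']
        have h0 : HasDerivAt (fun s : ℝ => s ^ 0 • f 0 m) 0 s := by
          simpa using hasDerivAt_const s (f 0 m)
        rw [← add_zero (∑ k ∈ Finset.range n, _)]
        refine HasDerivAt.add (HasDerivAt.fun_sum fun k _ => ?_) h0
        convert (hasDerivAt_pow (k + 1) s).smul_const (f (k + 1) m) using 1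
        simp [smul_smul, mul_comm]
    have hbound : ∀ s ∈ Set.uIcc 0 h, ‖(fun (k : ℕ) s => (k + 1 : ℝ) • f (k + 1) s) 0 (m + s)
        - ∑ k ∈ Finset.range n, s ^ k • ((k + 1 : ℝ) • f (k + 1) m)‖ ≤
        (n + 1).factorial * C * |h| ^ n := by
      intro s hs
      have hsub : Set.uIcc m (m + s) ⊆ Set.uIcc m (m + h) := by
        refine Set.uIcc_subset_uIcc Set.left_mem_uIcc ?_
        rw [Set.mem_uIcc] at hs ⊢
        rcases hs with hs | hs
        · left; constructor <;> linarith [hs.1, hs.2]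
        · right; constructor <;> linarith [hs.1, hs.2]
      have hsh : |s| ≤ |h| := by
        simpa using Set.abs_sub_left_of_mem_uIcc hs
      refine (ih (fun (k : ℕ) s => (k + 1 : ℝ) • f (k + 1) s) (fun k hk s => ?_)
        (C := (n + 1) * C) fun r hr => ?_).trans ?_
      · have := (hf (k + 1) (by omega) s).const_smul (k + 1 : ℝ)
        push_cast at this ⊢
        exact this
      · rw [norm_smul]
        have h1 : ‖((n : ℝ) + 1)‖ = n + 1 := by
          rw [Real.norm_eq_abs, abs_of_nonneg (by positivity)]
        rw [h1]
        exact mul_le_mul_of_nonneg_left (hC r (hsub hr)) (by positivity)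
      · rw [Nat.factorial_succ]
        push_cast
        calc (n.factorial : ℝ) * ((n + 1) * C) * |s| ^ n
            ≤ n.factorial * ((n + 1) * C) * |h| ^ n := by gcongr
          _ = _ := by ring
    have := (convex_uIcc (0 : ℝ) h).norm_image_sub_le_of_norm_hasDerivWithin_le
      (fun s _ => (hg s).hasDerivWithinAt) hbound Set.left_mem_uIcc Set.right_mem_uIcc
    have hg0 : g 0 = 0 := by
      simp [g, Finset.sum_range_succ']
    rw [hg0, sub_zero, sub_zero, Real.norm_eq_abs, mul_assoc, ← pow_succ] at this
    exact this

theorem smul_flowCoeff_succ {R : Type*} [Ring R] [Algebra ℂ R] (a : ℕ → R) (k : ℕ) :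
    (k + 1 : ℂ) • flowCoeff a (k + 1) = ∑ j ∈ Finset.range (k + 1), a j * flowCoeff a (k - j) := by
  have h : (k + 1 : ℂ) ≠ 0 := by exact_mod_cast Nat.succ_ne_zero k
  rw [flowCoeff, smul_smul, mul_inv_cancel₀ h, one_smul,
    Fin.sum_univ_eq_sum_range fun j => a j * flowCoeff a (k - j)]

/-- If `D` is a graph of a differentiation and `y' = a₀ y`, then `Uₖ y` is the sequence of scaled
derivatives of `y`. -/
theorem flowCoeff_mem_of_leibniz {N : Type*} [AddCommGroup N] [Module ℂ N]
    (D : Submodule ℂ (N × N)) (a : ℕ → Module.End ℂ N) (n : ℕ)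
    (ha : ∀ j < n, ∀ f g, (f, g) ∈ D → (a j f, a j g + (j + 1 : ℂ) • a (j + 1) f) ∈ D)
    {y : N} (hy : (y, a 0 y) ∈ D) (k : ℕ) (hk : k ≤ n) :
    (flowCoeff a k y, (k + 1 : ℂ) • flowCoeff a (k + 1) y) ∈ D := by
  have hsucc : ∀ k : ℕ, (k + 1 : ℂ) • flowCoeff a (k + 1) y =
      ∑ j ∈ Finset.range (k + 1), a j (flowCoeff a (k - j) y) := fun k => by
    rw [← LinearMap.smul_apply, smul_flowCoeff_succ, LinearMap.sum_apply]
    rfl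
  induction k using Nat.strong_induction_on with
  | _ k ih =>
    cases k with
    | zero =>
      rw [hsucc]
      simpa [flowCoeff] using hy
    | succ k =>
      have hk0 : (k + 1 : ℂ) ≠ 0 := by exact_mod_cast Nat.succ_ne_zero k
      -- The recursion for `U_{k+1} y` is differentiated term by term, by the Leibniz rule `ha` and
      -- the induction hypothesis.
      have h1 : ∑ j ∈ Finset.range (k + 1), (a j (flowCoeff a (k - j) y),
          a j (((k - j : ℕ) + 1 : ℂ) • flowCoeff a (k - j + 1) y)
            + (j + 1 : ℂ) • a (j + 1) (flowCoeff a (k - j) y)) ∈ D :=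
        Submodule.sum_mem _ fun j hj => by
          rw [Finset.mem_range] at hj
          exact ha j (by omega) _ _ (ih (k - j) (by omega) (by omega))
      have h2 := D.smul_mem ((k + 1 : ℂ)⁻¹) h1
      have h3 : ∑ j ∈ Finset.range (k + 1), (a j (((k - j : ℕ) + 1 : ℂ) • flowCoeff a (k - j + 1) y)
            + (j + 1 : ℂ) • a (j + 1) (flowCoeff a (k - j) y)) =
          (k + 1 : ℂ) • ((k + 1 : ℕ) + 1 : ℂ) • flowCoeff a (k + 1 + 1) y := by
        rw [hsucc, Finset.sum_add_distrib]
        -- Both halves become sums of `a j U_{k+1-j} y` over `j ≤ k + 1`: differentiating the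
        -- coefficient `U_{k-j}` gives the weight `k + 1 - j`, differentiating `a j` and shifting
        -- the index gives the weight `j`. The terms added at the ends have weight zero, and the
        -- weights sum to `k + 1`.
        have e1 : ∑ j ∈ Finset.range (k + 1),
            a j (((k - j : ℕ) + 1 : ℂ) • flowCoeff a (k - j + 1) y) =
            ∑ j ∈ Finset.range (k + 1 + 1),
              ((k + 1 - j : ℕ) : ℂ) • a j (flowCoeff a (k + 1 - j) y) := by
          rw [Finset.sum_range_succ _ (k + 1)]
          simp only [Nat.sub_self, Nat.cast_zero, zero_smul, add_zero]
          refine Finset.sum_congr rfl fun j hj => ?_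
          rw [Finset.mem_range] at hj
          rw [map_smul, Nat.succ_sub (by omega : j ≤ k)]
          push_cast
          rfl
        have e2 : ∑ j ∈ Finset.range (k + 1), (j + 1 : ℂ) • a (j + 1) (flowCoeff a (k - j) y) =
            ∑ j ∈ Finset.range (k + 1 + 1), (j : ℂ) • a j (flowCoeff a (k + 1 - j) y) := by
          rw [Finset.sum_range_succ' _ (k + 1)]
          simp
        rw [e1, e2, ← Finset.sum_add_distrib, Finset.smul_sum]
        refine Finset.sum_congr rfl fun j hj => ?_
        rw [Finset.mem_range] at hj
        rw [← add_smul, ← Nat.cast_add, Nat.sub_add_cancel (by omega)]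
        push_cast
        rfl
      have h4 : ∀ (s : Finset ℕ) (u v : ℕ → N),
          ∑ j ∈ s, (u j, v j) = (∑ j ∈ s, u j, ∑ j ∈ s, v j) := fun s u v =>
        Prod.ext (by simp [Prod.fst_sum]) (by simp [Prod.snd_sum])
      rw [h4, h3, Prod.smul_mk, smul_smul _ (k + 1 : ℂ), inv_mul_cancel₀ hk0, one_smul] at h2
      rwa [← hsucc, smul_smul, inv_mul_cancel₀ hk0, one_smul] at h2

/-! ### Nodes -/

theorem sqrt_fifteen_sq : √15 ^ 2 = (15 : ℝ) := Real.sq_sqrt (by norm_num)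

theorem sqrt_fifteen_le : √15 ≤ (4 : ℝ) := by
  rw [Real.sqrt_le_left (by norm_num)]
  norm_num

section Nodes

variable {F : Type*} [NormedAddCommGroup F] [NormedSpace ℝ F] (f : ℕ → ℝ → F)

/-- By symmetry of the nodes the first difference keeps only the odd Taylor terms and the second
only the even ones. The remainder of order six is enough, since the generators carry one more factor
`τ`. -/
theorem norm_nodes_sub_le (hf : ∀ k < 6, ∀ s, HasDerivAt (f k) ((k + 1 : ℝ) • f (k + 1) s) s)
    {m τ C : ℝ} (hτ : 0 ≤ τ) (hC : ∀ s ∈ Set.Icc (m - τ) (m + τ), ‖f 6 s‖ ≤ C) :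
    ‖(√15 / 3) • (f 0 (m + √15 / 10 * τ) - f 0 (m - √15 / 10 * τ))
        - (τ • f 1 m + ((3 / 20 * τ ^ 3) • f 3 m + (9 / 400 * τ ^ 5) • f 5 m))‖
        ≤ 4 * (Nat.factorial 6 * C) * τ ^ 6 ∧
    ‖(10 / 3 : ℝ) • (f 0 (m + √15 / 10 * τ) - (2 : ℝ) • f 0 m + f 0 (m - √15 / 10 * τ))
        - (τ ^ 2 • f 2 m + (3 / 20 * τ ^ 4) • f 4 m)‖ ≤ 20 * (Nat.factorial 6 * C) * τ ^ 6 := by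
  have h15 := sqrt_fifteen_sq
  have h15' := sqrt_fifteen_le
  have h0 : (0 : ℝ) ≤ √15 := Real.sqrt_nonneg _
  have hC0 : 0 ≤ C := (norm_nonneg _).trans (hC m ⟨by linarith, by linarith⟩)
  set h : ℝ := √15 / 10 * τ with hh
  have hh0 : 0 ≤ h := by positivity
  have hhτ : h ≤ τ := by nlinarith
  have hh2 : h ^ 2 = 3 / 20 * τ ^ 2 := by rw [hh, mul_pow, div_pow, h15]; ring
  have hp := norm_sub_sum_pow_smul_le 6 f hf (m := m) (h := h) (C := C) fun s hs => by
    rw [Set.uIcc_of_le (by linarith)] at hs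
    exact hC s ⟨by linarith [hs.1], by linarith [hs.2]⟩
  have hm := norm_sub_sum_pow_smul_le 6 f hf (m := m) (h := -h) (C := C) fun s hs => by
    rw [Set.uIcc_of_ge (by linarith)] at hs
    exact hC s ⟨by linarith [hs.1], by linarith [hs.2]⟩
  rw [abs_neg] at hm
  rw [abs_of_nonneg hh0] at hp hm
  set R : ℝ := Nat.factorial 6 * C with hR
  have hR0 : 0 ≤ R := by positivity
  have hpow : R * h ^ 6 ≤ R * τ ^ 6 := by gcongr
  simp only [Finset.sum_range_succ, Finset.sum_range_zero, ← sub_eq_add_neg] at hp hm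
  set rp := f 0 (m + h) - (0 + h ^ 0 • f 0 m + h ^ 1 • f 1 m + h ^ 2 • f 2 m + h ^ 3 • f 3 m +
    h ^ 4 • f 4 m + h ^ 5 • f 5 m) with hrp
  set rm := f 0 (m - h) - (0 + (-h) ^ 0 • f 0 m + (-h) ^ 1 • f 1 m + (-h) ^ 2 • f 2 m +
    (-h) ^ 3 • f 3 m + (-h) ^ 4 • f 4 m + (-h) ^ 5 • f 5 m) with hrm
  have hh3 : h ^ 3 = 3 / 20 * τ ^ 2 * h := by rw [pow_succ, hh2]
  have hh4 : h ^ 4 = 9 / 400 * τ ^ 4 := by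
    rw [show h ^ 4 = (h ^ 2) ^ 2 by ring, hh2]; ring
  have hh5 : h ^ 5 = 9 / 400 * τ ^ 4 * h := by rw [pow_succ, hh4]
  -- The one place where an odd power of `√15` would survive: the prefactor of the first difference
  -- cancels it.
  have hhτ' : 2 * (√15 / 3) * h = τ := by
    rw [hh]
    linear_combination τ / 15 * h15
  constructor
  · have e : (√15 / 3) • (f 0 (m + h) - f 0 (m - h))
        - (τ • f 1 m + ((3 / 20 * τ ^ 3) • f 3 m + (9 / 400 * τ ^ 5) • f 5 m)) =
        (√15 / 3) • (rp - rm) := by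
      have e1 : τ • f 1 m = (2 * (√15 / 3) * h) • f 1 m := by rw [hhτ']
      have e3 : (3 / 20 * τ ^ 3) • f 3 m = (2 * (√15 / 3) * h ^ 3) • f 3 m := by
        congr 1; rw [hh3]; linear_combination -(3 / 20 * τ ^ 2) * hhτ'
      have e5 : (9 / 400 * τ ^ 5) • f 5 m = (2 * (√15 / 3) * h ^ 5) • f 5 m := by
        congr 1; rw [hh5]; linear_combination -(9 / 400 * τ ^ 4) * hhτ'
      rw [e1, e3, e5, hrp, hrm]
      module
    rw [e, norm_smul, Real.norm_eq_abs, abs_of_nonneg (by positivity)]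
    have := norm_sub_le rp rm
    calc √15 / 3 * ‖rp - rm‖ ≤ 2 * (R * τ ^ 6 + R * τ ^ 6) := by
          gcongr <;> linarith
      _ = _ := by ring
  · have e : (10 / 3 : ℝ) • (f 0 (m + h) - (2 : ℝ) • f 0 m + f 0 (m - h))
        - (τ ^ 2 • f 2 m + (3 / 20 * τ ^ 4) • f 4 m) = (10 / 3 : ℝ) • (rp + rm) := by
      have e2 : τ ^ 2 • f 2 m = (20 / 3 * h ^ 2) • f 2 m := by
        congr 1; rw [hh2]; ring
      have e4 : (3 / 20 * τ ^ 4) • f 4 m = (20 / 3 * h ^ 4) • f 4 m := by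
        congr 1; rw [hh4]; ring
      rw [e2, e4, hrp, hrm]
      module
    rw [e, norm_smul, Real.norm_eq_abs, abs_of_nonneg (by norm_num)]
    have := norm_add_le rp rm
    calc (10 / 3 : ℝ) * ‖rp + rm‖ ≤ 10 * (R * τ ^ 6 + R * τ ^ 6) := by
          gcongr <;> linarith
      _ = _ := by ring

end Nodes

/-! ### Bounded families -/

/-- Bounded families of elements of a normed algebra. -/
def boundedFamily (ι A : Type*) [NormedRing A] [NormedAlgebra ℂ A] : Subalgebra ℂ (ι → A) where
  carrier := {f | ∃ C, ∀ p, ‖f p‖ ≤ C}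
  mul_mem' := by
    rintro f g ⟨C, hC⟩ ⟨D, hD⟩
    exact ⟨C * D, fun p => (norm_mul_le _ _).trans
      (mul_le_mul (hC p) (hD p) (norm_nonneg _) ((norm_nonneg _).trans (hC p)))⟩
  add_mem' := by
    rintro f g ⟨C, hC⟩ ⟨D, hD⟩
    exact ⟨C + D, fun p => (norm_add_le _ _).trans (add_le_add (hC p) (hD p))⟩
  algebraMap_mem' c := ⟨‖algebraMap ℂ A c‖, fun _ => le_rfl⟩

section BoundedFamily

variable {ι A : Type*} [NormedRing A] [NormedAlgebra ℂ A]

/-- The family of scalars `τ`. -/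
def stepFamily {τ : ι → ℝ} (hτ : ∀ p, τ p ∈ Set.Ioc (0 : ℝ) 1) : boundedFamily ι A :=
  ⟨fun p => (τ p : ℂ) • 1, ‖(1 : A)‖, fun p => by
    have := hτ p
    rw [norm_smul, Complex.norm_real, Real.norm_eq_abs, abs_of_pos this.1]
    exact mul_le_of_le_one_left (norm_nonneg _) this.2⟩

variable {τ : ι → ℝ} (hτ : ∀ p, τ p ∈ Set.Ioc (0 : ℝ) 1)

theorem stepFamily_commute (r : boundedFamily ι A) : Commute (stepFamily hτ) r := by
  ext p
  simp [stepFamily]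

theorem stepFamily_pow_mul_apply (n : ℕ) (r : boundedFamily ι A) (p : ι) :
    (stepFamily hτ ^ n * r : boundedFamily ι A).1 p = (τ p : ℂ) ^ n • r.1 p := by
  simp [stepFamily, smul_pow, -Complex.coe_smul]

/-- The dictionary between algebra and analysis: as `τ > 0`, one can divide by `τ ^ n`, and the
quotient is a bounded family exactly when the estimate holds. -/
theorem stepFamily_pow_dvd_iff (n : ℕ) (r : boundedFamily ι A) :
    stepFamily hτ ^ n ∣ r ↔ ∃ C, ∀ p, ‖r.1 p‖ ≤ C * τ p ^ n := by
  constructor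
  · rintro ⟨⟨c, C, hC⟩, rfl⟩
    refine ⟨C, fun p => ?_⟩
    rw [stepFamily_pow_mul_apply, norm_smul, norm_pow, Complex.norm_real, Real.norm_eq_abs,
      abs_of_pos (hτ p).1, mul_comm]
    exact mul_le_mul_of_nonneg_right (hC p) (pow_nonneg (hτ p).1.le _)
  · rintro ⟨C, hC⟩
    refine ⟨⟨fun p => ((τ p : ℂ) ^ n)⁻¹ • r.1 p, C, fun p => ?_⟩, ?_⟩
    · rw [norm_smul, norm_inv, norm_pow, Complex.norm_real, Real.norm_eq_abs,
        abs_of_pos (hτ p).1, inv_mul_le_iff₀ (pow_pos (hτ p).1 _), mul_comm]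
      exact hC p
    · ext p
      have h0 : (τ p : ℂ) ^ n ≠ 0 := pow_ne_zero _ (by exact_mod_cast (hτ p).1.ne')
      rw [stepFamily_pow_mul_apply, smul_smul, mul_inv_cancel₀ h0, one_smul]

end BoundedFamily

/-! ### Matrix exponentials and the bound on the propagator -/

section Matrix

variable {N : ℕ}

local notation "Mat" => Matrix (Fin N) (Fin N) ℂ

theorem exists_norm_exp_le (B : ℝ) : ∃ E : ℝ, 0 ≤ E ∧ ∀ X : Mat, ‖X‖ ≤ B → ‖NormedSpace.exp X‖ ≤ E := by
  have hp : ProperSpace Mat := FiniteDimensional.proper ℂ Mat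
  have hc : IsCompact (Metric.closedBall (0 : Mat) B) := isCompact_closedBall _ _
  let : NormedAlgebra ℚ Mat := NormedAlgebra.restrictScalars ℚ ℂ Mat
  obtain ⟨E, hE⟩ := hc.exists_bound_of_continuousOn
    (NormedSpace.exp_continuous (𝔸 := Mat)).continuousOn
  exact ⟨max E 0, le_max_right _ _, fun X hX => (hE X (by simpa using hX)).trans (le_max_left _ _)⟩

/-- Taylor's formula on `[0, 1]` for `s ↦ exp (s • X)`, with scaled derivatives `X ^ k * exp (s • X)
/ k!`; the factor `7!` of the remainder bound cancels. -/
theorem norm_exp_sub_expSum_le {B E : ℝ}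
    (hE : ∀ X : Mat, ‖X‖ ≤ B → ‖NormedSpace.exp X‖ ≤ E) (X : Mat) (hX : ‖X‖ ≤ B) :
    ‖NormedSpace.exp X - expSum X‖ ≤ E * ‖X‖ ^ 7 := by
  have h := norm_sub_sum_pow_smul_le 7
    (fun k s => ((k.factorial : ℝ)⁻¹) • (X ^ k * NormedSpace.exp (s • X))) (fun k _ s => ?_)
    (m := 0) (h := 1) (C := (Nat.factorial 7 : ℝ)⁻¹ * (‖X‖ ^ 7 * E)) fun s hs => ?_
  · simp only [zero_add, one_smul, zero_smul, NormedSpace.exp_zero, mul_one, one_pow, abs_one,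
      Nat.factorial_zero, Nat.cast_one, inv_one, pow_zero, one_mul] at h
    have e : expSum X = ∑ k ∈ Finset.range 7, ((k.factorial : ℝ)⁻¹) • X ^ k := by
      refine Finset.sum_congr rfl fun k _ => ?_
      rw [← Complex.coe_smul]
      push_cast
      rfl
    rw [e]
    refine h.trans (le_of_eq ?_)
    field_simp
  · have h1 := ((hasDerivAt_exp_smul_const' (𝕂 := ℝ) X s).const_mul (X ^ k)).const_smul
      ((k.factorial : ℝ)⁻¹)
    refine h1.congr_deriv ?_
    rw [smul_smul, Nat.factorial_succ, ← mul_assoc, ← pow_succ]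
    congr 1
    push_cast
    have : (k.factorial : ℝ) ≠ 0 := by positivity
    field_simp
  · rw [zero_add, Set.uIcc_of_le zero_le_one] at hs
    rw [norm_smul, norm_inv, RCLike.norm_natCast]
    gcongr
    refine (norm_mul_le _ _).trans ?_
    gcongr
    · exact norm_pow_le' X (by norm_num)
    · refine hE _ (le_trans ?_ hX)
      rw [norm_smul, Real.norm_eq_abs, abs_of_nonneg hs.1]
      exact mul_le_of_le_one_left (norm_nonneg _) hs.2

/-- `U* U` has zero derivative, hence equals `1`, and the C*-identity gives `‖U‖² = ‖1‖`. The bound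
`‖1‖ + 1` also covers `N = 0`, where `‖1‖ = 0`. -/
theorem IsPropagator.norm_le {T : Mat} {V : ℝ → Fin N → ℝ} {U : ℝ → ℝ → Mat} (hT : T.IsHermitian)
    (hU : IsPropagator T V U) (t s : ℝ) : ‖U t s‖ ≤ ‖(1 : Mat)‖ + 1 := by
  have hH : ∀ r, (T + potMatrix V r).conjTranspose = T + potMatrix V r := fun r => by
    rw [Matrix.conjTranspose_add, hT.eq, potMatrix, Matrix.diagonal_conjTranspose]
    congr 2
    ext k
    simp
  have hd : ∀ r, HasDerivAt (fun r => (U r s).conjTranspose * U r s) 0 r := fun r => by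
    have h1 := (hU s).2 r
    have h2 := h1.star
    have h3 := h2.mul h1
    simp only [Matrix.star_eq_conjTranspose] at h3
    refine h3.congr_deriv ?_
    rw [Matrix.conjTranspose_neg, Matrix.conjTranspose_smul, Matrix.conjTranspose_mul, hH]
    simp [mul_assoc]
  have hconst := is_const_of_deriv_eq_zero (fun r => (hd r).differentiableAt) (fun r => (hd r).deriv)
    t s
  simp only [(hU s).1, Matrix.conjTranspose_one, mul_one] at hconst
  have h := Matrix.l2_opNorm_conjTranspose_mul_self (U t s)
  rw [hconst] at h
  nlinarith [norm_nonneg (U t s), norm_nonneg (1 : Mat)]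

end Matrix

/-! ### The generator of the semi-discretized equation -/

section Midpoint

variable {A : Type*} [Ring A] [Algebra ℂ A]

theorem α₂_sub_midpoint (τ : ℝ) (V₁ V₃ f₁ f₃ f₅ : A) :
    α₂ τ V₁ V₃ - ((τ : ℂ) ^ 2 • (-(Complex.I • f₁)) + ((3 / 20 : ℂ) • ((τ : ℂ) ^ 4 • (-(Complex.I • f₃)))
      + (9 / 400 : ℂ) • ((τ : ℂ) ^ 6 • (-(Complex.I • f₅))))) =
    (-(Complex.I * (τ : ℂ))) • (((√15 / 3 : ℝ) : ℂ) • (V₃ - V₁) - ((τ : ℂ) • f₁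
      + (((3 / 20 * τ ^ 3 : ℝ) : ℂ) • f₃ + ((9 / 400 * τ ^ 5 : ℝ) : ℂ) • f₅))) := by
  rw [α₂]
  push_cast
  module

theorem α₃_sub_midpoint (τ : ℝ) (V₁ V₂ V₃ f₂ f₄ : A) :
    α₃ τ V₁ V₂ V₃ - ((τ : ℂ) ^ 3 • (-(Complex.I • f₂))
      + (3 / 20 : ℂ) • ((τ : ℂ) ^ 5 • (-(Complex.I • f₄)))) =
    (-(Complex.I * (τ : ℂ))) • (((10 / 3 : ℝ) : ℂ) • (V₃ - (2 : ℂ) • V₂ + V₁)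
      - ((τ : ℂ) ^ 2 • f₂ + ((3 / 20 * τ ^ 4 : ℝ) : ℂ) • f₄)) := by
  rw [α₃]
  push_cast
  module

end Midpoint

section Matrix

variable {N : ℕ}

local notation "Mat" => Matrix (Fin N) (Fin N) ℂ

/-- Diagonal matrices of real vectors, as a continuous linear map. -/
def diagCLM (N : ℕ) : (Fin N → ℝ) →L[ℝ] Matrix (Fin N) (Fin N) ℂ :=
  LinearMap.toContinuousLinearMap
    { toFun := fun v => Matrix.diagonal fun k => (v k : ℂ)
      map_add' := fun v w => by simp [Matrix.diagonal_add]
      map_smul' := fun c v => by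
        ext i j
        by_cases h : i = j <;> simp [h] }

theorem potMatrix_eq_diagCLM (V : ℝ → Fin N → ℝ) (t : ℝ) : potMatrix V t = diagCLM N (V t) := rfl

theorem commute_diagCLM (v w : Fin N → ℝ) : Commute (diagCLM N v) (diagCLM N w) := by
  change Matrix.diagonal _ * Matrix.diagonal _ = Matrix.diagonal _ * Matrix.diagonal _
  rw [Matrix.diagonal_mul_diagonal, Matrix.diagonal_mul_diagonal]
  simp only [mul_comm]

/-- The scaled derivatives of the potential. -/
def potCoeff (V : ℝ → Fin N → ℝ) (j : ℕ) (t : ℝ) : Matrix (Fin N) (Fin N) ℂ :=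
  diagCLM N ((j.factorial : ℝ)⁻¹ • iteratedDeriv j V t)

/-- The scaled derivatives of the generator `-i (T + V)`. -/
def matGenerator (T : Mat) (V : ℝ → Fin N → ℝ) (j : ℕ) (t : ℝ) : Mat :=
  -- The potential is only `C⁶`. Setting the later coefficients to zero keeps all of them
  -- continuous, and the coefficients up to `U₇` involve only `a 0, …, a 6`.
  if j ≤ 6 then -(Complex.I • ((if j = 0 then T else 0) + potCoeff V j t)) else 0

theorem continuous_potCoeff {V : ℝ → Fin N → ℝ} (hV : ContDiff ℝ 6 V) {j : ℕ} (hj : j ≤ 6) :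
    Continuous (potCoeff V j) :=
  (diagCLM N).continuous.comp
    ((hV.continuous_iteratedDeriv j (by exact_mod_cast hj)).const_smul ((j.factorial : ℝ)⁻¹))

theorem hasDerivAt_potCoeff {V : ℝ → Fin N → ℝ} (hV : ContDiff ℝ 6 V) {j : ℕ} (hj : j < 6) (t : ℝ) :
    HasDerivAt (potCoeff V j) ((j + 1 : ℝ) • potCoeff V (j + 1) t) t := by
  have h1 := (hV.differentiable_iteratedDeriv j (by exact_mod_cast hj) t).hasDerivAt
  rw [← iteratedDeriv_succ] at h1
  have h2 := (diagCLM N).hasFDerivAt.comp_hasDerivAt t (h1.const_smul ((j.factorial : ℝ)⁻¹))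
  refine h2.congr_deriv ?_
  rw [potCoeff, ← map_smul, smul_smul, Nat.factorial_succ]
  congr 2
  have : (j.factorial : ℝ) ≠ 0 := by positivity
  push_cast
  field_simp

theorem hasDerivAt_matGenerator (T : Mat) {V : ℝ → Fin N → ℝ} (hV : ContDiff ℝ 6 V) {j : ℕ}
    (hj : j < 6) (t : ℝ) :
    HasDerivAt (matGenerator T V j) ((j + 1 : ℂ) • matGenerator T V (j + 1) t) t := by
  have h1 := (((hasDerivAt_potCoeff hV hj t).const_add (if j = 0 then T else 0)).const_smul
    Complex.I).neg
  have e : matGenerator T V j =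
      fun t => -(Complex.I • ((if j = 0 then T else 0) + potCoeff V j t)) := by
    funext t
    simp [matGenerator, hj.le]
  rw [e]
  refine h1.congr_deriv ?_
  have : j + 1 ≤ 6 := hj
  rw [matGenerator, if_pos this, if_neg (by omega), zero_add, ← Complex.coe_smul]
  push_cast
  module

theorem continuous_matGenerator (T : Mat) {V : ℝ → Fin N → ℝ} (hV : ContDiff ℝ 6 V) (j : ℕ) :
    Continuous (matGenerator T V j) := by
  by_cases hj : j ≤ 6
  · have := (((continuous_potCoeff hV hj).const_add (if j = 0 then T else 0)).const_smul
      Complex.I).neg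
    refine this.congr fun t => ?_
    simp [matGenerator, hj]
  · refine (continuous_const (y := (0 : Mat))).congr fun t => ?_
    simp [matGenerator, hj]

/-- The derivatives of a solution in terms of the derivatives of the generator. -/
theorem hasDerivAt_flowCoeff_mul (T : Mat) {V : ℝ → Fin N → ℝ} (hV : ContDiff ℝ 6 V) {y : ℝ → Mat}
    (hy : ∀ t, HasDerivAt y (matGenerator T V 0 t * y t) t) {k : ℕ} (hk : k < 7) (t : ℝ) :
    HasDerivAt (fun t => flowCoeff (fun j => matGenerator T V j t) k * y t)
      ((k + 1 : ℝ) • (flowCoeff (fun j => matGenerator T V j t) (k + 1) * y t)) t := by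
  -- The graph of differentiation in time on matrix functions, on which the generator coefficients
  -- act by left multiplication.
  let D : Submodule ℂ ((ℝ → Mat) × (ℝ → Mat)) :=
    { carrier := {f | ∀ t, HasDerivAt f.1 (f.2 t) t}
      add_mem' := fun hf hg t => (hf t).add (hg t)
      zero_mem' := fun t => hasDerivAt_const t _
      smul_mem' := fun c f hf t => (hf t).const_smul c }
  have h := flowCoeff_mem_of_leibniz D (fun j => Algebra.lmul ℂ (ℝ → Mat) (matGenerator T V j)) 6
    (fun j hj f g hfg t => ?_) (y := y) hy k (by omega)
  · have e : ∀ (k : ℕ) (t : ℝ), (flowCoeff (fun j => Algebra.lmul ℂ (ℝ → Mat) (matGenerator T V j)) k) y t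
        = flowCoeff (fun j => matGenerator T V j t) k * y t := fun k t => by
      rw [← map_flowCoeff (Algebra.lmul ℂ (ℝ → Mat))]
      have := map_flowCoeff (Pi.evalAlgHom ℂ (fun _ : ℝ => Mat) t) (matGenerator T V) k
      change flowCoeff (matGenerator T V) k t * y t = _
      rw [← Pi.evalAlgHom_apply ℂ (fun _ : ℝ => Mat) t (flowCoeff (matGenerator T V) k), this]
      rfl
    have ht := h t
    have e' : (flowCoeff (fun j => Algebra.lmul ℂ (ℝ → Mat) (matGenerator T V j)) k) y =
        fun t => flowCoeff (fun j => matGenerator T V j t) k * y t := funext fun t => e k t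
    simp only [e', Pi.smul_apply, e] at ht
    refine ht.congr_deriv ?_
    rw [← Complex.coe_smul]
    push_cast
    rfl
  · have := (hasDerivAt_matGenerator T hV hj t).mul (hfg t)
    refine this.congr_deriv ?_
    simp [add_comm]

/-- The parameters `(m, τ)` of the steps with midpoint `m ∈ [a - 1, b + 2]` and length `τ ∈ (0, 1]`. -/
abbrev StepParam (a b : ℝ) : Type :=
  {p : ℝ × ℝ // p.1 ∈ Set.Icc (a - 1) (b + 2) ∧ p.2 ∈ Set.Ioc (0 : ℝ) 1}

variable {a b : ℝ}

theorem exists_bound_Icc {F : Type*} [NormedAddCommGroup F] {f : ℝ → F} (hf : Continuous f)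
    (a b : ℝ) : ∃ C, ∀ t ∈ Set.Icc a b, ‖f t‖ ≤ C :=
  isCompact_Icc.exists_bound_of_continuousOn hf.continuousOn

def generatorFamily (T : Mat) {V : ℝ → Fin N → ℝ} (hV : ContDiff ℝ 6 V) (a b : ℝ) (j : ℕ) :
    boundedFamily (StepParam a b) Mat :=
  ⟨fun p => matGenerator T V j p.1.1, by
    obtain ⟨C, hC⟩ := exists_bound_Icc (continuous_matGenerator T hV j) (a - 1) (b + 2)
    exact ⟨C, fun p => hC _ p.2.1⟩⟩

theorem flowCoeff_generatorFamily (T : Mat) {V : ℝ → Fin N → ℝ} (hV : ContDiff ℝ 6 V) (k : ℕ)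
    (p : StepParam a b) : (flowCoeff (generatorFamily T hV a b) k).1 p =
      flowCoeff (fun j => matGenerator T V j p.1.1) k :=
  map_flowCoeff ((Pi.evalAlgHom ℂ (fun _ : StepParam a b => Mat) p).comp
    (boundedFamily (StepParam a b) Mat).val) (generatorFamily T hV a b) k

def paramStep (a b : ℝ) : boundedFamily (StepParam a b) Mat :=
  stepFamily (τ := fun p : StepParam a b => p.1.2) fun p => p.2.2

theorem commute_generatorFamily (T : Mat) {V : ℝ → Fin N → ℝ} (hV : ContDiff ℝ 6 V) (i j : ℕ)
    (hi : i ≠ 0) (hj : j ≠ 0) : Commute (generatorFamily T hV a b i) (generatorFamily T hV a b j) := by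
  ext1
  funext p
  change matGenerator T V i p.1.1 * matGenerator T V j p.1.1
    = matGenerator T V j p.1.1 * matGenerator T V i p.1.1
  simp only [matGenerator, hi, hj, if_false, zero_add]
  split_ifs
  · exact (((commute_diagCLM _ _).smul_left _).smul_right _).neg_left.neg_right
  all_goals simp

/-- The three generators `α` as functions of the midpoint and the step. -/
def midpointAlphas (T : Mat) (V : ℝ → Fin N → ℝ) (m τ : ℝ) : Fin 3 → Mat :=
  ![α₁ τ T (potMatrix V m),
    α₂ τ (potMatrix V (m - √15 / 10 * τ)) (potMatrix V (m + √15 / 10 * τ)),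
    α₃ τ (potMatrix V (m - √15 / 10 * τ)) (potMatrix V m) (potMatrix V (m + √15 / 10 * τ))]

theorem midpointAlphas_zero (T : Mat) (V : ℝ → Fin N → ℝ) (m τ : ℝ) :
    midpointAlphas T V m τ 0 = (τ : ℂ) • matGenerator T V 0 m := by
  simp [midpointAlphas, α₁, matGenerator, potMatrix_eq_diagCLM, potCoeff, smul_smul,
    mul_comm (τ : ℂ), add_comm, -Complex.coe_smul]

theorem exists_norm_midpointAlphas_sub_le (T : Mat) {V : ℝ → Fin N → ℝ} (hV : ContDiff ℝ 6 V)
    (a b : ℝ) : ∃ C, ∀ p : StepParam a b,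
      ‖midpointAlphas T V p.1.1 p.1.2 1
        - (midpointAlpha₂ (paramStep a b) (generatorFamily T hV a b)).1 p‖ ≤ C * p.1.2 ^ 7 ∧
      ‖midpointAlphas T V p.1.1 p.1.2 2
        - (midpointAlpha₃ (paramStep a b) (generatorFamily T hV a b)).1 p‖ ≤ C * p.1.2 ^ 7 := by
  -- The parameter interval enlarged by one on each side contains `[m - τ, m + τ]`, hence all nodes.
  obtain ⟨C, hC⟩ := exists_bound_Icc (continuous_potCoeff hV le_rfl) (a - 2) (b + 3)
  refine ⟨20 * (Nat.factorial 6 * C), fun p => ?_⟩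
  obtain ⟨⟨m, τ⟩, hm, hτ0, hτ1⟩ := p
  simp only at hm hτ0 hτ1
  have hn := norm_nodes_sub_le (potCoeff V) (fun k hk s => hasDerivAt_potCoeff hV hk s) (m := m)
    hτ0.le (C := C) fun s hs => hC s ⟨by linarith [hs.1, hm.1], by linarith [hs.2, hm.2]⟩
  have hC0 : 0 ≤ C := (norm_nonneg _).trans (hC m ⟨by linarith [hm.1], by linarith [hm.2]⟩)
  have hV0 : ∀ t, potMatrix V t = potCoeff V 0 t := fun t => by
    simp [potMatrix_eq_diagCLM, potCoeff]
  have hstep : ∀ (n j : ℕ), 0 < j → j ≤ 6 → (paramStep a b ^ n * generatorFamily T hV a b j).1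
      ⟨(m, τ), hm, hτ0, hτ1⟩ = (τ : ℂ) ^ n • -(Complex.I • potCoeff V j m) := fun n j h0 h6 => by
    rw [paramStep, stepFamily_pow_mul_apply]
    simp [generatorFamily, matGenerator, h6, h0.ne']
  have hnorm : ∀ x : Mat, ‖(-(Complex.I * (τ : ℂ))) • x‖ = τ * ‖x‖ := fun x => by
    rw [norm_smul, norm_neg, norm_mul, Complex.norm_I, one_mul, Complex.norm_real, Real.norm_eq_abs,
      abs_of_pos hτ0]
  constructor
  · have e : (midpointAlpha₂ (paramStep a b) (generatorFamily T hV a b)).1 ⟨(m, τ), hm, hτ0, hτ1⟩ =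
        (τ : ℂ) ^ 2 • (-(Complex.I • potCoeff V 1 m)) + ((3 / 20 : ℂ) • ((τ : ℂ) ^ 4 •
          (-(Complex.I • potCoeff V 3 m))) + (9 / 400 : ℂ) • ((τ : ℂ) ^ 6 •
          (-(Complex.I • potCoeff V 5 m)))) := by
      rw [← hstep 2 1 (by norm_num) (by norm_num), ← hstep 4 3 (by norm_num) (by norm_num),
        ← hstep 6 5 (by norm_num) (by norm_num)]
      rfl
    rw [e]
    simp only [midpointAlphas, Matrix.cons_val]
    rw [α₂_sub_midpoint, hnorm, hV0, hV0]
    simp only [Complex.coe_smul]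
    calc τ * _ ≤ τ * (4 * (Nat.factorial 6 * C) * τ ^ 6) := by
          gcongr
          exact hn.1
      _ = 4 * (Nat.factorial 6 * C * τ ^ 7) := by ring
      _ ≤ 20 * (Nat.factorial 6 * C * τ ^ 7) := by gcongr; norm_num
      _ = _ := by ring
  · have e : (midpointAlpha₃ (paramStep a b) (generatorFamily T hV a b)).1 ⟨(m, τ), hm, hτ0, hτ1⟩ =
        (τ : ℂ) ^ 3 • (-(Complex.I • potCoeff V 2 m)) + (3 / 20 : ℂ) • ((τ : ℂ) ^ 5 •
          (-(Complex.I • potCoeff V 4 m))) := by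
      rw [← hstep 3 2 (by norm_num) (by norm_num), ← hstep 5 4 (by norm_num) (by norm_num)]
      rfl
    rw [e]
    simp only [midpointAlphas, Matrix.cons_val]
    rw [α₃_sub_midpoint, hnorm, hV0, hV0, hV0]
    have h2 : (2 : ℂ) = ((2 : ℝ) : ℂ) := by norm_num
    rw [h2, ← Complex.ofReal_pow]
    simp only [Complex.coe_smul]
    calc τ * _ ≤ τ * (20 * (Nat.factorial 6 * C) * τ ^ 6) := by
          gcongr
          exact hn.2
      _ = _ := by ring

end Matrix

/-! ### Sixth order for the semi-discretized equation -/

section Matrix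

variable {N : ℕ}

local notation "Mat" => Matrix (Fin N) (Fin N) ℂ

theorem dvd_sub_trans {R : Type*} [Ring R] {d x y z : R} (h₁ : d ∣ x - y) (h₂ : d ∣ y - z) :
    d ∣ x - z := by
  have := dvd_add h₁ h₂
  rwa [sub_add_sub_cancel] at this

theorem dvd_of_dvd_sub {R : Type*} [Ring R] {d x y : R} (h₁ : d ∣ x - y) (h₂ : d ∣ y) : d ∣ x := by
  have := dvd_add h₁ h₂
  rwa [sub_add_cancel] at this

/-- A product of four factors changes by a multiple of a central element when its factors do. -/
theorem dvd_mul_four_sub {R : Type*} [Ring R] {d : R} (hd : ∀ r, Commute d r) {e x : Fin 4 → R}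
    (h : ∀ i, d ∣ e i - x i) (Y : R) :
    d ∣ e 3 * (e 2 * (e 1 * (e 0 * Y))) - x 3 * (x 2 * (x 1 * (x 0 * Y))) := by
  have step : ∀ {u v p q : R}, d ∣ u - v → d ∣ p - q → d ∣ u * p - v * q := by
    intro u v p q h1 h2
    have e : u * p - v * q = (u - v) * p + v * (p - q) := by noncomm_ring
    rw [e]
    refine dvd_add (h1.mul_right p) ?_
    obtain ⟨c, hc⟩ := h2
    exact ⟨v * c, by rw [hc, ← mul_assoc, ← (hd v).eq, mul_assoc]⟩
  exact step (h 3) (step (h 2) (step (h 1) (step (h 0) (by simp))))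

/-- An exponent of size `O(τ)` has a seventh-order Taylor remainder of size `O(τ⁷)`, and its
exponential is again a bounded family. -/
theorem stepFamily_dvd_exp_sub {ι : Type*} {τ : ι → ℝ} (hτ : ∀ p, τ p ∈ Set.Ioc (0 : ℝ) 1)
    {X : boundedFamily ι Mat} (hX : stepFamily hτ ∣ X) :
    ∃ E : boundedFamily ι Mat, (∀ p, E.1 p = NormedSpace.exp (X.1 p)) ∧
      stepFamily hτ ^ 7 ∣ E - expSum X := by
  obtain ⟨B, hB⟩ := X.2
  obtain ⟨E, hE0, hE⟩ := exists_norm_exp_le (N := N) B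
  refine ⟨⟨fun p => NormedSpace.exp (X.1 p), E, fun p => hE _ (hB p)⟩, fun p => rfl, ?_⟩
  rw [stepFamily_pow_dvd_iff]
  rw [← pow_one (stepFamily hτ), stepFamily_pow_dvd_iff] at hX
  obtain ⟨C, hC⟩ := hX
  refine ⟨E * C ^ 7, fun p => ?_⟩
  have e : (expSum X).1 p = expSum (X.1 p) :=
    map_expSum ((Pi.evalAlgHom ℂ (fun _ : ι => Mat) p).comp (boundedFamily ι Mat).val) X
  change ‖NormedSpace.exp (X.1 p) - (expSum X).1 p‖ ≤ _
  rw [e, mul_assoc, ← mul_pow]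
  refine (norm_exp_sub_expSum_le hE _ (hB p)).trans ?_
  gcongr
  simpa using hC p

theorem matrixStep_eq (T : Mat) (V : ℝ → Fin N → ℝ) (s τ : ℝ) :
    matrixStep T V s τ =
      NormedSpace.exp (schemeExponent (midpointAlphas T V (s + τ / 2) τ 0)
        (midpointAlphas T V (s + τ / 2) τ 1) (midpointAlphas T V (s + τ / 2) τ 2) 3) *
      (NormedSpace.exp (schemeExponent (midpointAlphas T V (s + τ / 2) τ 0)
        (midpointAlphas T V (s + τ / 2) τ 1) (midpointAlphas T V (s + τ / 2) τ 2) 2) *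
      (NormedSpace.exp (schemeExponent (midpointAlphas T V (s + τ / 2) τ 0)
        (midpointAlphas T V (s + τ / 2) τ 1) (midpointAlphas T V (s + τ / 2) τ 2) 1) *
      (NormedSpace.exp (schemeExponent (midpointAlphas T V (s + τ / 2) τ 0)
        (midpointAlphas T V (s + τ / 2) τ 1) (midpointAlphas T V (s + τ / 2) τ 2) 0) * 1))) := by
  have h1 : s + c₁ * τ = s + τ / 2 - √15 / 10 * τ := by rw [c₁]; ring
  have h2 : s + c₂ * τ = s + τ / 2 := by rw [c₂]; ring
  have h3 : s + c₃ * τ = s + τ / 2 + √15 / 10 * τ := by rw [c₃]; ring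
  simp only [matrixStep, commutatorExponent_eq, h1, h2, h3, midpointAlphas, Matrix.cons_val, mul_one,
    mul_assoc]

/-- The family of steps reproduces the Taylor polynomial of the flow. -/
theorem exists_stepFamily_dvd (T : Mat) {V : ℝ → Fin N → ℝ} (hV : ContDiff ℝ 6 V) (a b : ℝ) :
    ∃ S : boundedFamily (StepParam a b) Mat,
      (∀ p : StepParam a b, S.1 p = matrixStep T V (p.1.1 - p.1.2 / 2) p.1.2) ∧
      paramStep a b ^ 7 ∣ S * flowSum (generatorFamily T hV a b) (paramStep a b) (-(1 / 2))
        - flowSum (generatorFamily T hV a b) (paramStep a b) (1 / 2) := by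
  obtain ⟨C, hC⟩ := exists_norm_midpointAlphas_sub_le T hV a b
  set t : boundedFamily (StepParam a b) Mat := paramStep a b
  set g := generatorFamily T hV a b
  have ht : ∀ r, Commute t r := stepFamily_commute _
  have hdiv : ∀ n (r : boundedFamily (StepParam a b) Mat),
      t ^ n ∣ r ↔ ∃ C, ∀ p : StepParam a b, ‖r.1 p‖ ≤ C * p.1.2 ^ n :=
    fun n r => stepFamily_pow_dvd_iff _ n r
  obtain ⟨B₂, hB₂⟩ := (midpointAlpha₂ t g).2
  obtain ⟨B₃, hB₃⟩ := (midpointAlpha₃ t g).2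
  have hbd : ∀ (i : Fin 3) (r : boundedFamily (StepParam a b) Mat),
      (∀ p : StepParam a b, ‖midpointAlphas T V p.1.1 p.1.2 i - r.1 p‖ ≤ C * p.1.2 ^ 7) →
      ∃ C, ∀ p : StepParam a b, ‖midpointAlphas T V p.1.1 p.1.2 i‖ ≤ C := by
    intro i r hr
    obtain ⟨B, hB⟩ := r.2
    refine ⟨|C| + B, fun p => ?_⟩
    have h1 := norm_add_le (midpointAlphas T V p.1.1 p.1.2 i - r.1 p) (r.1 p)
    rw [sub_add_cancel] at h1
    have h2 : C * p.1.2 ^ 7 ≤ |C| := by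
      have : p.1.2 ^ 7 ≤ 1 := pow_le_one₀ p.2.2.1.le p.2.2.2
      have h0 : 0 ≤ p.1.2 ^ 7 := pow_nonneg p.2.2.1.le _
      nlinarith [le_abs_self C, abs_nonneg C]
    linarith [hr p, hB p]
  -- `α₁` samples the potential at the midpoint itself, so it carries no truncation error.
  let A₁ : boundedFamily (StepParam a b) Mat := t * g 0
  let A₂ : boundedFamily (StepParam a b) Mat := ⟨fun p => midpointAlphas T V p.1.1 p.1.2 1,
    hbd 1 _ fun p => (hC p).1⟩
  let A₃ : boundedFamily (StepParam a b) Mat := ⟨fun p => midpointAlphas T V p.1.1 p.1.2 2,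
    hbd 2 _ fun p => (hC p).2⟩
  have hA₁ : ∀ p : StepParam a b, A₁.1 p = midpointAlphas T V p.1.1 p.1.2 0 := fun p => by
    rw [midpointAlphas_zero]
    have := stepFamily_pow_mul_apply (fun p : StepParam a b => p.2.2) 1 (g 0) p
    rw [pow_one, pow_one] at this
    exact this
  have h₁ : t ^ 7 ∣ A₁ - t * g 0 := by simp [A₁]
  have h₂ : t ^ 7 ∣ A₂ - midpointAlpha₂ t g := (hdiv 7 _).2 ⟨C, fun p => (hC p).1⟩
  have h₃ : t ^ 7 ∣ A₃ - midpointAlpha₃ t g := (hdiv 7 _).2 ⟨C, fun p => (hC p).2⟩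
  have hmain := dvd_truncatedStep_sub_flowSum t ht g (commute_generatorFamily T hV) h₁ h₂ h₃
  have h7 : t ∣ t ^ 7 := dvd_pow_self t (by norm_num)
  have hs : ∀ (c : ℂ) {x : boundedFamily (StepParam a b) Mat}, t ∣ x → t ∣ c • x := by
    rintro c _ ⟨x, rfl⟩
    exact ⟨c • x, by rw [mul_smul_comm]⟩
  have hp : ∀ (n : ℕ) (x : boundedFamily (StepParam a b) Mat), t ∣ t ^ (n + 1) * x := fun n x =>
    (dvd_pow_self t n.succ_ne_zero).mul_right x
  have hm₂ : t ∣ midpointAlpha₂ t g :=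
    dvd_add (hp 1 _) (dvd_add (hs _ (hp 3 _)) (hs _ (hp 5 _)))
  have hm₃ : t ∣ midpointAlpha₃ t g := dvd_add (hp 2 _) (hs _ (hp 4 _))
  have hX : ∀ i, t ∣ schemeExponent A₁ A₂ A₃ i := dvd_schemeExponent (Dvd.intro _ rfl)
    (dvd_of_dvd_sub (h7.trans h₂) hm₂) (dvd_of_dvd_sub (h7.trans h₃) hm₃)
  choose E hE hE7 using fun i => stepFamily_dvd_exp_sub (fun p : StepParam a b => p.2.2) (hX i)
  have ht7 : ∀ r, Commute (t ^ 7) r := fun r => (ht r).pow_left 7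
  refine ⟨E 3 * (E 2 * (E 1 * (E 0 * 1))), fun p => ?_, ?_⟩
  · have hs : p.1.1 - p.1.2 / 2 + p.1.2 / 2 = p.1.1 := by ring
    have hXp : ∀ i, (schemeExponent A₁ A₂ A₃ i).1 p =
        schemeExponent (A₁.1 p) (A₂.1 p) (A₃.1 p) i := fun i =>
      map_schemeExponent ((Pi.evalAlgHom ℂ (fun _ : StepParam a b => Mat) p).comp
        (boundedFamily (StepParam a b) Mat).val) A₁ A₂ A₃ i
    rw [matrixStep_eq, hs]
    change (E 3).1 p * ((E 2).1 p * ((E 1).1 p * ((E 0).1 p * 1))) = _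
    simp only [hE, hXp, hA₁]
    rfl
  · have h := dvd_mul_four_sub ht7 hE7 (flowSum g t (-(1 / 2)))
    have := dvd_sub_trans h hmain
    simpa only [mul_one, mul_assoc] using this

/-- With `Y = U (s + τ/2) s`, both `1 = U s s` and `U (s + τ) s` are Taylor polynomials times `Y` up
to `O(τ⁷)`, and the step carries one polynomial to the other up to `O(τ⁷)`. -/
theorem matrixStep_order_six (T : Mat) (V : ℝ → Fin N → ℝ) (U : ℝ → ℝ → Mat) (hT : T.IsHermitian)
    (hV : ContDiff ℝ 6 V) (hU : IsPropagator T V U) (a b : ℝ) :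
    ∃ C δ : ℝ, 0 < δ ∧ ∀ s ∈ Set.Icc a b, ∀ τ : ℝ, 0 < τ → τ ≤ δ →
      ‖matrixStep T V s τ - U (s + τ) s‖ ≤ C * τ ^ 7 := by
  obtain ⟨S, hS, hdiv⟩ := exists_stepFamily_dvd T hV a b
  rw [paramStep, stepFamily_pow_dvd_iff] at hdiv
  obtain ⟨C₁, hC₁⟩ := hdiv
  obtain ⟨C₂, hC₂⟩ := S.2
  obtain ⟨C₃, hC₃⟩ := (flowCoeff (generatorFamily T hV a b) 7).2
  set M : ℝ := ‖(1 : Mat)‖ + 1 with hM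
  have hM0 : 0 ≤ M := by positivity
  set K : ℝ := Nat.factorial 7 * (C₃ * M)
  refine ⟨C₂ * K + C₁ * M + K, 1, one_pos, fun s hs τ hτ0 hτ1 => ?_⟩
  let p : StepParam a b := ⟨(s + τ / 2, τ), ⟨by linarith [hs.1], by linarith [hs.2]⟩, hτ0, hτ1⟩
  have hC₂0 : 0 ≤ C₂ := (norm_nonneg _).trans (hC₂ p)
  have hC₃0 : 0 ≤ C₃ := (norm_nonneg _).trans (hC₃ p)
  have hK0 : 0 ≤ K := by positivity
  have hy : ∀ t, HasDerivAt (fun t => U t s) (matGenerator T V 0 t * U t s) t := fun t => by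
    refine ((hU s).2 t).congr_deriv ?_
    simp [matGenerator, potCoeff, potMatrix_eq_diagCLM, add_mul, add_comm]
  have htaylor : ∀ h : ℝ, |h| ≤ 1 / 2 → ‖U (s + τ / 2 + h * τ) s
      - (flowSum (generatorFamily T hV a b) (paramStep a b) (h : ℂ)).1 p * U (s + τ / 2) s‖
      ≤ K * τ ^ 7 := by
    intro h hh
    have hhτ : |h * τ| ≤ τ / 2 := by
      rw [abs_mul, abs_of_pos hτ0]
      nlinarith
    have hh1 := (abs_le.1 hhτ).1
    have hh2 := (abs_le.1 hhτ).2
    have := norm_sub_sum_pow_smul_le 7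
      (fun k t => flowCoeff (fun j => matGenerator T V j t) k * U t s)
      (fun k hk t => hasDerivAt_flowCoeff_mul T hV hy hk t) (m := s + τ / 2) (h := h * τ)
      (C := C₃ * M) fun r hr => by
        have hr' : r ∈ Set.Icc (a - 1) (b + 2) := by
          rw [Set.mem_uIcc] at hr
          rcases hr with hr | hr <;>
            exact ⟨by linarith [hr.1, hs.1], by linarith [hr.2, hs.2]⟩
        -- The generator family depends only on the first parameter, so the step length `1` is an
        -- arbitrary choice.
        have h3 := hC₃ ⟨(r, 1), hr', one_pos, le_rfl⟩
        rw [flowCoeff_generatorFamily] at h3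
        exact (norm_mul_le _ _).trans (mul_le_mul h3 (hU.norm_le hT r s) (norm_nonneg _) hC₃0)
    have e : (flowSum (generatorFamily T hV a b) (paramStep a b) (h : ℂ)).1 p * U (s + τ / 2) s =
        ∑ k ∈ Finset.range 7, (h * τ) ^ k •
          (flowCoeff (fun j => matGenerator T V j (s + τ / 2)) k * U (s + τ / 2) s) := by
      simp only [flowSum]
      rw [AddSubmonoidClass.coe_finsetSum, Finset.sum_apply, Finset.sum_mul]
      refine Finset.sum_congr rfl fun k _ => ?_
      have h1 := stepFamily_pow_mul_apply (fun p : StepParam a b => p.2.2) k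
        (flowCoeff (generatorFamily T hV a b) k) p
      rw [flowCoeff_generatorFamily] at h1
      change ((h : ℂ) ^ k • (paramStep a b ^ k * flowCoeff (generatorFamily T hV a b) k :
        boundedFamily (StepParam a b) Mat).1 p) * _ = _
      rw [paramStep, h1, smul_smul, smul_mul_assoc, ← mul_pow, ← Complex.coe_smul]
      push_cast
      rfl
    rw [e]
    simp only [show ∀ t, flowCoeff (fun j => matGenerator T V j t) 0 = 1 from
      fun t => by rw [flowCoeff], one_mul] at this
    refine this.trans ?_
    have : |h * τ| ^ 7 ≤ τ ^ 7 := by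
      gcongr
      linarith
    exact mul_le_mul_of_nonneg_left this (by positivity)
  have hp := htaylor (1 / 2) (by norm_num [abs_of_pos])
  have hm := htaylor (-(1 / 2)) (by norm_num [abs_of_pos])
  have e1 : s + τ / 2 + 1 / 2 * τ = s + τ := by ring
  have e2 : s + τ / 2 + -(1 / 2) * τ = s := by ring
  have e3 : s + τ / 2 - τ / 2 = s := by ring
  rw [e1] at hp
  rw [e2, (hU s).1] at hm
  push_cast at hp hm
  have hSp := hS p
  simp only [p, e3] at hSp
  have h1 := hC₁ p
  have h2 := hC₂ p
  set Fp := (flowSum (generatorFamily T hV a b) (paramStep a b) (1 / 2)).1 p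
  set Fm := (flowSum (generatorFamily T hV a b) (paramStep a b) (-(1 / 2))).1 p
  change ‖S.1 p * Fm - Fp‖ ≤ C₁ * τ ^ 7 at h1
  change S.1 p = _ at hSp
  rw [← hSp]
  set Y := U (s + τ / 2) s
  have hY : ‖Y‖ ≤ M := hU.norm_le hT _ _
  have e : S.1 p - U (s + τ) s = S.1 p * (1 - Fm * Y) + (S.1 p * Fm - Fp) * Y
      - (U (s + τ) s - Fp * Y) := by
    noncomm_ring
  rw [e]
  refine (norm_sub_le _ _).trans ?_
  have t1 : ‖S.1 p * (1 - Fm * Y)‖ ≤ C₂ * (K * τ ^ 7) :=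
    (norm_mul_le _ _).trans (mul_le_mul h2 hm (norm_nonneg _) hC₂0)
  have t2 : ‖(S.1 p * Fm - Fp) * Y‖ ≤ C₁ * τ ^ 7 * M :=
    (norm_mul_le _ _).trans (mul_le_mul h1 hY (norm_nonneg _) ((norm_nonneg _).trans h1))
  have t3 := norm_add_le (S.1 p * (1 - Fm * Y)) ((S.1 p * Fm - Fp) * Y)
  calc _ ≤ C₂ * (K * τ ^ 7) + C₁ * τ ^ 7 * M + K * τ ^ 7 := by linarith
    _ = _ := by ring

end Matrix

/-! ### Multiplication operators and the kinetic energy -/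

section PartialDeriv

variable {d : ℕ} {F : Type*} [NormedAddCommGroup F] [NormedSpace ℝ F]

/-- The partial derivative in the `i`-th coordinate. -/
def partialDeriv (i : Fin d) (f : EuclideanSpace ℝ (Fin d) → F) (x : EuclideanSpace ℝ (Fin d)) : F :=
  fderiv ℝ f x (EuclideanSpace.single i 1)

theorem contDiff_partialDeriv {f : EuclideanSpace ℝ (Fin d) → F} (hf : ContDiff ℝ ∞ f) (i : Fin d) :
    ContDiff ℝ ∞ (partialDeriv i f) :=
  (hf.fderiv_right (m := ∞) (by norm_cast)).clm_apply contDiff_const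

theorem laplacian_eq_sum_partialDeriv {f : EuclideanSpace ℝ (Fin d) → F} (hf : ContDiff ℝ ∞ f)
    (x : EuclideanSpace ℝ (Fin d)) :
    Laplacian.laplacian f x = ∑ i, partialDeriv i (partialDeriv i f) x := by
  rw [InnerProductSpace.laplacian_eq_iteratedFDeriv_orthonormalBasis f
    (EuclideanSpace.basisFun (Fin d) ℝ)]
  refine Finset.sum_congr rfl fun i _ => ?_
  have h : DifferentiableAt ℝ (fderiv ℝ f) x :=
    (hf.fderiv_right (m := ∞) (by norm_cast)).differentiable (by simp) x
  rw [iteratedFDeriv_two_apply, partialDeriv]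
  unfold partialDeriv
  rw [fderiv_clm_apply h (differentiableAt_const _)]
  simp

theorem partialDeriv_add_right {f : EuclideanSpace ℝ (Fin d) → F} {v : EuclideanSpace ℝ (Fin d)}
    (hf : ∀ x, f (x + v) = f x) (i : Fin d) (x : EuclideanSpace ℝ (Fin d)) :
    partialDeriv i f (x + v) = partialDeriv i f x := by
  have hf' : (fun x => f (x + v)) = f := funext hf
  have h := fderiv_comp_add_right (𝕜 := ℝ) (f := f) (x := x) v
  rw [hf'] at h
  rw [partialDeriv, partialDeriv, h]

theorem partialDeriv_mul {f g : EuclideanSpace ℝ (Fin d) → ℂ} (hf : ContDiff ℝ ∞ f)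
    (hg : ContDiff ℝ ∞ g) (i : Fin d) (x : EuclideanSpace ℝ (Fin d)) :
    partialDeriv i (fun x => f x * g x) x = f x * partialDeriv i g x + g x * partialDeriv i f x := by
  have hf' : DifferentiableAt ℝ f x := hf.differentiable (by simp) x
  have hg' : DifferentiableAt ℝ g x := hg.differentiable (by simp) x
  have h := fderiv_mul hf' hg'
  change fderiv ℝ (f * g) x _ = _
  rw [h]
  simp [partialDeriv]

theorem partialDeriv_ofReal {f : EuclideanSpace ℝ (Fin d) → ℝ} (hf : ContDiff ℝ ∞ f) (i : Fin d)
    (x : EuclideanSpace ℝ (Fin d)) :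
    partialDeriv i (fun x => (f x : ℂ)) x = ((partialDeriv i f x : ℝ) : ℂ) := by
  have h := Complex.ofRealCLM.hasFDerivAt.comp x (hf.differentiable (by simp) x).hasFDerivAt
  change fderiv ℝ (Complex.ofRealCLM ∘ f) x _ = _
  rw [h.fderiv]
  rfl

theorem laplacian_mul {f g : EuclideanSpace ℝ (Fin d) → ℂ} (hf : ContDiff ℝ ∞ f)
    (hg : ContDiff ℝ ∞ g) (x : EuclideanSpace ℝ (Fin d)) :
    Laplacian.laplacian (fun x => f x * g x) x = f x * Laplacian.laplacian g x
      + 2 * ∑ i, partialDeriv i f x * partialDeriv i g x + g x * Laplacian.laplacian f x := by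
  rw [laplacian_eq_sum_partialDeriv (hf.mul hg), laplacian_eq_sum_partialDeriv hf,
    laplacian_eq_sum_partialDeriv hg, Finset.mul_sum, Finset.mul_sum, Finset.mul_sum,
    ← Finset.sum_add_distrib, ← Finset.sum_add_distrib]
  refine Finset.sum_congr rfl fun i _ => ?_
  have h1 : partialDeriv i (fun x => f x * g x) = fun x =>
      f x * partialDeriv i g x + g x * partialDeriv i f x := funext (partialDeriv_mul hf hg i)
  have hf1 := contDiff_partialDeriv hf i
  have hg1 := contDiff_partialDeriv hg i
  have h2 : partialDeriv i (fun x => f x * partialDeriv i g x + g x * partialDeriv i f x) x =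
      partialDeriv i (fun x => f x * partialDeriv i g x) x
        + partialDeriv i (fun x => g x * partialDeriv i f x) x :=
    congrArg (fun l => l (EuclideanSpace.single i 1)) (fderiv_fun_add
      ((hf.mul hg1).differentiable (by simp) x) ((hg.mul hf1).differentiable (by simp) x))
  rw [h1, h2, partialDeriv_mul hf hg1, partialDeriv_mul hg hf1]
  ring

theorem norm_gradient_sq (f : EuclideanSpace ℝ (Fin d) → ℝ) (x : EuclideanSpace ℝ (Fin d)) :
    ‖gradient f x‖ ^ 2 = ∑ i, partialDeriv i f x ^ 2 := by
  rw [EuclideanSpace.norm_sq_eq]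
  refine Finset.sum_congr rfl fun i _ => ?_
  have h : gradient f x i = partialDeriv i f x := by
    have h1 := InnerProductSpace.toDual_symm_apply (𝕜 := ℝ) (x := EuclideanSpace.single i (1 : ℝ))
      (y := fderiv ℝ f x)
    rw [partialDeriv, ← h1, EuclideanSpace.inner_single_right]
    simp [gradient]
  rw [h, Real.norm_eq_abs, sq_abs]

end PartialDeriv

section Operators

variable {d : ℕ} {L : Fin d → ℝ}

theorem mulOp_apply (w : smoothPeriodic ℝ L) (ψ : smoothPeriodic ℂ L)
    (x : EuclideanSpace ℝ (Fin d)) : (mulOp w ψ).1 x = (w.1 x : ℂ) * ψ.1 x := rfl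

theorem kineticOp_apply (μ : ℝ) (ψ : smoothPeriodic ℂ L) (x : EuclideanSpace ℝ (Fin d)) :
    (kineticOp L μ ψ).1 x = (-(1 / (2 * μ) : ℝ) : ℂ) * Laplacian.laplacian ψ.1 x := rfl

theorem mulOp_add (v w : smoothPeriodic ℝ L) : mulOp (v + w) = mulOp v + mulOp w := by
  ext ψ x
  simp [mulOp_apply, add_mul]

theorem mulOp_sub (v w : smoothPeriodic ℝ L) : mulOp (v - w) = mulOp v - mulOp w := by
  ext ψ x
  simp [mulOp_apply, sub_mul]

theorem mulOp_smul (c : ℝ) (w : smoothPeriodic ℝ L) : mulOp (c • w) = (c : ℂ) • mulOp w := by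
  ext ψ x
  change ((c * w.1 x : ℝ) : ℂ) * ψ.1 x = (c : ℂ) * ((w.1 x : ℂ) * ψ.1 x)
  push_cast
  ring

theorem commute_mulOp (v w : smoothPeriodic ℝ L) : Commute (mulOp v) (mulOp w) := by
  ext ψ x
  change (v.1 x : ℂ) * ((w.1 x : ℂ) * ψ.1 x) = (w.1 x : ℂ) * ((v.1 x : ℂ) * ψ.1 x)
  ring

/-- The squared gradient of a smooth periodic function. -/
def gradSq (w : smoothPeriodic ℝ L) : smoothPeriodic ℝ L := gradDiffSq 0 w

theorem gradSq_apply (w : smoothPeriodic ℝ L) (x : EuclideanSpace ℝ (Fin d)) :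
    (gradSq w).1 x = ∑ i, partialDeriv i w.1 x ^ 2 := by
  rw [← norm_gradient_sq]
  have h0 : gradient (0 : EuclideanSpace ℝ (Fin d) → ℝ) x = 0 := by
    simp [gradient]
  change ‖gradient w.1 x - gradient (0 : EuclideanSpace ℝ (Fin d) → ℝ) x‖ ^ 2 = _
  rw [h0, sub_zero]

theorem gradSq_sub (w₁ w₃ : smoothPeriodic ℝ L) : gradSq (w₃ - w₁) = gradDiffSq w₁ w₃ := by
  ext x
  rw [gradSq_apply, ← norm_gradient_sq]
  change _ = ‖gradient w₃.1 x - gradient w₁.1 x‖ ^ 2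
  have h : fderiv ℝ (w₃.1 - w₁.1) x = fderiv ℝ w₃.1 x - fderiv ℝ w₁.1 x :=
    fderiv_sub (w₃.2.1.differentiable (by simp) x) (w₁.2.1.differentiable (by simp) x)
  have h' : gradient (w₃ - w₁ : smoothPeriodic ℝ L).1 x = gradient w₃.1 x - gradient w₁.1 x := by
    change (InnerProductSpace.toDual ℝ _).symm (fderiv ℝ (w₃.1 - w₁.1) x) = _
    rw [h, map_sub]
    rfl
  rw [h']

/-- The double commutator of a multiplication operator with the kinetic energy. -/
theorem doubleComm_mulOp_kineticOp (μ : ℝ) (w : smoothPeriodic ℝ L) :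
    doubleComm (mulOp w) (kineticOp L μ) = ((1 / μ : ℝ) : ℂ) • mulOp (gradSq w) := by
  ext ψ x
  have hw : ContDiff ℝ ∞ fun x => (w.1 x : ℂ) := Complex.ofRealCLM.contDiff.comp w.2.1
  -- By the product rule `Δ(w²ψ) - 2wΔ(wψ) + w²Δψ = 2|∇w|²ψ`: every term with a derivative of `ψ` or
  -- a second derivative of `w` cancels.
  have e : (doubleComm (mulOp w) (kineticOp L μ) ψ).1 x =
      (w.1 x : ℂ) * ((kineticOp L μ (mulOp w ψ)).1 x - (w.1 x : ℂ) * (kineticOp L μ ψ).1 x)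
      - ((kineticOp L μ (mulOp w (mulOp w ψ))).1 x
        - (w.1 x : ℂ) * (kineticOp L μ (mulOp w ψ)).1 x) := rfl
  have h1 : Laplacian.laplacian (mulOp w ψ).1 x = _ := laplacian_mul hw ψ.2.1 x
  have h2 : Laplacian.laplacian (mulOp w (mulOp w ψ)).1 x = _ := laplacian_mul hw (mulOp w ψ).2.1 x
  have h3 : ∀ i, partialDeriv i (mulOp w ψ).1 x = _ := fun i => partialDeriv_mul hw ψ.2.1 i x
  have h4 : ((((1 / μ : ℝ) : ℂ) • mulOp (gradSq w)) ψ).1 x =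
      ((1 / μ : ℝ) : ℂ) * (((gradSq w).1 x : ℂ) * ψ.1 x) := rfl
  rw [e, h4, kineticOp_apply, kineticOp_apply, kineticOp_apply, h2, mulOp_apply, h1, gradSq_apply]
  simp only [h3]
  have h5 : ∑ i, partialDeriv i (fun x => (w.1 x : ℂ)) x *
      ((w.1 x : ℂ) * partialDeriv i ψ.1 x + ψ.1 x * partialDeriv i (fun x => (w.1 x : ℂ)) x) =
      (w.1 x : ℂ) * ∑ i, partialDeriv i (fun x => (w.1 x : ℂ)) x * partialDeriv i ψ.1 x
        + ψ.1 x * ((∑ i, partialDeriv i w.1 x ^ 2 : ℝ) : ℂ) := by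
    rw [Finset.mul_sum]
    push_cast
    rw [Finset.mul_sum, ← Finset.sum_add_distrib]
    refine Finset.sum_congr rfl fun i _ => ?_
    rw [partialDeriv_ofReal w.2.1]
    ring
  rw [h5]
  push_cast
  ring

/-- The potential inside `α₁` commutes with `α₂` and drops out; the rest is homogeneity, quadratic
in the outer entry and linear in the inner one. -/
theorem doubleComm_smul_smul_add {A : Type*} [Ring A] [Algebra ℂ A] {M M' T : A}
    (h : Commute M M') (c e : ℂ) :
    doubleComm (c • M) (e • (T + M')) = (c ^ 2 * e) • doubleComm M T := by
  have h' : ⁅T + M', M⁆ = ⁅T, M⁆ := by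
    simp only [Ring.lie_def, add_mul, mul_add, h.eq]
    abel
  have h1 : ⁅e • (T + M'), c • M⁆ = (e * c) • ⁅T, M⁆ := by
    rw [← h', Ring.lie_def, Ring.lie_def, smul_mul_smul_comm, smul_mul_smul_comm, mul_comm c e,
      smul_sub]
  rw [doubleComm, doubleComm, h1, Ring.lie_def, Ring.lie_def M, smul_mul_smul_comm,
    smul_mul_smul_comm, smul_sub, show c * (e * c) = c ^ 2 * e by ring,
    show e * c * c = c ^ 2 * e by ring]

/-- The scalar is `(-iτ√15/3)² (-iτ) = (-iτ) τ² (-5/3)`, and the commutator with the kinetic energy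
contributes `1/μ`. -/
theorem doubleComm_α (μ τ : ℝ) (w₁ w₂ w₃ : smoothPeriodic ℝ L) :
    doubleComm (α₂ τ (mulOp w₁) (mulOp w₃)) (α₁ τ (kineticOp L μ) (mulOp w₂)) =
      (-(Complex.I * (τ : ℂ))) • ((τ : ℂ) ^ 2) •
        mulOp ((-(5 / (3 * μ))) • gradDiffSq w₁ w₃) := by
  rw [α₁, α₂, ← mulOp_sub, smul_smul, doubleComm_smul_smul_add (commute_mulOp _ _),
    doubleComm_mulOp_kineticOp, gradSq_sub, mulOp_smul, smul_smul, smul_smul, smul_smul]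
  congr 1
  have h15 : ((√15 : ℝ) : ℂ) ^ 2 = 15 := by
    rw [← Complex.ofReal_pow, sqrt_fifteen_sq]
    norm_num
  have hI : Complex.I ^ 2 = -1 := Complex.I_sq
  push_cast
  rw [show (-(Complex.I * (τ : ℂ)) * (((√15 : ℝ) : ℂ) / 3)) ^ 2 * -(Complex.I * (τ : ℂ)) * (1 / (μ : ℂ)) =
    -(Complex.I * τ) * (Complex.I ^ 2 * τ ^ 2) * (((√15 : ℝ) : ℂ) ^ 2 / 9) * (1 / (μ : ℂ)) by ring, h15, hI]
  -- For `μ = 0` both sides vanish, since division by zero gives zero.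
  by_cases hμ : (μ : ℂ) = 0
  · simp [hμ]
  · field_simp
    ring

theorem commutatorExponent_eq_coordinateExponent (μ τ : ℝ) (w₁ w₂ w₃ : smoothPeriodic ℝ L) :
    commutatorExponent τ (kineticOp L μ) (mulOp w₁) (mulOp w₂) (mulOp w₃) =
      coordinateExponent τ (kineticOp L μ) (mulOp w₁) (mulOp w₂) (mulOp w₃)
        (mulOp (modifiedPotential μ w₁ w₃)) := by
  have hW : mulOp (modifiedPotential μ w₁ w₃) =
      (yCoef : ℂ) • mulOp ((-(5 / (3 * μ))) • gradDiffSq w₁ w₃) := by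
    rw [modifiedPotential, mulOp_smul, mulOp_smul, smul_smul]
    congr 1
    push_cast
    ring
  funext i
  rw [hW]
  fin_cases i <;>
    simp only [commutatorExponent, coordinateExponent, doubleComm_α, Fin.zero_eta, Fin.mk_one,
      Fin.reduceFinMk, Matrix.cons_val] <;>
    -- With the double commutator as an atom, what remains is a comparison of coefficients, linear
    -- in `T`, the three potentials and `D`.
    generalize mulOp ((-(5 / (3 * μ))) • gradDiffSq w₁ w₃) = D <;>
    simp only [α₁, α₂, α₃, x₁₂, x₁₃, x₂₁, x₂₂, x₂₃, a₁₁, a₁₂, a₁₃, a₂₁, a₂₂, a₂₃] <;>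
    push_cast <;>
    module

end Operators

/-! ### Integrals over the period cell -/

section Cell

open MeasureTheory
open scoped Pointwise

variable {d : ℕ} (L : Fin d → ℝ)

/-- The period cell. -/
def cell : Set (EuclideanSpace ℝ (Fin d)) := {x | ∀ i, x i ∈ Set.Ico 0 (L i)}

/-- The closed period cell. -/
def closedCell : Set (EuclideanSpace ℝ (Fin d)) := {x | ∀ i, x i ∈ Set.Icc 0 (L i)}

theorem cell_subset_closedCell : cell L ⊆ closedCell L := fun _ hx i => Set.Ico_subset_Icc_self (hx i)

theorem isCompact_closedCell : IsCompact (closedCell L) := by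
  have h : IsCompact (Set.pi Set.univ fun i => Set.Icc 0 (L i)) :=
    isCompact_univ_pi fun i => isCompact_Icc
  have e : closedCell L = (EuclideanSpace.equiv (Fin d) ℝ).symm ''
      (Set.pi Set.univ fun i => Set.Icc 0 (L i)) := by
    rw [ContinuousLinearEquiv.image_symm_eq_preimage]
    ext x
    simp only [closedCell, Set.mem_preimage, Set.mem_univ_pi]
    rfl
  rw [e]
  exact h.image (EuclideanSpace.equiv (Fin d) ℝ).symm.continuous

theorem measurableSet_cell : MeasurableSet (cell L) := by
  have e : cell L = ⋂ i, (fun x : EuclideanSpace ℝ (Fin d) => x i) ⁻¹' Set.Ico 0 (L i) := by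
    ext x
    simp [cell]
  rw [e]
  exact MeasurableSet.iInter fun i => (by fun_prop : Continuous fun x : EuclideanSpace ℝ (Fin d) =>
    x i).measurable measurableSet_Ico

theorem volume_cell_lt_top : volume (cell L) < ⊤ :=
  (measure_mono (cell_subset_closedCell L)).trans_lt (isCompact_closedCell L).measure_lt_top

variable {L} {F : Type*} [NormedAddCommGroup F]

theorem integrableOn_cell {f : EuclideanSpace ℝ (Fin d) → F} (hf : Continuous f) :
    IntegrableOn f (cell L) :=
  (hf.continuousOn.integrableOn_compact (isCompact_closedCell L)).mono_set (cell_subset_closedCell L)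

variable [NormedSpace ℝ F]

/-- Differentiation under the integral: a jointly continuous derivative is bounded on the compact
set `[r - 1, r + 1]` times the closed cell, and this constant dominates. -/
theorem hasDerivAt_integral_cell {G G' : ℝ → EuclideanSpace ℝ (Fin d) → F}
    (hG : ∀ r, Continuous (G r)) (hG' : Continuous fun p : ℝ × EuclideanSpace ℝ (Fin d) => G' p.1 p.2)
    (h : ∀ r x, HasDerivAt (fun r => G r x) (G' r x) r) (r : ℝ) :
    HasDerivAt (fun r => ∫ x in cell L, G r x) (∫ x in cell L, G' r x) r := by
  obtain ⟨C, hC⟩ := (isCompact_Icc.prod (isCompact_closedCell L)).exists_bound_of_continuousOn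
    (s := Set.Icc (r - 1) (r + 1) ×ˢ closedCell L) hG'.continuousOn
  have hGr : Continuous (G' r) := hG'.comp (Continuous.prodMk continuous_const continuous_id)
  refine (hasDerivAt_integral_of_dominated_loc_of_deriv_le (bound := fun _ => C)
    (s := Set.Icc (r - 1) (r + 1)) (Icc_mem_nhds (by linarith) (by linarith))
    (Filter.Eventually.of_forall fun s => (hG s).aestronglyMeasurable) (integrableOn_cell (hG r))
    hGr.aestronglyMeasurable ?_ ?_ ?_).2
  · filter_upwards [ae_restrict_mem (measurableSet_cell L)] with x hx s hs
    exact hC (s, x) ⟨hs, cell_subset_closedCell L hx⟩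
  · exact integrableOn_const (volume_cell_lt_top L).ne
  · exact Filter.Eventually.of_forall fun x s _ => h s x

/-- The cell and its translate are both fundamental domains of the lattice spanned by the periods,
and a lattice-invariant function has the same integral over each. -/
theorem integral_cell_add_right (hL : ∀ i, 0 < L i) {f : EuclideanSpace ℝ (Fin d) → F}
    (hf : ∀ i x, f (x + EuclideanSpace.single i (L i)) = f x) (v : EuclideanSpace ℝ (Fin d)) :
    ∫ x in cell L, f (x + v) = ∫ x in cell L, f x := by
  let b : Module.Basis (Fin d) ℝ (EuclideanSpace ℝ (Fin d)) :=
    (EuclideanSpace.basisFun (Fin d) ℝ).toBasis.isUnitSMul (w := L) fun i => (hL i).ne'.isUnit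
  have hb : ∀ i, b i = EuclideanSpace.single i (L i) := fun i => by
    simp only [b, Module.Basis.isUnitSMul_apply, OrthonormalBasis.coe_toBasis,
      EuclideanSpace.basisFun_apply]
    ext j
    by_cases h : j = i <;> simp [h]
  have hcell : ZSpan.fundamentalDomain b = cell L := by
    ext x
    simp only [ZSpan.mem_fundamentalDomain, cell]
    refine forall_congr' fun i => ?_
    have hr : b.repr x i = (L i)⁻¹ * x i := by
      simp only [b, Module.Basis.repr_isUnitSMul]
      simp [Units.smul_def]
    rw [hr, Set.mem_Ico, Set.mem_Ico, inv_mul_lt_one₀ (hL i)]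
    rw [mul_nonneg_iff_of_pos_left (inv_pos.2 (hL i))]
  have hfd : IsAddFundamentalDomain (Submodule.span ℤ (Set.range b)) (cell L) volume :=
    hcell ▸ ZSpan.isAddFundamentalDomain b volume
  have hper : ∀ (g : Submodule.span ℤ (Set.range b)) (x : EuclideanSpace ℝ (Fin d)),
      f (g +ᵥ x) = f x := by
    rintro ⟨g, hg⟩ x
    change f (g + x) = f x
    induction hg using Submodule.span_induction generalizing x with
    | mem g hg =>
      obtain ⟨i, rfl⟩ := hg
      rw [hb, add_comm, hf]
    | zero => rw [zero_add]
    | add g h _ _ ihg ihh => rw [add_assoc, ihg, ihh]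
    | smul n g _ ih =>
      have hnat : ∀ (n : ℕ) x, f (n • g + x) = f x := fun n => by
        induction n with
        | zero => simp
        | succ n ihn =>
          intro x
          rw [succ_nsmul, add_assoc, ihn, ih]
      obtain ⟨n, rfl | rfl⟩ := n.eq_nat_or_neg
      · rw [natCast_zsmul, hnat]
      · rw [← hnat n, neg_smul, natCast_zsmul, add_neg_cancel_left]
  have hfd' := hfd.vadd_of_comm v
  have hinv : VAddInvariantMeasure (Submodule.span ℤ (Set.range b)) (EuclideanSpace ℝ (Fin d))
      volume := ⟨fun c s _ => measure_preimage_add volume (c : EuclideanSpace ℝ (Fin d)) s⟩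
  rw [hfd.setIntegral_eq hfd' hper]
  have hmp := measurePreserving_add_right (volume : Measure (EuclideanSpace ℝ (Fin d))) v
  have := hmp.setIntegral_preimage_emb (MeasurableEquiv.addRight v).measurableEmbedding f
    (v +ᵥ cell L)
  rw [← this]
  congr 2
  ext x
  rw [Set.mem_preimage, Set.mem_vadd_set_iff_neg_vadd_mem]
  simp [vadd_eq_add, add_comm x]

/-- The integral of `f (x + r eᵢ)` over the cell does not depend on `r`; its derivative at `r = 0`
is the integral in question. No boundary terms arise. -/
theorem integral_cell_partialDeriv [CompleteSpace F] (hL : ∀ i, 0 < L i)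
    {f : EuclideanSpace ℝ (Fin d) → F} (hf : ContDiff ℝ ∞ f)
    (hp : ∀ i x, f (x + EuclideanSpace.single i (L i)) = f x) (i : Fin d) :
    ∫ x in cell L, partialDeriv i f x = 0 := by
  have h := hasDerivAt_integral_cell (L := L)
    (G := fun r x => f (x + r • EuclideanSpace.single i (1 : ℝ)))
    (G' := fun r x => partialDeriv i f (x + r • EuclideanSpace.single i (1 : ℝ)))
    (fun r => hf.continuous.comp (by fun_prop))
    ((contDiff_partialDeriv hf i).continuous.comp (by fun_prop)) (fun r x => ?_) 0
  · simp only [integral_cell_add_right hL hp] at h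
    have h0 := h.unique (hasDerivAt_const _ _)
    simpa using h0
  · have h1 : HasDerivAt (fun r : ℝ => x + r • EuclideanSpace.single i (1 : ℝ))
        (EuclideanSpace.single i (1 : ℝ)) r := by
      simpa using ((hasDerivAt_id r).smul_const (EuclideanSpace.single i (1 : ℝ))).const_add x
    exact ((hf.differentiable (by simp) _).hasFDerivAt).comp_hasDerivAt r h1

end Cell

/-! ### Energy estimates -/

section Energy

open MeasureTheory ComplexConjugate

variable {d : ℕ} {L : Fin d → ℝ}

/-- The square of the `L²` norm over the period cell. -/
def sqNorm (ψ : smoothPeriodic ℂ L) : ℝ := ∫ x in cell L, ‖ψ.1 x‖ ^ 2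

theorem cellNorm_eq (ψ : smoothPeriodic ℂ L) : cellNorm ψ = √(sqNorm ψ) := rfl

theorem sqNorm_nonneg (ψ : smoothPeriodic ℂ L) : 0 ≤ sqNorm ψ :=
  integral_nonneg fun _ => by positivity

theorem integrableOn_sqNorm (ψ : smoothPeriodic ℂ L) : IntegrableOn (fun x => ‖ψ.1 x‖ ^ 2) (cell L) :=
  integrableOn_cell (ψ.2.1.continuous.norm.pow 2)

theorem sqNorm_le_of_norm_le {ψ φ : smoothPeriodic ℂ L} {c : ℝ}
    (h : ∀ x ∈ cell L, ‖ψ.1 x‖ ≤ c * ‖φ.1 x‖) : sqNorm ψ ≤ c ^ 2 * sqNorm φ := by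
  rw [sqNorm, sqNorm, ← integral_const_mul]
  refine setIntegral_mono_on (integrableOn_sqNorm ψ) ((integrableOn_sqNorm φ).const_mul _)
    (measurableSet_cell L) fun x hx => ?_
  rw [← mul_pow]
  exact pow_le_pow_left₀ (norm_nonneg _) (h x hx) 2

theorem sqNorm_smul (c : ℂ) (ψ : smoothPeriodic ℂ L) : sqNorm (c • ψ) = ‖c‖ ^ 2 * sqNorm ψ := by
  rw [sqNorm, sqNorm, ← integral_const_mul]
  refine integral_congr_ae (Filter.Eventually.of_forall fun x => ?_)
  change ‖c * ψ.1 x‖ ^ 2 = _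
  rw [norm_mul, mul_pow]

theorem sqNorm_sum_le {ι : Type*} (s : Finset ι) (ψ : ι → smoothPeriodic ℂ L) :
    sqNorm (∑ i ∈ s, ψ i) ≤ s.card * ∑ i ∈ s, sqNorm (ψ i) := by
  simp only [sqNorm]
  rw [← integral_finsetSum _ fun i _ => integrableOn_sqNorm (ψ i), ← integral_const_mul]
  refine integral_mono (integrableOn_sqNorm _)
    ((integrable_finsetSum _ fun i _ => integrableOn_sqNorm (ψ i)).const_mul _) fun x => ?_
  have e : (∑ i ∈ s, ψ i : smoothPeriodic ℂ L).1 x = ∑ i ∈ s, (ψ i).1 x := by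
    rw [AddSubmonoidClass.coe_finsetSum, Finset.sum_apply]
  change ‖(∑ i ∈ s, ψ i : smoothPeriodic ℂ L).1 x‖ ^ 2 ≤ s.card * ∑ i ∈ s, ‖(ψ i).1 x‖ ^ 2
  rw [e]
  refine (pow_le_pow_left₀ (norm_nonneg _) (norm_sum_le _ _) 2).trans ?_
  exact sq_sum_le_card_mul_sum_sq

theorem sqNorm_add_le (ψ φ : smoothPeriodic ℂ L) : sqNorm (ψ + φ) ≤ 2 * (sqNorm ψ + sqNorm φ) := by
  have := sqNorm_sum_le Finset.univ ![ψ, φ]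
  simpa using this

/-- Skew-symmetry with respect to the real `L²` inner product over the period cell. -/
def IsSkew (X : Module.End ℂ (smoothPeriodic ℂ L)) : Prop :=
  ∀ ψ, ∫ x in cell L, (conj (ψ.1 x) * (X ψ).1 x).re = 0

theorem continuous_re_conj_mul (ψ φ : smoothPeriodic ℂ L) :
    Continuous fun x => (conj (ψ.1 x) * φ.1 x).re :=
  Complex.continuous_re.comp
    ((Complex.continuous_conj.comp ψ.2.1.continuous).mul φ.2.1.continuous)

theorem IsSkew.add {X Y : Module.End ℂ (smoothPeriodic ℂ L)} (hX : IsSkew X) (hY : IsSkew Y) :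
    IsSkew (X + Y) := fun ψ => by
  have e : ∀ x, (conj (ψ.1 x) * ((X + Y) ψ).1 x).re =
      (conj (ψ.1 x) * (X ψ).1 x).re + (conj (ψ.1 x) * (Y ψ).1 x).re := fun x => by
    rw [← Complex.add_re, ← mul_add]
    rfl
  simp only [e]
  rw [integral_add (integrableOn_cell (continuous_re_conj_mul ψ _))
    (integrableOn_cell (continuous_re_conj_mul ψ _)), hX, hY, add_zero]

theorem IsSkew.smul {X : Module.End ℂ (smoothPeriodic ℂ L)} (hX : IsSkew X) (c : ℝ) :
    IsSkew ((c : ℂ) • X) := fun ψ => by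
  have e : ∀ x, (conj (ψ.1 x) * (((c : ℂ) • X) ψ).1 x).re = c * (conj (ψ.1 x) * (X ψ).1 x).re :=
    fun x => by
      change (conj (ψ.1 x) * ((c : ℂ) * (X ψ).1 x)).re = _
      rw [mul_left_comm, Complex.re_ofReal_mul]
  simp only [e]
  rw [integral_const_mul, hX, mul_zero]

theorem IsSkew.neg {X : Module.End ℂ (smoothPeriodic ℂ L)} (hX : IsSkew X) : IsSkew (-X) := by
  rw [show -X = ((-1 : ℝ) : ℂ) • X by
    ext ψ x
    change -(X ψ).1 x = ((-1 : ℝ) : ℂ) * (X ψ).1 x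
    push_cast
    ring]
  exact hX.smul (-1)

theorem isSkew_mulOp (w : smoothPeriodic ℝ L) : IsSkew ((-Complex.I) • mulOp w) := fun ψ => by
  have e : ∀ x, (conj (ψ.1 x) * (((-Complex.I) • mulOp w) ψ).1 x).re = 0 := fun x => by
    change (conj (ψ.1 x) * (-Complex.I * ((w.1 x : ℂ) * ψ.1 x))).re = 0
    simp
    ring
  simp only [e, integral_zero]

theorem partialDeriv_clm {F G : Type*} [NormedAddCommGroup F] [NormedSpace ℝ F]
    [NormedAddCommGroup G] [NormedSpace ℝ G] (l : F →L[ℝ] G) {f : EuclideanSpace ℝ (Fin d) → F}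
    (hf : ContDiff ℝ ∞ f) (i : Fin d) (x : EuclideanSpace ℝ (Fin d)) :
    partialDeriv i (fun x => l (f x)) x = l (partialDeriv i f x) := by
  have h := l.hasFDerivAt.comp x (hf.differentiable (by simp) x).hasFDerivAt
  change fderiv ℝ (l ∘ f) x _ = _
  rw [h.fderiv]
  rfl

/-- The integrand is a constant times the divergence of the current `Im (conj ψ ∂ᵢψ)`, because
`|∂ᵢψ|²` is real; a divergence integrates to zero over the cell. -/
theorem isSkew_kineticOp (hL : ∀ i, 0 < L i) (μ : ℝ) :
    IsSkew ((-Complex.I) • kineticOp L μ) := fun ψ => by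
  have hc : ContDiff ℝ ∞ fun x => conj (ψ.1 x) := Complex.conjCLE.contDiff.comp ψ.2.1
  have hψ := ψ.2.1
  let g : Fin d → EuclideanSpace ℝ (Fin d) → ℝ := fun i x =>
    Complex.imCLM (conj (ψ.1 x) * partialDeriv i ψ.1 x)
  have hg : ∀ i, ContDiff ℝ ∞ (g i) := fun i =>
    Complex.imCLM.contDiff.comp (hc.mul (contDiff_partialDeriv hψ i))
  have hgp : ∀ j i x, g j (x + EuclideanSpace.single i (L i)) = g j x := fun j i x => by
    simp only [g, partialDeriv_add_right (ψ.2.2 i), ψ.2.2 i]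
  have hgd : ∀ i x, partialDeriv i (g i) x =
      (conj (ψ.1 x) * partialDeriv i (partialDeriv i ψ.1) x).im := fun i x => by
    have h1 := partialDeriv_clm Complex.imCLM (hc.mul (contDiff_partialDeriv hψ i)) i x
    have h2 := partialDeriv_mul hc (contDiff_partialDeriv hψ i) i x
    have h3 : partialDeriv i (fun x => conj (ψ.1 x)) x = conj (partialDeriv i ψ.1 x) :=
      partialDeriv_clm Complex.conjCLE.toContinuousLinearMap hψ i x
    refine h1.trans ?_
    rw [h2, h3, map_add, Complex.mul_conj]
    simp
  have e : ∀ x, (conj (ψ.1 x) * (((-Complex.I) • kineticOp L μ) ψ).1 x).re =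
      -(1 / (2 * μ)) * ∑ i, partialDeriv i (g i) x := fun x => by
    change (conj (ψ.1 x) * (-Complex.I * ((-(1 / (2 * μ) : ℝ) : ℂ) *
      Laplacian.laplacian ψ.1 x))).re = _
    rw [laplacian_eq_sum_partialDeriv hψ]
    simp only [hgd]
    rw [← Complex.im_sum, ← Finset.mul_sum]
    generalize ∑ i, partialDeriv i (partialDeriv i ψ.1) x = S
    rw [show conj (ψ.1 x) * (-Complex.I * ((-(1 / (2 * μ) : ℝ) : ℂ) * S)) =
      ((1 / (2 * μ) : ℝ) : ℂ) * (Complex.I * (conj (ψ.1 x) * S)) by push_cast; ring,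
      Complex.re_ofReal_mul, Complex.I_mul_re]
    ring
  simp only [e]
  rw [integral_const_mul, integral_finsetSum _ fun i _ =>
    integrableOn_cell (contDiff_partialDeriv (hg i) i).continuous]
  simp only [integral_cell_partialDeriv hL (hg _) (hgp _), Finset.sum_const_zero, mul_zero]

/-- The energy estimate for `w' = X w + g` with `X` skew. -/
theorem IsSkew.sqNorm_le {X : Module.End ℂ (smoothPeriodic ℂ L)} (hX : IsSkew X)
    {w g : ℝ → smoothPeriodic ℂ L} (hw : JointlySmooth w)
    (hd : ∀ r x, HasDerivAt (fun r => (w r).1 x) ((X (w r)).1 x + (g r).1 x) r) {B : ℝ}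
    (hB : ∀ r ∈ Set.Icc (0 : ℝ) 1, sqNorm (g r) ≤ B) :
    sqNorm (w 1) ≤ 3 * (sqNorm (w 0) + B) := by
  have hB0 : 0 ≤ B := (sqNorm_nonneg _).trans (hB 0 (by simp))
  -- Neither summand is assumed jointly continuous, but the sum is the time derivative of the
  -- jointly smooth `w`.
  have hcont : Continuous fun p : ℝ × EuclideanSpace ℝ (Fin d) => (X (w p.1)).1 p.2 + (g p.1).1 p.2 := by
    have h1 : Continuous fun p : ℝ × EuclideanSpace ℝ (Fin d) =>
        fderiv ℝ (fun p : ℝ × EuclideanSpace ℝ (Fin d) => (w p.1).1 p.2) p (1, 0) :=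
      (hw.continuous_fderiv (by simp)).clm_apply continuous_const
    refine h1.congr fun p => ?_
    have h2 := (hw.differentiable (by simp) (p.1, p.2)).hasFDerivAt.comp_hasDerivAt p.1
      ((hasDerivAt_id p.1).prodMk (hasDerivAt_const p.1 p.2))
    exact h2.unique (hd p.1 p.2)
  have hN : ∀ r, HasDerivAt (fun r => sqNorm (w r))
      (∫ x in cell L, 2 * (conj ((w r).1 x) * ((X (w r)).1 x + (g r).1 x)).re) r := by
    refine hasDerivAt_integral_cell (G := fun r x => ‖(w r).1 x‖ ^ 2)
      (G' := fun r x => 2 * (conj ((w r).1 x) * ((X (w r)).1 x + (g r).1 x)).re)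
      (fun r => (w r).2.1.continuous.norm.pow 2) ?_ fun r x => ?_
    · exact continuous_const.mul (Complex.continuous_re.comp
        ((Complex.continuous_conj.comp hw.continuous).mul hcont))
    · have := (hd r x).norm_sq
      rw [Complex.inner, mul_comm (_ + _)] at this
      exact this
  have hle : ∀ r ∈ Set.Icc (0 : ℝ) 1,
      ∫ x in cell L, 2 * (conj ((w r).1 x) * ((X (w r)).1 x + (g r).1 x)).re ≤ sqNorm (w r) + B := by
    intro r hr
    have e : ∀ x, 2 * (conj ((w r).1 x) * ((X (w r)).1 x + (g r).1 x)).re =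
        2 * (conj ((w r).1 x) * (X (w r)).1 x).re + 2 * (conj ((w r).1 x) * (g r).1 x).re := fun x => by
      rw [mul_add, Complex.add_re]
      ring
    simp only [e]
    have hi := fun φ : smoothPeriodic ℂ L =>
      (integrableOn_cell (L := L) (continuous_re_conj_mul (w r) φ)).const_mul 2
    rw [integral_add (hi _) (hi _), integral_const_mul, hX, mul_zero, zero_add]
    refine le_trans ?_ (add_le_add_right (hB r hr) _)
    rw [sqNorm, sqNorm, ← integral_add (integrableOn_sqNorm _) (integrableOn_sqNorm _)]
    refine integral_mono (hi _) ((integrableOn_sqNorm _).add (integrableOn_sqNorm _)) fun x => ?_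
    have h1 : (conj ((w r).1 x) * (g r).1 x).re ≤ ‖(w r).1 x‖ * ‖(g r).1 x‖ := by
      refine (Complex.re_le_norm _).trans ?_
      rw [norm_mul, RCLike.norm_conj]
    change 2 * (conj ((w r).1 x) * (g r).1 x).re ≤ ‖(w r).1 x‖ ^ 2 + ‖(g r).1 x‖ ^ 2
    nlinarith [sq_nonneg (‖(w r).1 x‖ - ‖(g r).1 x‖)]
  set N' : ℝ → ℝ := fun r =>
    ∫ x in cell L, 2 * (conj ((w r).1 x) * ((X (w r)).1 x + (g r).1 x)).re
  -- Gronwall: the squared norm `N` satisfies `N' ≤ N + B`, so this function does not increase on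
  -- `[0, 1]`. The constant `3` is a bound for `e`.
  have hh : ∀ r, HasDerivAt (fun r => Real.exp (-r) * sqNorm (w r) - B * r)
      (Real.exp (-r) * (N' r - sqNorm (w r)) - B) r := fun r => by
    have h1 := ((hasDerivAt_neg r).exp.mul (hN r)).sub ((hasDerivAt_id r).const_mul B)
    refine h1.congr_deriv ?_
    simp only [N']
    ring
  have hanti : AntitoneOn (fun r => Real.exp (-r) * sqNorm (w r) - B * r) (Set.Icc 0 1) := by
    refine antitoneOn_of_deriv_nonpos (convex_Icc 0 1)
      (fun r _ => (hh r).continuousAt.continuousWithinAt)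
      (fun r _ => (hh r).differentiableAt.differentiableWithinAt) fun r hr => ?_
    rw [(hh r).deriv]
    have hr' := interior_subset hr
    have h1 : Real.exp (-r) ≤ 1 := Real.exp_le_one_iff.2 (by linarith [hr'.1])
    have h2 := hle r hr'
    have h3 := Real.exp_pos (-r)
    have h4 : N' r - sqNorm (w r) ≤ B := by linarith
    nlinarith
  have h1 := hanti (by simp) (by simp) zero_le_one
  simp only [neg_zero, Real.exp_zero, one_mul, mul_zero, sub_zero, mul_one] at h1
  have h2 : Real.exp 1 * Real.exp (-1) = 1 := by rw [← Real.exp_add]; simp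
  have h3 : Real.exp 1 ≤ 3 := (Real.exp_one_lt_d9.le.trans (by norm_num))
  have h4 : sqNorm (w 1) = Real.exp 1 * (Real.exp (-1) * sqNorm (w 1)) := by
    rw [← mul_assoc, h2, one_mul]
  rw [h4]
  have h5 : Real.exp (-1) * sqNorm (w 1) ≤ sqNorm (w 0) + B := by linarith
  exact (mul_le_mul_of_nonneg_left h5 (Real.exp_pos 1).le).trans
    (mul_le_mul_of_nonneg_right h3 (add_nonneg (sqNorm_nonneg _) hB0))

/-- The path `φ` is compared with `p(r) = ∑ rᵏ/k! Yᵏ q`. Since `X p - p' = ∑ rᵏ/k! (X - Y) Yᵏ q +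
r⁶/6! Y⁷ q`, the difference `φ - p` solves the equation of `X` with this source, and the energy
estimate applies. Only `X` has to be skew, so `Y` may be a truncation and neither operator has to be
bounded. -/
theorem ExpMaps.sqNorm_sub_expSum_le {X : Module.End ℂ (smoothPeriodic ℂ L)} (hX : IsSkew X)
    {ψ ψ' : smoothPeriodic ℂ L} (h : ExpMaps X ψ ψ') (Y : Module.End ℂ (smoothPeriodic ℂ L))
    (q : smoothPeriodic ℂ L) :
    sqNorm (ψ' - expSum Y q) ≤ 3 * (sqNorm (ψ - q) + 2 * (7 * ∑ k ∈ Finset.range 7,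
      sqNorm ((X - Y) ((Y ^ k) q)) + sqNorm ((Y ^ 7) q))) := by
  obtain ⟨φ, hφ, hφ0, hφ1, hd⟩ := h
  let c : ℕ → ℝ → ℂ := fun k r => (k.factorial : ℂ)⁻¹ * (r : ℂ) ^ k
  have hc : ∀ k r, r ∈ Set.Icc (0 : ℝ) 1 → ‖c k r‖ ^ 2 ≤ 1 := fun k r hr => by
    have h1 : ‖c k r‖ ≤ 1 := by
      simp only [c, norm_mul, norm_inv, norm_pow, Complex.norm_natCast, Complex.norm_real,
        Real.norm_eq_abs, abs_of_nonneg hr.1]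
      exact mul_le_one₀ (inv_le_one_of_one_le₀ (by exact_mod_cast k.factorial_pos)) (pow_nonneg hr.1 _) (pow_le_one₀ hr.1 hr.2)
    exact pow_le_one₀ (norm_nonneg _) h1
  let p : ℝ → smoothPeriodic ℂ L := fun r => ∑ k ∈ Finset.range 7, c k r • (Y ^ k) q
  have hpx : ∀ r x, (p r).1 x = ∑ k ∈ Finset.range 7, c k r * ((Y ^ k) q).1 x := fun r x => by
    simp only [p]
    rw [AddSubmonoidClass.coe_finsetSum, Finset.sum_apply]
    rfl
  have hp : JointlySmooth p := by
    unfold JointlySmooth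
    simp only [hpx]
    refine ContDiff.sum fun k _ => ContDiff.mul ?_ (((Y ^ k) q).2.1.comp contDiff_snd)
    exact contDiff_const.mul ((Complex.ofRealCLM.contDiff.comp contDiff_fst).pow k)
  have hcd : ∀ k r, HasDerivAt (c (k + 1)) (c k r) r := fun k r => by
    have h1 := (((hasDerivAt_id r).ofReal_comp.pow (k + 1))).const_mul (((k + 1).factorial : ℂ)⁻¹)
    refine h1.congr_deriv ?_
    have : (k.factorial : ℂ) ≠ 0 := by exact_mod_cast k.factorial_ne_zero
    have hk : (k + 1 : ℂ) ≠ 0 := by exact_mod_cast k.succ_ne_zero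
    simp only [c, Nat.factorial_succ, id]
    push_cast
    field_simp
  let g : ℝ → smoothPeriodic ℂ L := fun r =>
    ∑ k ∈ Finset.range 7, c k r • (X - Y) ((Y ^ k) q) + c 6 r • (Y ^ 7) q
  have hpd : ∀ r x, HasDerivAt (fun r => (p r).1 x)
      (∑ k ∈ Finset.range 6, c k r * ((Y ^ (k + 1)) q).1 x) r := fun r x => by
    simp only [hpx, Finset.sum_range_succ' _ 6]
    have h0 : HasDerivAt (fun r => c 0 r * ((Y ^ 0) q).1 x) 0 r := by
      simpa [c] using hasDerivAt_const r (q.1 x)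
    rw [← add_zero (∑ k ∈ Finset.range 6, _)]
    exact (HasDerivAt.fun_sum fun k _ => (hcd k r).mul_const _).add h0
  have hmain : ∀ r x, HasDerivAt (fun r => (φ r - p r).1 x)
      ((X (φ r - p r)).1 x + (g r).1 x) r := fun r x => by
    refine ((hd r x).sub (hpd r x)).congr_deriv ?_
    have hX1 : X (φ r - p r) = X (φ r) - X (p r) := map_sub _ _ _
    have hg : g r = X (p r) - ∑ k ∈ Finset.range 6, c k r • (Y ^ (k + 1)) q := by
      have hy : ∀ k, Y ((Y ^ k) q) = (Y ^ (k + 1)) q := fun k => by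
        rw [pow_succ' Y k]
        rfl
      simp only [g, p, map_sum, map_smul, LinearMap.sub_apply, smul_sub, hy]
      rw [Finset.sum_sub_distrib, Finset.sum_range_succ (fun k => c k r • (Y ^ (k + 1)) q) 6]
      abel
    have hs : (∑ k ∈ Finset.range 6, c k r • (Y ^ (k + 1)) q : smoothPeriodic ℂ L).1 x =
        ∑ k ∈ Finset.range 6, c k r * ((Y ^ (k + 1)) q).1 x := by
      rw [AddSubmonoidClass.coe_finsetSum, Finset.sum_apply]
      rfl
    rw [hX1, hg]
    change _ = ((X (φ r)).1 x - (X (p r)).1 x) + ((X (p r)).1 x - _)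
    rw [hs]
    ring
  have hB : ∀ r ∈ Set.Icc (0 : ℝ) 1, sqNorm (g r) ≤ 2 * (7 * ∑ k ∈ Finset.range 7,
      sqNorm ((X - Y) ((Y ^ k) q)) + sqNorm ((Y ^ 7) q)) := fun r hr => by
    refine (sqNorm_add_le _ _).trans ?_
    have h1 := sqNorm_sum_le (Finset.range 7) fun k => c k r • (X - Y) ((Y ^ k) q)
    have h2 : ∀ k (f : smoothPeriodic ℂ L), sqNorm (c k r • f) ≤ sqNorm f := fun k f => by
      rw [sqNorm_smul]
      exact mul_le_of_le_one_left (sqNorm_nonneg _) (hc k r hr)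
    have h3 := Finset.sum_le_sum fun k (_ : k ∈ Finset.range 7) => h2 k ((X - Y) ((Y ^ k) q))
    have h4 := h2 6 ((Y ^ 7) q)
    rw [Finset.card_range] at h1
    push_cast at h1
    linarith
  have hfin := hX.sqNorm_le (w := fun r => φ r - p r) (g := g) (hφ.sub hp) hmain hB
  have hp0 : p 0 = q := by
    simp [p, c, Finset.sum_range_succ]
  have hp1 : p 1 = expSum Y q := by
    simp [p, c, expSum, LinearMap.sum_apply]
  simpa only [hφ0, hφ1, hp0, hp1] using hfin

end Energy

/-! ### Smooth families of functions and operators -/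

section PartialDerivParam

variable {d : ℕ} {W F : Type*} [NormedAddCommGroup W] [NormedSpace ℝ W]
  [NormedAddCommGroup F] [NormedSpace ℝ F]

theorem partialDeriv_param {H : W × EuclideanSpace ℝ (Fin d) → F} (hH : ContDiff ℝ ∞ H) (i : Fin d)
    (p : W) (x : EuclideanSpace ℝ (Fin d)) :
    partialDeriv i (fun y => H (p, y)) x = fderiv ℝ H (p, x) (0, EuclideanSpace.single i 1) := by
  have h := (hH.differentiable (by simp) (p, x)).hasFDerivAt.comp x
    ((hasFDerivAt_const p x).prodMk (hasFDerivAt_id x))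
  have h' : HasFDerivAt (fun y => H (p, y)) _ x := h
  rw [partialDeriv, h'.fderiv]
  rfl

theorem contDiff_partialDeriv_param {H : W × EuclideanSpace ℝ (Fin d) → F} (hH : ContDiff ℝ ∞ H)
    (i : Fin d) : ContDiff ℝ ∞ fun q : W × EuclideanSpace ℝ (Fin d) =>
      partialDeriv i (fun y => H (q.1, y)) q.2 := by
  simp only [partialDeriv_param hH]
  exact (hH.fderiv_right (m := ∞) (by norm_cast)).clm_apply contDiff_const

theorem hasDerivAt_fst {H : ℝ × EuclideanSpace ℝ (Fin d) → F} (hH : ContDiff ℝ ∞ H) (t : ℝ)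
    (x : EuclideanSpace ℝ (Fin d)) :
    HasDerivAt (fun r => H (r, x)) (fderiv ℝ H (t, x) (1, 0)) t :=
  (hH.differentiable (by simp) (t, x)).hasFDerivAt.comp_hasDerivAt t
    ((hasDerivAt_id t).prodMk (hasDerivAt_const t x))

/-- Time derivatives commute with partial derivatives. -/
theorem hasDerivAt_partialDeriv {H : ℝ × EuclideanSpace ℝ (Fin d) → F} (hH : ContDiff ℝ ∞ H)
    {G : ℝ → EuclideanSpace ℝ (Fin d) → F} (hG : ∀ t x, HasDerivAt (fun r => H (r, x)) (G t x) t)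
    (i : Fin d) (t : ℝ) (x : EuclideanSpace ℝ (Fin d)) :
    HasDerivAt (fun r => partialDeriv i (fun y => H (r, y)) x) (partialDeriv i (G t) x) t := by
  have hG' : G t = fun y => fderiv ℝ H (t, y) (1, 0) :=
    funext fun y => (hG t y).unique (hasDerivAt_fst hH t y)
  have hd : ContDiff ℝ ∞ (fderiv ℝ H) := hH.fderiv_right (m := ∞) (by norm_cast)
  have hd' : Differentiable ℝ (fderiv ℝ H) := hd.differentiable (by simp)
  have hsymm : IsSymmSndFDerivAt ℝ H (t, x) := by
    refine hH.contDiffAt.isSymmSndFDerivAt ?_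
    simp only [minSmoothness_of_isRCLikeNormedField]
    norm_cast
  have hclm : ∀ (v : ℝ × EuclideanSpace ℝ (Fin d)) q,
      fderiv ℝ (fun q => fderiv ℝ H q v) q = (fderiv ℝ (fderiv ℝ H) q).flip v := fun v q => by
    rw [fderiv_clm_apply (hd' q) (differentiableAt_const _)]
    simp
  rw [hG', partialDeriv_param (H := fun q => fderiv ℝ H q (1, 0)) (hd.clm_apply contDiff_const), hclm]
  simp only [partialDeriv_param hH]
  have h := hasDerivAt_fst (H := fun q => fderiv ℝ H q (0, EuclideanSpace.single i 1))
    (hd.clm_apply contDiff_const) t x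
  rw [hclm] at h
  refine h.congr_deriv ?_
  exact hsymm _ _

end PartialDerivParam

/-! ### Algebras of operator families acting on families of vectors -/

section PreservingFamily

variable {P V : Type*} [AddCommGroup V] [Module ℂ V]

/-- Families of endomorphisms that preserve a given module of families of vectors. -/
def preservingFamily (M : Submodule ℂ (P → V)) : Subalgebra ℂ (P → Module.End ℂ V) where
  carrier := {X | ∀ F ∈ M, (fun p => X p (F p)) ∈ M}
  mul_mem' hX hY _ hF := hX _ (hY _ hF)
  add_mem' hX hY _ hF := M.add_mem (hX _ hF) (hY _ hF)
  algebraMap_mem' c _ hF := M.smul_mem c hF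

/-- The type of families of endomorphisms that preserve a given module of families of vectors. -/
def PreservingFamily (M : Submodule ℂ (P → V)) : Type _ := preservingFamily M

variable (M : Submodule ℂ (P → V))

instance : Ring (PreservingFamily M) := inferInstanceAs (Ring (preservingFamily M))

instance : Algebra ℂ (PreservingFamily M) := inferInstanceAs (Algebra ℂ (preservingFamily M))

/-- The value of a family at a parameter. -/
def evalFamily (p : P) : PreservingFamily M →ₐ[ℂ] Module.End ℂ V :=
  (Pi.evalAlgHom ℂ (fun _ : P => Module.End ℂ V) p).comp (preservingFamily M).val

/-- The action on families of vectors. -/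
def familyAction : PreservingFamily M →ₐ[ℂ] Module.End ℂ M where
  toFun X :=
    { toFun := fun F => ⟨fun p => X.1 p (F.1 p), X.2 F.1 F.2⟩
      map_add' := fun _ _ => Subtype.ext (funext fun p => map_add (X.1 p) _ _)
      map_smul' := fun c _ => Subtype.ext (funext fun p => map_smul (X.1 p) c _) }
  map_one' := rfl
  map_mul' _ _ := rfl
  map_zero' := rfl
  map_add' _ _ := rfl
  commutes' _ := rfl

theorem familyAction_flowCoeff_mem_of_leibniz (D : Submodule ℂ (M × M))
    (a : ℕ → PreservingFamily M)
    (ha : ∀ j f g, (f, g) ∈ D → (familyAction M (a j) f,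
      familyAction M (a j) g + (j + 1 : ℂ) • familyAction M (a (j + 1)) f) ∈ D)
    {y : M} (hy : (y, familyAction M (a 0) y) ∈ D) (k : ℕ) :
    (familyAction M (flowCoeff a k) y, (k + 1 : ℂ) • familyAction M (flowCoeff a (k + 1)) y) ∈ D := by
  have e := map_flowCoeff (Q := Module.End ℂ M) (familyAction M) a
  rw [e, e]
  exact flowCoeff_mem_of_leibniz D (fun j => familyAction M (a j)) k (fun j _ => ha j) hy k le_rfl

end PreservingFamily

/-! ### Smooth families of periodic functions and the Taylor coefficients of a solution -/

section Families

variable {d : ℕ} {L : Fin d → ℝ} {𝕜 : Type*} [RCLike 𝕜] {W : Type*} [NormedAddCommGroup W]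
  [NormedSpace ℝ W]

/-- Families of periodic functions that are smooth in the parameter and the space variable. -/
def SmoothFamily (f : W → smoothPeriodic 𝕜 L) : Prop :=
  ContDiff ℝ ∞ fun q : W × EuclideanSpace ℝ (Fin d) => (f q.1).1 q.2

theorem SmoothFamily.comp {W' : Type*} [NormedAddCommGroup W'] [NormedSpace ℝ W']
    {f : W → smoothPeriodic 𝕜 L} (hf : SmoothFamily f) {g : W' → W} (hg : ContDiff ℝ ∞ g) :
    SmoothFamily fun p => f (g p) := by
  have h : ContDiff ℝ ∞ fun q : W' × EuclideanSpace ℝ (Fin d) => (g q.1, q.2) :=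
    (hg.comp contDiff_fst).prodMk contDiff_snd
  exact ContDiff.comp hf h

theorem SmoothFamily.laplacian {f : W → smoothPeriodic 𝕜 L} (hf : SmoothFamily f) :
    ContDiff ℝ ∞ fun q : W × EuclideanSpace ℝ (Fin d) => Laplacian.laplacian (f q.1).1 q.2 := by
  have h : ∀ q : W × EuclideanSpace ℝ (Fin d), Laplacian.laplacian (f q.1).1 q.2 =
      ∑ i, partialDeriv i (partialDeriv i (f q.1).1) q.2 := fun q =>
    laplacian_eq_sum_partialDeriv (f q.1).2.1 q.2
  simp only [h]
  exact ContDiff.sum fun i _ => contDiff_partialDeriv_param (contDiff_partialDeriv_param hf i) i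

theorem hasDerivAt_laplacian {f g : ℝ → smoothPeriodic 𝕜 L} (hf : JointlySmooth f)
    (h : ∀ t x, HasDerivAt (fun r => (f r).1 x) ((g t).1 x) t) (t : ℝ)
    (x : EuclideanSpace ℝ (Fin d)) :
    HasDerivAt (fun r => Laplacian.laplacian (f r).1 x) (Laplacian.laplacian (g t).1 x) t := by
  simp only [laplacian_eq_sum_partialDeriv (f _).2.1, laplacian_eq_sum_partialDeriv (g _).2.1]
  refine HasDerivAt.fun_sum fun i _ => ?_
  exact hasDerivAt_partialDeriv (H := fun q : ℝ × EuclideanSpace ℝ (Fin d) =>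
    partialDeriv i (fun y => (f q.1).1 y) q.2) (contDiff_partialDeriv_param hf i)
    (fun t x => hasDerivAt_partialDeriv hf h i t x) i t x

/-- The time derivative of a smooth family. -/
def timeDeriv {f : ℝ → smoothPeriodic 𝕜 L} (hf : JointlySmooth f) (t : ℝ) : smoothPeriodic 𝕜 L :=
  ⟨fun x => fderiv ℝ (fun q : ℝ × EuclideanSpace ℝ (Fin d) => (f q.1).1 q.2) (t, x) (1, 0),
    (((hf.fderiv_right (m := ∞) (by norm_cast)).clm_apply contDiff_const).comp
      (contDiff_const.prodMk contDiff_id) :), fun i x => by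
      have hv : (fun q : ℝ × EuclideanSpace ℝ (Fin d) =>
          (f (q + (0, EuclideanSpace.single i (L i))).1).1 (q + (0, EuclideanSpace.single i (L i))).2) =
          fun q => (f q.1).1 q.2 := by
        funext q
        simp [(f _).2.2 i]
      have h := fderiv_comp_add_right (𝕜 := ℝ)
        (f := fun q : ℝ × EuclideanSpace ℝ (Fin d) => (f q.1).1 q.2) (x := (t, x))
        (0, EuclideanSpace.single i (L i))
      rw [hv, Prod.mk_add_mk, add_zero] at h
      exact congrArg (fun l => l (1, 0)) h.symm⟩

theorem jointlySmooth_timeDeriv {f : ℝ → smoothPeriodic 𝕜 L} (hf : JointlySmooth f) :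
    JointlySmooth (timeDeriv hf) :=
  (hf.fderiv_right (m := ∞) (by norm_cast)).clm_apply contDiff_const

theorem hasDerivAt_timeDeriv {f : ℝ → smoothPeriodic 𝕜 L} (hf : JointlySmooth f) (t : ℝ)
    (x : EuclideanSpace ℝ (Fin d)) :
    HasDerivAt (fun r => (f r).1 x) ((timeDeriv hf t).1 x) t :=
  hasDerivAt_fst hf t x

/-- The scaled time derivatives of a smooth family. -/
def timeCoeff {V : ℝ → smoothPeriodic ℝ L} (hV : JointlySmooth V) :
    ℕ → {f : ℝ → smoothPeriodic ℝ L // JointlySmooth f}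
  | 0 => ⟨V, hV⟩
  | j + 1 => ⟨fun t => ((j + 1 : ℝ)⁻¹) • timeDeriv (timeCoeff hV j).2 t,
      contDiff_const.mul (jointlySmooth_timeDeriv (timeCoeff hV j).2)⟩

variable {V : ℝ → smoothPeriodic ℝ L} (hV : JointlySmooth V)

theorem timeDeriv_timeCoeff (j : ℕ) (t : ℝ) :
    timeDeriv (timeCoeff hV j).2 t = (j + 1 : ℝ) • (timeCoeff hV (j + 1)).1 t := by
  have : (j + 1 : ℝ) ≠ 0 := by positivity
  rw [timeCoeff, smul_smul, mul_inv_cancel₀ this, one_smul]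

theorem hasDerivAt_timeCoeff (j : ℕ) (t : ℝ) (x : EuclideanSpace ℝ (Fin d)) :
    HasDerivAt (fun r => ((timeCoeff hV j).1 r).1 x)
      ((j + 1 : ℝ) • ((timeCoeff hV (j + 1)).1 t).1 x) t := by
  have h := hasDerivAt_timeDeriv (timeCoeff hV j).2 t x
  rw [timeDeriv_timeCoeff] at h
  exact h

theorem hasDerivAt_partialDeriv_timeCoeff (i : Fin d) (j : ℕ) (t : ℝ)
    (x : EuclideanSpace ℝ (Fin d)) :
    HasDerivAt (fun r => partialDeriv i ((timeCoeff hV j).1 r).1 x)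
      ((j + 1 : ℝ) • partialDeriv i ((timeCoeff hV (j + 1)).1 t).1 x) t := by
  refine (hasDerivAt_partialDeriv (timeCoeff hV j).2 (hasDerivAt_timeCoeff hV j) i t x).congr_deriv ?_
  exact partialDeriv_clm (ContinuousLinearMap.lsmul ℝ ℝ (j + 1 : ℝ))
    ((timeCoeff hV (j + 1)).1 t).2.1 i x

theorem SmoothFamily.add {f g : W → smoothPeriodic 𝕜 L} (hf : SmoothFamily f)
    (hg : SmoothFamily g) : SmoothFamily (f + g) :=
  ContDiff.add hf hg

theorem SmoothFamily.smul {f : W → smoothPeriodic 𝕜 L} (hf : SmoothFamily f) (c : 𝕜) :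
    SmoothFamily (c • f) :=
  contDiff_const.mul hf

theorem SmoothFamily.zero : SmoothFamily (0 : W → smoothPeriodic 𝕜 L) :=
  contDiff_const (c := (0 : 𝕜))

/-- Smooth families, as a module. -/
def familyModule (L : Fin d → ℝ) : Submodule ℂ (ℝ × ℝ → smoothPeriodic ℂ L) where
  carrier := {F | SmoothFamily F}
  add_mem' hF hG := SmoothFamily.add hF hG
  zero_mem' := SmoothFamily.zero
  smul_mem' c _ hF := SmoothFamily.smul hF c

/-- Families of operators on periodic functions that preserve smooth families. -/
abbrev OperatorFamily (L : Fin d → ℝ) : Type := PreservingFamily (familyModule L)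

/-- Multiplication by a smooth family. -/
def mulFamily {w : ℝ × ℝ → smoothPeriodic ℝ L} (hw : SmoothFamily w) : OperatorFamily L :=
  ⟨fun p => mulOp (w p), fun _ hF => (Complex.ofRealCLM.contDiff.comp hw).mul hF⟩

def kineticFamily (L : Fin d → ℝ) (μ : ℝ) : OperatorFamily L :=
  ⟨fun _ => kineticOp L μ, fun _ hF => contDiff_const.mul hF.laplacian⟩

/-- The step length, as a family of scalar operators. -/
def lengthFamily (L : Fin d → ℝ) : OperatorFamily L :=
  ⟨fun p => (p.2 : ℂ) • 1, fun F (hF : SmoothFamily F) => by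
    have h : ContDiff ℝ ∞ fun q : (ℝ × ℝ) × EuclideanSpace ℝ (Fin d) => ((q.1.2 : ℝ) : ℂ) :=
      Complex.ofRealCLM.contDiff.comp (contDiff_snd.comp contDiff_fst)
    exact h.mul hF⟩

theorem lengthFamily_commute (X : OperatorFamily L) : Commute (lengthFamily L) X := by
  refine Subtype.ext (funext fun p => ?_)
  change ((p.2 : ℂ) • (1 : Module.End ℂ (smoothPeriodic ℂ L))) * X.1 p = X.1 p * ((p.2 : ℂ) • 1)
  rw [smul_mul_assoc, mul_smul_comm, one_mul, mul_one]

theorem lengthFamily_pow_mul_apply (n : ℕ) (X : OperatorFamily L) (p : ℝ × ℝ) :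
    (lengthFamily L ^ n * X).1 p = (p.2 : ℂ) ^ n • X.1 p := by
  change ((p.2 : ℂ) • (1 : Module.End ℂ (smoothPeriodic ℂ L))) ^ n * X.1 p = _
  rw [smul_pow, one_pow, smul_mul_assoc, one_mul]

/-- The scaled derivatives of the generator `-i (T + V)` at the midpoint. -/
def opGenerator (μ : ℝ) (j : ℕ) : OperatorFamily L :=
  (-Complex.I) • ((if j = 0 then kineticFamily L μ else 0) +
    mulFamily (w := fun p => (timeCoeff hV j).1 p.1)
      (SmoothFamily.comp (W := ℝ) (timeCoeff hV j).2 contDiff_fst))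

theorem opGenerator_apply (μ : ℝ) (j : ℕ) (p : ℝ × ℝ) (ψ : smoothPeriodic ℂ L)
    (x : EuclideanSpace ℝ (Fin d)) : ((opGenerator hV μ j).1 p ψ).1 x =
      -Complex.I * ((if j = 0 then (kineticOp L μ ψ).1 x else 0) +
        (((timeCoeff hV j).1 p.1).1 x : ℂ) * ψ.1 x) := by
  rw [opGenerator]
  split_ifs <;> rfl

/-- The derivatives of a solution in terms of the derivatives of the generator. -/
theorem hasDerivAt_flowCoeff_apply {μ : ℝ} {u : ℝ → smoothPeriodic ℂ L} (hu : IsSolution μ V u)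
    (k : ℕ) (p : ℝ × ℝ) (x : EuclideanSpace ℝ (Fin d)) :
    HasDerivAt (fun r => ((flowCoeff (opGenerator hV μ) k).1 (r, p.2) (u r)).1 x)
      ((k + 1 : ℝ) • ((flowCoeff (opGenerator hV μ) (k + 1)).1 p (u p.1)).1 x) p.1 := by
  -- The graph of differentiation in the midpoint at fixed step length. The Leibniz rule for the
  -- kinetic part is that time derivatives commute with the Laplacian.
  let D : Submodule ℂ (familyModule L × familyModule L) :=
    { carrier := {f | ∀ p x, HasDerivAt (fun r => (f.1.1 (r, p.2)).1 x) ((f.2.1 p).1 x) p.1}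
      add_mem' := by
        intro f g hf hg p x
        exact (hf p x).add (hg p x)
      zero_mem' := fun p _ => hasDerivAt_const p.1 (0 : ℂ)
      smul_mem' := by
        intro c f hf p x
        exact (hf p x).const_mul c }
  let y : familyModule L := ⟨fun p => u p.1, SmoothFamily.comp (W := ℝ) hu.1 contDiff_fst⟩
  have h := familyAction_flowCoeff_mem_of_leibniz (familyModule L) D (opGenerator hV μ)
    (fun j f g hfg p x => ?_) (y := y) (fun p x => ?_) k
  · refine (h p x).congr_deriv ?_
    change (k + 1 : ℂ) * _ = _
    rw [← Complex.coe_smul]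
    push_cast
    rfl
  · have hfs : JointlySmooth fun r => f.1 (r, p.2) :=
      SmoothFamily.comp (W' := ℝ) f.2 (contDiff_id.prodMk contDiff_const)
    have hf1 := fun t x => hfg (t, p.2) x
    have hlap := hasDerivAt_laplacian (f := fun r => f.1 (r, p.2)) (g := fun r => g.1 (r, p.2))
      hfs hf1 p.1 x
    have hV' := (hasDerivAt_timeCoeff hV j p.1 x).ofReal_comp
    have hVf := hV'.mul (hfg p x)
    have e1 : ∀ r, (((familyAction (familyModule L) (opGenerator hV μ j)) f).1 (r, p.2)).1 x = -Complex.I *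
        ((if j = 0 then (-(1 / (2 * μ) : ℝ) : ℂ) * Laplacian.laplacian (f.1 (r, p.2)).1 x else 0) +
          (((timeCoeff hV j).1 r).1 x : ℂ) * (f.1 (r, p.2)).1 x) := fun r =>
      opGenerator_apply hV μ j (r, p.2) (f.1 (r, p.2)) x
    have e2 : (((familyAction (familyModule L) (opGenerator hV μ j)) g +
        (j + 1 : ℂ) • (familyAction (familyModule L) (opGenerator hV μ (j + 1))) f).1 p).1 x = -Complex.I *
        ((if j = 0 then (-(1 / (2 * μ) : ℝ) : ℂ) * Laplacian.laplacian (g.1 p).1 x else 0) +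
          (((timeCoeff hV j).1 p.1).1 x : ℂ) * (g.1 p).1 x) +
        (j + 1 : ℂ) * (-Complex.I * (((timeCoeff hV (j + 1)).1 p.1).1 x * (f.1 p).1 x)) := by
      change ((opGenerator hV μ j).1 p (g.1 p)).1 x +
        (j + 1 : ℂ) * ((opGenerator hV μ (j + 1)).1 p (f.1 p)).1 x = _
      rw [opGenerator_apply, opGenerator_apply, if_neg j.succ_ne_zero, zero_add]
      rfl
    change HasDerivAt (fun r => (((familyAction (familyModule L) (opGenerator hV μ j)) f).1 (r, p.2)).1 x)
      ((((familyAction (familyModule L) (opGenerator hV μ j)) g +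
        (j + 1 : ℂ) • (familyAction (familyModule L) (opGenerator hV μ (j + 1))) f).1 p).1 x) p.1
    simp only [e1]
    rw [e2]
    have h0 : HasDerivAt (fun r => if j = 0 then (-(1 / (2 * μ) : ℝ) : ℂ) *
        Laplacian.laplacian (f.1 (r, p.2)).1 x else 0)
        (if j = 0 then (-(1 / (2 * μ) : ℝ) : ℂ) * Laplacian.laplacian (g.1 p).1 x else 0) p.1 := by
      split_ifs
      · exact hlap.const_mul _
      · exact hasDerivAt_const _ _
    refine ((h0.add hVf).const_mul (-Complex.I)).congr_deriv ?_
    simp only [smul_eq_mul]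
    push_cast
    ring
  · refine (hu.2 p.1 x).congr_deriv ?_
    change _ = ((opGenerator hV μ 0).1 p (u p.1)).1 x
    rw [opGenerator_apply, if_pos rfl, neg_mul]
    rfl

end Families

/-! ### The exponents of the scheme at the midpoint -/

section PreservingFamily

variable {P V : Type*} [AddCommGroup V] [Module ℂ V] (M : Submodule ℂ (P → V))

theorem schemeExponent_family_apply (A B C : PreservingFamily M) (i : Fin 4) (p : P) :
    (schemeExponent A B C i).1 p = schemeExponent (A.1 p) (B.1 p) (C.1 p) i :=
  map_schemeExponent (Q := Module.End ℂ V) (evalFamily M p) A B C i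

theorem expSum_family_apply (A : PreservingFamily M) (p : P) : (expSum A).1 p = expSum (A.1 p) :=
  map_expSum (Q := Module.End ℂ V) (evalFamily M p) A

end PreservingFamily

/-! ### Pointwise bounds and skewness of the exponents -/

section Exponents

variable {d : ℕ} {L : Fin d → ℝ}

/-- The operator does not increase values by more than the factor `c`. -/
def PointwiseBound (X : Module.End ℂ (smoothPeriodic ℂ L)) (c : ℝ) : Prop :=
  ∀ ψ, ∀ x ∈ cell L, ‖(X ψ).1 x‖ ≤ c * ‖ψ.1 x‖

variable {X Y : Module.End ℂ (smoothPeriodic ℂ L)} {c e : ℝ}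

theorem PointwiseBound.add (hX : PointwiseBound X c) (hY : PointwiseBound Y e) :
    PointwiseBound (X + Y) (c + e) := fun ψ x hx => by
  rw [add_mul]
  exact (norm_add_le _ _).trans (add_le_add (hX ψ x hx) (hY ψ x hx))

theorem PointwiseBound.smul (hX : PointwiseBound X c) (k : ℂ) :
    PointwiseBound (k • X) (‖k‖ * c) := fun ψ x hx => by
  have h := mul_le_mul_of_nonneg_left (hX ψ x hx) (norm_nonneg k)
  rw [← norm_mul, ← mul_assoc] at h
  exact h

theorem PointwiseBound.smul_of_norm_le (hX : PointwiseBound X c) {k : ℂ} (hk : ‖k‖ ≤ 1) :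
    PointwiseBound (k • X) c := fun ψ x hx => by
  refine le_trans ?_ (hX ψ x hx)
  change ‖k * (X ψ).1 x‖ ≤ _
  rw [norm_mul]
  exact mul_le_of_le_one_left (norm_nonneg _) hk

theorem pointwiseBound_mulOp {w : smoothPeriodic ℝ L} (hw : ∀ x ∈ cell L, ‖w.1 x‖ ≤ c) :
    PointwiseBound (mulOp w) c := fun ψ x hx => by
  rw [mulOp_apply, norm_mul, Complex.norm_real]
  exact mul_le_mul_of_nonneg_right (hw x hx) (norm_nonneg _)

theorem PointwiseBound.sqNorm_le (hX : PointwiseBound X c) (ψ : smoothPeriodic ℂ L) :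
    sqNorm (X ψ) ≤ c ^ 2 * sqNorm ψ :=
  sqNorm_le_of_norm_le (hX ψ)

theorem PointwiseBound.smul_sub_smul (h : PointwiseBound (X - Y) c) (k : ℂ) :
    PointwiseBound (k • X - k • Y) (‖k‖ * c) := fun ψ x hx => by
  refine le_trans (le_of_eq ?_) (h.smul k ψ x hx)
  change ‖k * (X ψ).1 x - k * (Y ψ).1 x‖ = ‖k * ((X ψ).1 x - (Y ψ).1 x)‖
  rw [mul_sub]

/-- The same `A₁` stands in both exponents, so its linear contribution, the only one with an
unbounded operator outside the double commutator, cancels. -/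
theorem schemeExponent_sub {A : Type*} [Ring A] [Algebra ℂ A] (A₁ A₂ A₃ B₂ B₃ : A) (i : Fin 4) :
    ∃ k₂ k₃ k : ℝ, |k₂| ≤ 1 ∧ |k₃| ≤ 1 ∧ |k| ≤ 1 ∧
      schemeExponent A₁ A₂ A₃ i - schemeExponent A₁ B₂ B₃ i = (k₂ : ℂ) • (A₂ - B₂) +
        (k₃ : ℂ) • (A₃ - B₃) + (k : ℂ) • (doubleComm A₂ A₁ - doubleComm B₂ A₁) := by
  have k₁₂ : |x₁₂| ≤ 1 := by norm_num [x₁₂, abs_le]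
  have k₁₃ : |x₁₃| ≤ 1 := by norm_num [x₁₃, abs_le]
  have k₂₂ : |x₂₂| ≤ 1 := by norm_num [x₂₂, abs_le]
  have k₂₃ : |x₂₃| ≤ 1 := by norm_num [x₂₃, abs_le]
  have ky : |yCoef| ≤ 1 := by norm_num [yCoef, zCoef, abs_le]
  have k0 : |(0 : ℝ)| ≤ 1 := by simp
  fin_cases i
  · refine ⟨_, _, _, k₁₂, k₁₃, ky, ?_⟩
    simp only [schemeExponent, Fin.mk_zero, Matrix.cons_val]
    module
  · refine ⟨_, _, _, k₂₂, k₂₃, k0, ?_⟩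
    simp only [schemeExponent, Fin.mk_one, Matrix.cons_val]
    push_cast
    module
  · refine ⟨_, _, _, (abs_neg x₂₂).trans_le k₂₂, k₂₃, k0, ?_⟩
    simp only [schemeExponent, Fin.reduceFinMk, Matrix.cons_val]
    push_cast
    module
  · refine ⟨_, _, _, (abs_neg x₁₂).trans_le k₁₂, k₁₃, ky, ?_⟩
    simp only [schemeExponent, Fin.reduceFinMk, Matrix.cons_val]
    push_cast
    module

theorem pointwiseBound_schemeExponent_sub {A₁ A₂ A₃ B₂ B₃ : Module.End ℂ (smoothPeriodic ℂ L)}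
    (h₂ : PointwiseBound (A₂ - B₂) c) (h₃ : PointwiseBound (A₃ - B₃) c)
    (hd : PointwiseBound (doubleComm A₂ A₁ - doubleComm B₂ A₁) c) (i : Fin 4) :
    PointwiseBound (schemeExponent A₁ A₂ A₃ i - schemeExponent A₁ B₂ B₃ i) (c + c + c) := by
  obtain ⟨k₂, k₃, k, hk₂, hk₃, hk, h⟩ := schemeExponent_sub A₁ A₂ A₃ B₂ B₃ i
  have hn : ∀ r : ℝ, |r| ≤ 1 → ‖(r : ℂ)‖ ≤ 1 := fun r hr => by
    rwa [Complex.norm_real, Real.norm_eq_abs]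
  exact (congrArg (PointwiseBound · (c + c + c)) h).mpr
    (((h₂.smul_of_norm_le (hn _ hk₂)).add (h₃.smul_of_norm_le (hn _ hk₃))).add
      (hd.smul_of_norm_le (hn _ hk)))

theorem IsSkew.sub (hX : IsSkew X) (hY : IsSkew Y) : IsSkew (X - Y) := by
  have e : X - Y = X + -Y := sub_eq_add_neg X Y
  rw [e]
  exact hX.add hY.neg

/-- Each exponent is a real combination of `-i` times the kinetic energy and `-i` times
multiplications by real functions; `doubleComm_α` puts the double commutator into this form. -/
theorem isSkew_commutatorExponent (hL : ∀ i, 0 < L i) (μ τ : ℝ) (w₁ w₂ w₃ : smoothPeriodic ℝ L)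
    (i : Fin 4) :
    IsSkew (commutatorExponent τ (kineticOp L μ) (mulOp w₁) (mulOp w₂) (mulOp w₃) i) := by
  have hm : ∀ w : smoothPeriodic ℝ L, IsSkew ((-(Complex.I * (τ : ℂ))) • mulOp w) := fun w => by
    have h := (isSkew_mulOp w).smul τ
    rw [smul_smul] at h
    convert h using 2
    ring
  have h₁ : IsSkew (α₁ τ (kineticOp L μ) (mulOp w₂)) := by
    have h := (isSkew_kineticOp hL μ).smul τ
    rw [smul_smul] at h
    rw [α₁, smul_add]
    refine IsSkew.add ?_ (hm _)
    convert h using 2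
    ring
  have h₂ : IsSkew (α₂ τ (mulOp w₁) (mulOp w₃)) := by
    rw [α₂, ← mulOp_sub, ← mulOp_smul]
    exact hm _
  have h₃ : IsSkew (α₃ τ (mulOp w₁) (mulOp w₂) (mulOp w₃)) := by
    have e : (2 : ℂ) • mulOp w₂ = mulOp ((2 : ℝ) • w₂) := by
      rw [mulOp_smul]
      norm_num
    rw [α₃, e, ← mulOp_sub, ← mulOp_add, ← mulOp_smul]
    exact hm _
  have hd : IsSkew (doubleComm (α₂ τ (mulOp w₁) (mulOp w₃))
      (α₁ τ (kineticOp L μ) (mulOp w₂))) := by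
    rw [doubleComm_α, smul_smul, mul_comm, ← smul_smul]
    have h := (hm ((-(5 / (3 * μ))) • gradDiffSq w₁ w₃)).smul (τ ^ 2)
    rwa [Complex.ofReal_pow] at h
  fin_cases i
  · exact ((h₂.smul _).add (h₃.smul _)).add (hd.smul _)
  · exact ((h₁.smul _).add (h₂.smul _)).add (h₃.smul _)
  · exact ((h₁.smul _).sub (h₂.smul _)).add (h₃.smul _)
  · exact ((h₂.smul _).neg.add (h₃.smul _)).add (hd.smul _)

end Exponents

/-! ### Uniform expansions of the potential and its gradient at the nodes -/

section Nodes

variable {d : ℕ} {L : Fin d → ℝ} {V : ℝ → smoothPeriodic ℝ L} (hV : JointlySmooth V)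

theorem exists_bound_of_continuous {W F : Type*} [TopologicalSpace W] [NormedAddCommGroup F]
    {H : W × EuclideanSpace ℝ (Fin d) → F} (hH : Continuous H) {K : Set W} (hK : IsCompact K)
    (L : Fin d → ℝ) : ∃ C, 0 ≤ C ∧ ∀ p ∈ K, ∀ x ∈ cell L, ‖H (p, x)‖ ≤ C := by
  obtain ⟨C, hC⟩ := (hK.prod (isCompact_closedCell L)).exists_bound_of_continuousOn hH.continuousOn
  exact ⟨max C 0, le_max_right _ _, fun p hp x hx =>
    (hC (p, x) ⟨hp, cell_subset_closedCell L hx⟩).trans (le_max_left _ _)⟩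

/-- The first difference of the potential at the nodes. -/
def nodeDiff (V : ℝ → smoothPeriodic ℝ L) (m τ : ℝ) : smoothPeriodic ℝ L :=
  (√15 / 3) • (V (m + √15 / 10 * τ) - V (m - √15 / 10 * τ))

/-- The second difference of the potential at the nodes. -/
def nodeDiff₂ (V : ℝ → smoothPeriodic ℝ L) (m τ : ℝ) : smoothPeriodic ℝ L :=
  (10 / 3 : ℝ) • (V (m + √15 / 10 * τ) - (2 : ℝ) • V m + V (m - √15 / 10 * τ))

/-- The truncated expansion of the first difference. -/
def nodeSum (m τ : ℝ) : smoothPeriodic ℝ L :=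
  τ • (timeCoeff hV 1).1 m + ((3 / 20 * τ ^ 3) • (timeCoeff hV 3).1 m
    + (9 / 400 * τ ^ 5) • (timeCoeff hV 5).1 m)

/-- The truncated expansion of the second difference. -/
def nodeSum₂ (m τ : ℝ) : smoothPeriodic ℝ L :=
  τ ^ 2 • (timeCoeff hV 2).1 m + (3 / 20 * τ ^ 4) • (timeCoeff hV 4).1 m

theorem partialDeriv_add_smooth (i : Fin d) (v w : smoothPeriodic ℝ L)
    (x : EuclideanSpace ℝ (Fin d)) :
    partialDeriv i (v + w).1 x = partialDeriv i v.1 x + partialDeriv i w.1 x := by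
  have h : fderiv ℝ (v.1 + w.1) x = fderiv ℝ v.1 x + fderiv ℝ w.1 x :=
    fderiv_add (v.2.1.differentiable (by simp) x) (w.2.1.differentiable (by simp) x)
  change fderiv ℝ (v.1 + w.1) x _ = _
  rw [h]
  rfl

theorem partialDeriv_smul_smooth (i : Fin d) (c : ℝ) (w : smoothPeriodic ℝ L)
    (x : EuclideanSpace ℝ (Fin d)) :
    partialDeriv i (c • w).1 x = c • partialDeriv i w.1 x :=
  partialDeriv_clm (ContinuousLinearMap.lsmul ℝ ℝ c) w.2.1 i x

theorem partialDeriv_sub_smooth (i : Fin d) (v w : smoothPeriodic ℝ L)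
    (x : EuclideanSpace ℝ (Fin d)) :
    partialDeriv i (v - w).1 x = partialDeriv i v.1 x - partialDeriv i w.1 x := by
  have h := partialDeriv_add_smooth i (v - w) w x
  rw [sub_add_cancel] at h
  rw [h, add_sub_cancel_right]

/-- The node expansion is applied in time at each fixed `x`, to the potential and to its partial
derivatives; compactness of the closed cell makes it uniform. The gradients enter through the double
commutator. -/
theorem exists_nodes_bound (a b : ℝ) : ∃ C, 0 ≤ C ∧ ∀ m ∈ Set.Icc a b, ∀ τ ∈ Set.Icc (0 : ℝ) 1,
    ∀ x ∈ cell L, ‖(nodeDiff V m τ - nodeSum hV m τ).1 x‖ ≤ C * τ ^ 6 ∧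
      ‖(nodeDiff₂ V m τ - nodeSum₂ hV m τ).1 x‖ ≤ C * τ ^ 6 ∧
      (∀ i, ‖partialDeriv i (nodeDiff V m τ).1 x - partialDeriv i (nodeSum hV m τ).1 x‖
        ≤ C * τ ^ 6) ∧ ∀ i, ‖partialDeriv i (nodeDiff V m τ).1 x‖ ≤ C := by
  have hK : IsCompact (Set.Icc (a - 1) (b + 1)) := isCompact_Icc
  have hD : ∀ k i, Continuous fun q : ℝ × EuclideanSpace ℝ (Fin d) =>
      partialDeriv i ((timeCoeff hV k).1 q.1).1 q.2 := fun k i =>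
    (contDiff_partialDeriv_param (timeCoeff hV k).2 i).continuous
  obtain ⟨C₁, h₁0, h₁⟩ := exists_bound_of_continuous (timeCoeff hV 6).2.continuous hK L
  choose C₂ h₂0 h₂ using fun i => exists_bound_of_continuous (hD 6 i) hK L
  choose C₃ h₃0 h₃ using fun i => exists_bound_of_continuous (hD 0 i) hK L
  set B := C₁ + ∑ i, (C₂ i + C₃ i) with hB
  have hs0 : 0 ≤ ∑ i, (C₂ i + C₃ i) := Finset.sum_nonneg fun i _ => add_nonneg (h₂0 i) (h₃0 i)
  have hs : ∀ i, C₂ i + C₃ i ≤ ∑ i, (C₂ i + C₃ i) := fun i =>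
    Finset.single_le_sum (f := fun i => C₂ i + C₃ i) (fun i _ => add_nonneg (h₂0 i) (h₃0 i))
      (Finset.mem_univ i)
  have hB0 : 0 ≤ B := by positivity
  have hf : (1 : ℝ) ≤ Nat.factorial 6 := by exact_mod_cast Nat.factorial_pos 6
  refine ⟨20 * (Nat.factorial 6 * B), by positivity, fun m hm τ hτ x hx => ?_⟩
  have hsub : ∀ s ∈ Set.Icc (m - τ) (m + τ), s ∈ Set.Icc (a - 1) (b + 1) := fun s hs =>
    ⟨by linarith [hs.1, hm.1, hτ.2], by linarith [hs.2, hm.2, hτ.2]⟩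
  have hle : 4 * (Nat.factorial 6 * B) * τ ^ 6 ≤ 20 * (Nat.factorial 6 * B) * τ ^ 6 := by
    have := hτ.1
    gcongr
    norm_num
  have n₁ := norm_nodes_sub_le (fun k t => ((timeCoeff hV k).1 t).1 x)
    (fun k _ s => hasDerivAt_timeCoeff hV k s x) (C := B) (m := m) hτ.1 fun s h =>
      (h₁ s (hsub s h) x hx).trans (by linarith)
  have n₂ := fun i => norm_nodes_sub_le (fun k t => partialDeriv i ((timeCoeff hV k).1 t).1 x)
    (fun k _ s => hasDerivAt_partialDeriv_timeCoeff hV i k s x) (C := B) (m := m) hτ.1 fun s h =>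
      (h₂ i s (hsub s h) x hx).trans (by linarith [hs i, h₃0 i])
  refine ⟨n₁.1.trans hle, n₁.2, fun i => ?_, fun i => ?_⟩
  · have h := (n₂ i).1.trans hle
    simp only [nodeDiff, nodeSum, partialDeriv_add_smooth, partialDeriv_smul_smooth,
      partialDeriv_sub_smooth]
    exact h
  · simp only [nodeDiff, partialDeriv_smul_smooth, partialDeriv_sub_smooth]
    have h15 := sqrt_fifteen_le
    have h15' : 0 ≤ √15 := Real.sqrt_nonneg _
    have hh : 0 ≤ √15 / 10 * τ := mul_nonneg (by positivity) hτ.1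
    have hh' : √15 / 10 * τ ≤ τ := by nlinarith [hτ.1]
    have b₁ := h₃ i _ (hsub (m + √15 / 10 * τ) ⟨by linarith [hτ.1], by linarith⟩) x hx
    have b₂ := h₃ i _ (hsub (m - √15 / 10 * τ) ⟨by linarith, by linarith [hτ.1]⟩) x hx
    have hC : C₃ i ≤ B := by linarith [hs i, h₂0 i]
    have b₃ := norm_sub_le (partialDeriv i (V (m + √15 / 10 * τ)).1 x)
      (partialDeriv i (V (m - √15 / 10 * τ)).1 x)
    change ‖partialDeriv i (V (m + √15 / 10 * τ)).1 x‖ ≤ _ at b₁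
    change ‖partialDeriv i (V (m - √15 / 10 * τ)).1 x‖ ≤ _ at b₂
    rw [norm_smul, Real.norm_eq_abs, abs_of_nonneg (by positivity)]
    calc √15 / 3 * ‖_‖ ≤ 4 / 3 * (B + B) := by
          gcongr
          linarith
      _ ≤ 20 * (1 * B) := by linarith
      _ ≤ _ := by gcongr

end Nodes

/-! ### Comparison of the exact and the truncated exponents -/

section Midpoint

variable {d : ℕ} {L : Fin d → ℝ} {V : ℝ → smoothPeriodic ℝ L} (hV : JointlySmooth V)

theorem opGenerator_succ_apply (μ : ℝ) (j : ℕ) (p : ℝ × ℝ) : (opGenerator hV μ (j + 1)).1 p =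
    -(Complex.I • mulOp ((timeCoeff hV (j + 1)).1 p.1)) := by
  ext ψ x
  refine (opGenerator_apply hV μ (j + 1) p ψ x).trans ?_
  rw [if_neg j.succ_ne_zero, zero_add, neg_mul]
  rfl

theorem length_mul_opGenerator_zero_apply (μ : ℝ) (p : ℝ × ℝ) :
    (lengthFamily L * opGenerator hV μ 0).1 p = α₁ p.2 (kineticOp L μ) (mulOp (V p.1)) := by
  ext ψ x
  change (p.2 : ℂ) * ((opGenerator hV μ 0).1 p ψ).1 x = -(Complex.I * (p.2 : ℂ)) *
    ((kineticOp L μ ψ).1 x + (mulOp (V p.1) ψ).1 x)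
  rw [opGenerator_apply, if_pos rfl, mulOp_apply]
  change _ * (_ * (_ + ((V p.1).1 x : ℂ) * _)) = _
  ring

theorem midpointAlpha₂_apply (μ : ℝ) (p : ℝ × ℝ) :
    (midpointAlpha₂ (lengthFamily L) (opGenerator hV μ)).1 p =
      (-(Complex.I * (p.2 : ℂ))) • mulOp (nodeSum hV p.1 p.2) := by
  have h : (midpointAlpha₂ (lengthFamily L) (opGenerator hV μ)).1 p =
      (lengthFamily L ^ 2 * opGenerator hV μ 1).1 p +
      ((3 / 20 : ℂ) • (lengthFamily L ^ 4 * opGenerator hV μ 3).1 p +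
      (9 / 400 : ℂ) • (lengthFamily L ^ 6 * opGenerator hV μ 5).1 p) := rfl
  rw [h, lengthFamily_pow_mul_apply, lengthFamily_pow_mul_apply, lengthFamily_pow_mul_apply,
    opGenerator_succ_apply, opGenerator_succ_apply, opGenerator_succ_apply, nodeSum, mulOp_add,
    mulOp_add, mulOp_smul, mulOp_smul, mulOp_smul]
  push_cast
  module

theorem midpointAlpha₃_apply (μ : ℝ) (p : ℝ × ℝ) :
    (midpointAlpha₃ (lengthFamily L) (opGenerator hV μ)).1 p =
      (-(Complex.I * (p.2 : ℂ))) • mulOp (nodeSum₂ hV p.1 p.2) := by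
  have h : (midpointAlpha₃ (lengthFamily L) (opGenerator hV μ)).1 p =
      (lengthFamily L ^ 3 * opGenerator hV μ 2).1 p +
      (3 / 20 : ℂ) • (lengthFamily L ^ 5 * opGenerator hV μ 4).1 p := rfl
  rw [h, lengthFamily_pow_mul_apply, lengthFamily_pow_mul_apply,
    opGenerator_succ_apply, opGenerator_succ_apply, nodeSum₂, mulOp_add, mulOp_smul, mulOp_smul]
  push_cast
  module

theorem α₂_eq_nodeDiff (m τ : ℝ) :
    α₂ τ (mulOp (V (m - √15 / 10 * τ))) (mulOp (V (m + √15 / 10 * τ))) =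
      (-(Complex.I * (τ : ℂ))) • mulOp (nodeDiff V m τ) := by
  rw [α₂, nodeDiff, mulOp_smul, mulOp_sub]

theorem α₃_eq_nodeDiff₂ (m τ : ℝ) :
    α₃ τ (mulOp (V (m - √15 / 10 * τ))) (mulOp (V m)) (mulOp (V (m + √15 / 10 * τ))) =
      (-(Complex.I * (τ : ℂ))) • mulOp (nodeDiff₂ V m τ) := by
  rw [α₃, nodeDiff₂, mulOp_smul, mulOp_add, mulOp_sub, mulOp_smul]
  norm_num

/-- The exponents of the scheme with the expansions of the potential at the midpoint truncated. -/
def truncatedExponent (μ : ℝ) (i : Fin 4) : OperatorFamily L :=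
  schemeExponent (lengthFamily L * opGenerator hV μ 0)
    (midpointAlpha₂ (lengthFamily L) (opGenerator hV μ))
    (midpointAlpha₃ (lengthFamily L) (opGenerator hV μ)) i

theorem exists_pointwiseBound_sub_truncatedExponent (μ a b : ℝ) :
    ∃ C, 0 ≤ C ∧ ∀ m ∈ Set.Icc a b, ∀ τ ∈ Set.Icc (0 : ℝ) 1, ∀ i,
      PointwiseBound (commutatorExponent τ (kineticOp L μ) (mulOp (V (m - √15 / 10 * τ)))
        (mulOp (V m)) (mulOp (V (m + √15 / 10 * τ))) i - (truncatedExponent hV μ i).1 (m, τ))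
        (C * τ ^ 7) := by
  obtain ⟨C, hC0, hC⟩ := exists_nodes_bound hV a b
  -- In each of the `d` directions `|v² - w²| ≤ |v - w| (2|v| + |v - w|)` with `|v - w| ≤ Cτ⁶` and
  -- `|v| ≤ C`. The double commutators carry a further `τ³`, so they differ by `Dτ⁹ ≤ Dτ⁷`.
  set D := d * (C * (2 * C + C)) * |1 / μ|
  have hD0 : 0 ≤ D := by positivity
  refine ⟨3 * (C + D), by positivity, fun m hm τ hτ i => ?_⟩
  have hτ0 := hτ.1
  have hτ1 := hτ.2
  have hc : ‖-(Complex.I * (τ : ℂ))‖ = τ := by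
    rw [norm_neg, norm_mul, Complex.norm_I, one_mul, Complex.norm_real, Real.norm_eq_abs,
      abs_of_nonneg hτ0]
  have h67 : τ * (C * τ ^ 6) ≤ (C + D) * τ ^ 7 := by
    have : 0 ≤ D * τ ^ 7 := by positivity
    nlinarith
  have hmono : ∀ {X : Module.End ℂ (smoothPeriodic ℂ L)} {c e : ℝ}, PointwiseBound X c → c ≤ e →
      PointwiseBound X e := fun h hce ψ x hx =>
    (h ψ x hx).trans (mul_le_mul_of_nonneg_right hce (norm_nonneg _))
  have hsub : ∀ {v w : smoothPeriodic ℝ L} {c : ℝ}, (∀ x ∈ cell L, ‖(v - w).1 x‖ ≤ c) →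
      PointwiseBound (mulOp v - mulOp w) c := fun h => by
    rw [← mulOp_sub]
    exact pointwiseBound_mulOp h
  rw [truncatedExponent, schemeExponent_family_apply, length_mul_opGenerator_zero_apply,
    midpointAlpha₂_apply, midpointAlpha₃_apply, commutatorExponent_eq, α₂_eq_nodeDiff,
    α₃_eq_nodeDiff₂]
  dsimp only
  rw [show 3 * (C + D) * τ ^ 7 = (C + D) * τ ^ 7 + (C + D) * τ ^ 7 + (C + D) * τ ^ 7 by ring]
  refine pointwiseBound_schemeExponent_sub ?_ ?_ ?_ i
  · refine hmono ((hsub fun x hx => (hC m hm τ hτ x hx).1).smul_sub_smul _) ?_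
    rwa [hc]
  · refine hmono ((hsub fun x hx => (hC m hm τ hτ x hx).2.1).smul_sub_smul _) ?_
    rwa [hc]
  · rw [α₁, doubleComm_smul_smul_add (commute_mulOp _ _), doubleComm_smul_smul_add (commute_mulOp _ _),
      doubleComm_mulOp_kineticOp, doubleComm_mulOp_kineticOp]
    refine hmono (((hsub (c := d * (C * τ ^ 6 * (2 * C + C))) fun x hx => ?_).smul_sub_smul
      _).smul_sub_smul _) ?_
    · obtain ⟨-, -, h₁, h₂⟩ := hC m hm τ hτ x hx
      change ‖(gradSq (nodeDiff V m τ)).1 x - (gradSq (nodeSum hV m τ)).1 x‖ ≤ _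
      rw [gradSq_apply, gradSq_apply, ← Finset.sum_sub_distrib]
      refine (norm_sum_le _ _).trans ((Finset.sum_le_card_nsmul _ _ (C * τ ^ 6 * (2 * C + C))
        fun i _ => ?_).trans_eq ?_)
      · specialize h₁ i
        specialize h₂ i
        generalize partialDeriv i (nodeDiff V m τ).1 x = v at *
        generalize partialDeriv i (nodeSum hV m τ).1 x = w at *
        rw [show v ^ 2 - w ^ 2 = (v - w) * (2 * v - (v - w)) by ring, norm_mul]
        have h6 : τ ^ 6 ≤ 1 := pow_le_one₀ hτ0 hτ1
        have h₃ : ‖2 * v - (v - w)‖ ≤ 2 * C + C := by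
          refine (norm_sub_le _ _).trans (add_le_add ?_ (h₁.trans (mul_le_of_le_one_right hC0 h6)))
          rw [norm_mul]
          norm_num
          exact h₂
        exact mul_le_mul h₁ h₃ (norm_nonneg _) (by positivity)
      · simp
    · rw [norm_mul, norm_pow, hc, Complex.norm_real, Real.norm_eq_abs]
      have h9 : τ ^ 9 ≤ τ ^ 7 := pow_le_pow_of_le_one hτ0 hτ1 (by norm_num)
      have hC7 : 0 ≤ C * τ ^ 7 := by positivity
      calc _ = D * τ ^ 9 := by simp only [D]; ring
        _ ≤ D * τ ^ 7 := by gcongr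
        _ ≤ _ := by linarith

end Midpoint

/-! ### Sixth order in coordinates -/

theorem pow_family_apply {P V : Type*} [AddCommGroup V] [Module ℂ V] (M : Submodule ℂ (P → V))
    (A : PreservingFamily M) (k : ℕ) (p : P) : (A ^ k).1 p = (A.1 p) ^ k :=
  map_pow (evalFamily M p) A k

section Assembly

variable {d : ℕ} {L : Fin d → ℝ} {V : ℝ → smoothPeriodic ℝ L} (hV : JointlySmooth V)

/-- The constant function one. -/
def constOne (L : Fin d → ℝ) : smoothPeriodic ℂ L := ⟨fun _ => 1, contDiff_const, fun _ _ => rfl⟩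

theorem sqNorm_le_of_forall_norm_le {ψ : smoothPeriodic ℂ L} {c : ℝ}
    (h : ∀ x ∈ cell L, ‖ψ.1 x‖ ≤ c) : sqNorm ψ ≤ c ^ 2 * sqNorm (constOne L) :=
  sqNorm_le_of_norm_le fun x hx => by
    change _ ≤ c * ‖(1 : ℂ)‖
    rw [norm_one, mul_one]
    exact h x hx

variable {u : ℝ → smoothPeriodic ℂ L}

/-- Substitute for operator norms: a preserving family applied to `u(m)` is smooth in all variables,
hence bounded over compact parameter sets and the cell. -/
theorem OperatorFamily.exists_bound (Q : OperatorFamily L) (hu : JointlySmooth u) (a b : ℝ) :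
    ∃ C, 0 ≤ C ∧ ∀ m ∈ Set.Icc a b, ∀ τ ∈ Set.Icc (0 : ℝ) 1, ∀ x ∈ cell L,
      ‖(Q.1 (m, τ) (u m)).1 x‖ ≤ C := by
  have h : SmoothFamily fun p : ℝ × ℝ => Q.1 p (u p.1) :=
    Q.2 (fun p => u p.1) (SmoothFamily.comp (W := ℝ) hu contDiff_fst)
  obtain ⟨C, hC0, hC⟩ := exists_bound_of_continuous h.continuous
    ((isCompact_Icc (a := a) (b := b)).prod (isCompact_Icc (a := (0 : ℝ)) (b := 1))) L
  exact ⟨C, hC0, fun m hm τ hτ x hx => hC (m, τ) ⟨hm, hτ⟩ x hx⟩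

theorem OperatorFamily.exists_sqNorm_le (Q : OperatorFamily L) (hu : JointlySmooth u) (a b : ℝ) :
    ∃ C, 0 ≤ C ∧ ∀ m ∈ Set.Icc a b, ∀ τ ∈ Set.Icc (0 : ℝ) 1, sqNorm (Q.1 (m, τ) (u m)) ≤ C := by
  obtain ⟨C, -, hC⟩ := Q.exists_bound hu a b
  exact ⟨C ^ 2 * sqNorm (constOne L), mul_nonneg (sq_nonneg _) (sqNorm_nonneg _),
    fun m hm τ hτ => sqNorm_le_of_forall_norm_le (hC m hm τ hτ)⟩

theorem OperatorFamily.sub_apply_eq {A B R : OperatorFamily L} {n : ℕ}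
    (h : A - B = lengthFamily L ^ n * R) (p : ℝ × ℝ) (ψ : smoothPeriodic ℂ L) :
    A.1 p ψ - B.1 p ψ = (p.2 : ℂ) ^ n • R.1 p ψ :=
  (congrArg (fun T : OperatorFamily L => T.1 p ψ) h).trans
    (congrArg (fun T : Module.End ℂ (smoothPeriodic ℂ L) => T ψ) (lengthFamily_pow_mul_apply n R p))

/-- Writing `X = τZ` with `τ` central gives `X⁷ Q u(m) = τ⁷ Z⁷ Q u(m)`, and replacing `X` by `Y`
costs a multiplier of size `O(τ⁷)`; squared norms turn `τ⁷` into `τ¹⁴`. The factor `Q` holds the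
steps already made, which allows iteration. -/
theorem exists_sqNorm_step_le (hu : JointlySmooth u) (a b : ℝ) (X Q : OperatorFamily L)
    (hX : lengthFamily L ∣ X) {C : ℝ} :
    ∃ K, 0 ≤ K ∧ ∀ m ∈ Set.Icc a b, ∀ τ ∈ Set.Icc (0 : ℝ) 1,
      ∀ (Y : Module.End ℂ (smoothPeriodic ℂ L)) (ψ ψ' : smoothPeriodic ℂ L), IsSkew Y →
        PointwiseBound (Y - X.1 (m, τ)) (C * τ ^ 7) → ExpMaps Y ψ ψ' →
        sqNorm (ψ' - (expSum X * Q).1 (m, τ) (u m)) ≤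
          3 * sqNorm (ψ - Q.1 (m, τ) (u m)) + K * τ ^ 14 := by
  obtain ⟨Z, rfl⟩ := hX
  choose B hB0 hB using fun k : ℕ =>
    OperatorFamily.exists_sqNorm_le ((lengthFamily L * Z) ^ k * Q) hu a b
  obtain ⟨D, hD0, hD⟩ := OperatorFamily.exists_sqNorm_le (Z ^ 7 * Q) hu a b
  refine ⟨6 * (7 * ∑ k ∈ Finset.range 7, C ^ 2 * B k + D), mul_nonneg (by norm_num) (add_nonneg
    (mul_nonneg (by norm_num) (Finset.sum_nonneg fun k _ => mul_nonneg (sq_nonneg _) (hB0 k))) hD0),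
    fun m hm τ hτ Y ψ ψ' hY hb hψ => ?_⟩
  have h := hψ.sqNorm_sub_expSum_le hY ((lengthFamily L * Z).1 (m, τ)) (Q.1 (m, τ) (u m))
  have e : (expSum (lengthFamily L * Z) * Q).1 (m, τ) (u m) =
      expSum ((lengthFamily L * Z).1 (m, τ)) (Q.1 (m, τ) (u m)) :=
    congrArg (fun T : Module.End ℂ (smoothPeriodic ℂ L) => T (Q.1 (m, τ) (u m)))
      (expSum_family_apply (familyModule L) (lengthFamily L * Z) (m, τ))
  have ep : ∀ k, (((lengthFamily L * Z).1 (m, τ)) ^ k) (Q.1 (m, τ) (u m)) =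
      ((lengthFamily L * Z) ^ k * Q).1 (m, τ) (u m) := fun k =>
    (congrArg (fun T : Module.End ℂ (smoothPeriodic ℂ L) => T (Q.1 (m, τ) (u m)))
      (pow_family_apply (familyModule L) (lengthFamily L * Z) k (m, τ))).symm
  have e7 : ((lengthFamily L * Z) ^ 7 * Q).1 (m, τ) (u m) =
      (τ : ℂ) ^ 7 • (Z ^ 7 * Q).1 (m, τ) (u m) := by
    rw [(lengthFamily_commute Z).mul_pow, mul_assoc]
    exact congrArg (fun T : Module.End ℂ (smoothPeriodic ℂ L) => T (u m))
      (lengthFamily_pow_mul_apply 7 (Z ^ 7 * Q) (m, τ))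
  have h1 : ∀ k, sqNorm ((Y - (lengthFamily L * Z).1 (m, τ))
      ((((lengthFamily L * Z).1 (m, τ)) ^ k) (Q.1 (m, τ) (u m)))) ≤ C ^ 2 * B k * τ ^ 14 := fun k => by
    refine (hb.sqNorm_le _).trans ?_
    rw [ep k]
    have := mul_le_mul_of_nonneg_left (hB k m hm τ hτ) (sq_nonneg (C * τ ^ 7))
    refine this.trans_eq ?_
    ring
  have h2 : sqNorm ((((lengthFamily L * Z).1 (m, τ)) ^ 7) (Q.1 (m, τ) (u m))) ≤ D * τ ^ 14 := by
    rw [ep 7, e7, sqNorm_smul, norm_pow, Complex.norm_real, Real.norm_eq_abs,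
      abs_of_nonneg hτ.1, ← pow_mul, mul_comm]
    exact mul_le_mul_of_nonneg_right (hD m hm τ hτ) (pow_nonneg hτ.1 _)
  have h3 := Finset.sum_le_sum fun k (_ : k ∈ Finset.range 7) => h1 k
  rw [← Finset.sum_mul] at h3
  rw [e]
  refine h.trans ?_
  linarith

theorem exists_sqNorm_taylor_le {μ : ℝ} (hu : IsSolution μ V u) (a b : ℝ) :
    ∃ K, 0 ≤ K ∧ ∀ m ∈ Set.Icc a b, ∀ τ ∈ Set.Icc (0 : ℝ) 1, ∀ h : ℝ, |h| ≤ 1 →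
      sqNorm (u (m + h * τ) - (flowSum (opGenerator hV μ) (lengthFamily L) (h : ℂ)).1 (m, τ) (u m))
        ≤ K * τ ^ 14 := by
  obtain ⟨C, hC0, hC⟩ := OperatorFamily.exists_bound (flowCoeff (opGenerator hV μ) 7) hu.1
    (a - 1) (b + 1)
  refine ⟨(Nat.factorial 7 * C) ^ 2 * sqNorm (constOne L),
    mul_nonneg (sq_nonneg _) (sqNorm_nonneg _), fun m hm τ hτ h hh => ?_⟩
  have hτ0 := hτ.1
  have hhτ : |h * τ| ≤ τ := by
    rw [abs_mul, abs_of_nonneg hτ0]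
    exact mul_le_of_le_one_left hτ0 hh
  have hh1 := (abs_le.1 hhτ).1
  have hh2 := (abs_le.1 hhτ).2
  have key : sqNorm (u (m + h * τ)
      - (flowSum (opGenerator hV μ) (lengthFamily L) (h : ℂ)).1 (m, τ) (u m)) ≤
      (Nat.factorial 7 * C * τ ^ 7) ^ 2 * sqNorm (constOne L) := by
    refine sqNorm_le_of_forall_norm_le fun x hx => ?_
    have ht := norm_sub_sum_pow_smul_le 7
      (fun k t => ((flowCoeff (opGenerator hV μ) k).1 (t, τ) (u t)).1 x)
      (fun k _ t => hasDerivAt_flowCoeff_apply hV hu k (t, τ) x) (m := m) (h := h * τ)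
      (C := C) fun r hr => by
        have hr' : r ∈ Set.Icc (a - 1) (b + 1) := by
          rw [Set.mem_uIcc] at hr
          rcases hr with hr | hr <;>
            exact ⟨by linarith [hr.1, hm.1, hτ.2], by linarith [hr.2, hm.2, hτ.2]⟩
        exact hC r hr' τ hτ x hx
    have e : ((flowSum (opGenerator hV μ) (lengthFamily L) (h : ℂ)).1 (m, τ) (u m)).1 x =
        ∑ k ∈ Finset.range 7, (h * τ) ^ k •
          ((flowCoeff (opGenerator hV μ) k).1 (m, τ) (u m)).1 x := by
      have e1 : ∀ k, ((((h : ℂ) ^ k • (lengthFamily L ^ k * flowCoeff (opGenerator hV μ) k) :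
          OperatorFamily L).1 (m, τ)) (u m)).1 x =
          (h * τ) ^ k • ((flowCoeff (opGenerator hV μ) k).1 (m, τ) (u m)).1 x := fun k => by
        have e2 : ((lengthFamily L ^ k * flowCoeff (opGenerator hV μ) k).1 (m, τ) (u m)).1 x =
            (τ : ℂ) ^ k * ((flowCoeff (opGenerator hV μ) k).1 (m, τ) (u m)).1 x :=
          congrArg (fun T : Module.End ℂ (smoothPeriodic ℂ L) => (T (u m)).1 x)
            (lengthFamily_pow_mul_apply k (flowCoeff (opGenerator hV μ) k) (m, τ))
        change (h : ℂ) ^ k *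
          ((lengthFamily L ^ k * flowCoeff (opGenerator hV μ) k).1 (m, τ) (u m)).1 x = _
        rw [e2, ← mul_assoc, ← mul_pow, Complex.real_smul]
        push_cast
        rfl
      rw [← Finset.sum_congr rfl fun k _ => e1 k]
      simp only [flowSum, Finset.sum_range_succ, Finset.sum_range_zero]
      rfl
    change ‖(u (m + h * τ)).1 x - _‖ ≤ _
    have e0 : ∀ t, (flowCoeff (opGenerator hV μ) 0).1 (t, τ) (u t) = u t := fun t => by
      rw [flowCoeff]
      rfl
    simp only [e0] at ht
    rw [e]
    refine ht.trans ?_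
    gcongr
  refine key.trans_eq ?_
  ring

theorem dvd_truncatedStep_truncatedExponent_sub (μ : ℝ) :
    lengthFamily L ^ 7 ∣ truncatedStep (truncatedExponent hV μ)
      (flowSum (opGenerator hV μ) (lengthFamily L) (-(1 / 2)))
      - flowSum (opGenerator hV μ) (lengthFamily L) (1 / 2) := by
  refine dvd_truncatedStep_sub_flowSum (lengthFamily L) lengthFamily_commute (opGenerator hV μ)
    -- The truncated exponents are built from the midpoint expansions themselves, so the three
    -- congruences hold with difference zero.
    (fun i j hi hj => ?_) (by simp) (by simp) (by simp)
  obtain ⟨i, rfl⟩ := Nat.exists_eq_succ_of_ne_zero hi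
  obtain ⟨j, rfl⟩ := Nat.exists_eq_succ_of_ne_zero hj
  refine Subtype.ext (funext fun p => ?_)
  change (opGenerator hV μ (i + 1)).1 p * (opGenerator hV μ (j + 1)).1 p =
    (opGenerator hV μ (j + 1)).1 p * (opGenerator hV μ (i + 1)).1 p
  rw [opGenerator_succ_apply, opGenerator_succ_apply]
  generalize (timeCoeff hV (i + 1)).1 p.1 = v
  generalize (timeCoeff hV (j + 1)).1 p.1 = w
  ext ψ x
  change -(Complex.I * ((v.1 x : ℂ) * -(Complex.I * ((w.1 x : ℂ) * ψ.1 x)))) =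
    -(Complex.I * ((w.1 x : ℂ) * -(Complex.I * ((v.1 x : ℂ) * ψ.1 x))))
  ring

theorem dvd_truncatedExponent (μ : ℝ) (i : Fin 4) : lengthFamily L ∣ truncatedExponent hV μ i := by
  have hs : ∀ (c : ℂ) {x : OperatorFamily L}, lengthFamily L ∣ x → lengthFamily L ∣ c • x := by
    rintro c _ ⟨x, rfl⟩
    exact ⟨c • x, by rw [mul_smul_comm]⟩
  have hp : ∀ (n : ℕ) (x : OperatorFamily L), lengthFamily L ∣ lengthFamily L ^ (n + 1) * x :=
    fun n x => (dvd_pow_self _ n.succ_ne_zero).mul_right x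
  exact dvd_schemeExponent (Dvd.intro _ rfl)
    (dvd_add (hp 1 _) (dvd_add (hs _ (hp 3 _)) (hs _ (hp 5 _)))) (dvd_add (hp 2 _) (hs _ (hp 4 _))) i

/-- Every exponential multiplies the accumulated squared error by `3` and adds its own: hence `81 =
3⁴` and the weights `27, 9, 3, 1` of the four constants. -/
theorem exists_sqNorm_four_steps_le (hu : JointlySmooth u) (a b : ℝ) (X : Fin 4 → OperatorFamily L)
    (Q : OperatorFamily L) (hX : ∀ i, lengthFamily L ∣ X i) (C : ℝ) :
    ∃ K, 0 ≤ K ∧ ∀ m ∈ Set.Icc a b, ∀ τ ∈ Set.Icc (0 : ℝ) 1,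
      ∀ (Y : Fin 4 → Module.End ℂ (smoothPeriodic ℂ L)) (ψ ψ' : smoothPeriodic ℂ L),
        (∀ i, IsSkew (Y i)) → (∀ i, PointwiseBound (Y i - (X i).1 (m, τ)) (C * τ ^ 7)) →
        StepMaps Y ψ ψ' →
        sqNorm (ψ' - (truncatedStep X Q).1 (m, τ) (u m)) ≤
          81 * sqNorm (ψ - Q.1 (m, τ) (u m)) + K * τ ^ 14 := by
  rw [truncatedStep]
  obtain ⟨K₀, hK₀0, hK₀⟩ := exists_sqNorm_step_le hu a b (X 0) Q (hX 0) (C := C)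
  generalize expSum (X 0) * Q = Q₁ at *
  obtain ⟨K₁, hK₁0, hK₁⟩ := exists_sqNorm_step_le hu a b (X 1) Q₁ (hX 1) (C := C)
  generalize expSum (X 1) * Q₁ = Q₂ at *
  obtain ⟨K₂, hK₂0, hK₂⟩ := exists_sqNorm_step_le hu a b (X 2) Q₂ (hX 2) (C := C)
  generalize expSum (X 2) * Q₂ = Q₃ at *
  obtain ⟨K₃, hK₃0, hK₃⟩ := exists_sqNorm_step_le hu a b (X 3) Q₃ (hX 3) (C := C)
  generalize expSum (X 3) * Q₃ = Q₄ at *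
  refine ⟨27 * K₀ + 9 * K₁ + 3 * K₂ + K₃, by positivity, ?_⟩
  rintro m hm τ hτ Y ψ ψ' hY hb ⟨ψ₁, ψ₂, ψ₃, h₀, h₁, h₂, h₃⟩
  have g₀ := hK₀ m hm τ hτ _ _ _ (hY 0) (hb 0) h₀
  have g₁ := hK₁ m hm τ hτ _ _ _ (hY 1) (hb 1) h₁
  have g₂ := hK₂ m hm τ hτ _ _ _ (hY 2) (hb 2) h₂
  have g₃ := hK₃ m hm τ hτ _ _ _ (hY 3) (hb 3) h₃
  linarith

theorem coordinateStep_order_six (hV : JointlySmooth V) (hL : ∀ i, 0 < L i) {μ : ℝ}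
    (hu : IsSolution μ V u) (a b : ℝ) :
    ∃ C δ : ℝ, 0 < δ ∧ ∀ s ∈ Set.Icc a b, ∀ τ : ℝ, 0 < τ → τ ≤ δ → ∀ ψ : smoothPeriodic ℂ L,
      StepMaps (commutatorExponent τ (kineticOp L μ) (mulOp (V (s + c₁ * τ)))
        (mulOp (V (s + c₂ * τ))) (mulOp (V (s + c₃ * τ)))) (u s) ψ →
      cellNorm (ψ - u (s + τ)) ≤ C * τ ^ 7 := by
  obtain ⟨C, -, hC⟩ := exists_pointwiseBound_sub_truncatedExponent hV μ a (b + 1)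
  obtain ⟨K, hK0, hK⟩ := exists_sqNorm_taylor_le hV hu a (b + 1)
  obtain ⟨R, hR⟩ := dvd_truncatedStep_truncatedExponent_sub hV μ
  obtain ⟨D, hD0, hD⟩ := OperatorFamily.exists_sqNorm_le R hu.1 a (b + 1)
  have hKp := fun m hm τ hτ => hK m hm τ hτ (1 / 2) (by norm_num [abs_le])
  have hKm := fun m hm τ hτ => hK m hm τ hτ (-(1 / 2)) (by norm_num [abs_le])
  push_cast at hKp hKm
  obtain ⟨K', hK'0, hK'⟩ := exists_sqNorm_four_steps_le hu.1 a (b + 1) (truncatedExponent hV μ)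
    (flowSum (opGenerator hV μ) (lengthFamily L) (-(1 / 2))) (dvd_truncatedExponent hV μ) C
  generalize truncatedStep (truncatedExponent hV μ)
    (flowSum (opGenerator hV μ) (lengthFamily L) (-(1 / 2))) = S at hR hK'
  generalize flowSum (opGenerator hV μ) (lengthFamily L) (-(1 / 2)) = F' at hKm hK'
  generalize flowSum (opGenerator hV μ) (lengthFamily L) (1 / 2) = F at hR hKp
  refine ⟨√(2 * (81 * K + K' + 2 * (D + K))), 1, one_pos, fun s hs τ hτ0 hτ1 ψ hψ => ?_⟩
  have hτ : τ ∈ Set.Icc (0 : ℝ) 1 := ⟨hτ0.le, hτ1⟩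
  obtain ⟨m, hm⟩ : ∃ m, m = s + τ / 2 := ⟨_, rfl⟩
  have hmI : m ∈ Set.Icc a (b + 1) := ⟨by linarith [hs.1], by linarith [hs.2]⟩
  have n₁ : s + c₁ * τ = m - √15 / 10 * τ := by rw [c₁, hm]; ring
  have n₂ : s + c₂ * τ = m := by rw [c₂, hm]; ring
  have n₃ : s + c₃ * τ = m + √15 / 10 * τ := by rw [c₃, hm]; ring
  rw [n₁, n₂, n₃] at hψ
  have e₀ := hKm m hmI τ hτ
  have e₄ := hKp m hmI τ hτ
  rw [show m + -(1 / 2) * τ = s by rw [hm]; ring] at e₀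
  rw [show m + 1 / 2 * τ = s + τ by rw [hm]; ring] at e₄
  have g := hK' m hmI τ hτ _ _ _ (isSkew_commutatorExponent hL μ τ _ _ _) (hC m hmI τ hτ) hψ
  have hd : sqNorm (S.1 (m, τ) (u m) - F.1 (m, τ) (u m)) ≤ D * τ ^ 14 := by
    rw [OperatorFamily.sub_apply_eq hR (m, τ) (u m), sqNorm_smul, norm_pow, Complex.norm_real,
      Real.norm_eq_abs, abs_of_pos hτ0, ← pow_mul, mul_comm]
    exact mul_le_mul_of_nonneg_right (hD m hmI τ hτ) (pow_nonneg hτ.1 _)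
  generalize S.1 (m, τ) (u m) = q at *
  generalize F.1 (m, τ) (u m) = f at *
  have hn : sqNorm (f - u (s + τ)) = sqNorm (u (s + τ) - f) := by
    rw [← neg_sub, ← neg_one_smul ℂ, sqNorm_smul]
    simp
  -- The three errors: the true exponentials against the truncated scheme, including the initial
  -- Taylor error; the algebraic order defect; and the Taylor error at the end of the step.
  have hsplit : ψ - u (s + τ) = (ψ - q) + ((q - f) + (f - u (s + τ))) := by abel
  have f₁ := sqNorm_add_le (ψ - q) ((q - f) + (f - u (s + τ)))
  have f₂ := sqNorm_add_le (q - f) (f - u (s + τ))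
  rw [← hsplit] at f₁
  rw [cellNorm_eq, ← Real.sqrt_sq (pow_nonneg hτ0.le 7), ← Real.sqrt_mul (by positivity)]
  refine Real.sqrt_le_sqrt ?_
  have g' : sqNorm (ψ - q) ≤ 81 * (K * τ ^ 14) + K' * τ ^ 14 :=
    g.trans (add_le_add_left (mul_le_mul_of_nonneg_left e₀ (by norm_num)) _)
  calc sqNorm (ψ - u (s + τ))
      ≤ 2 * ((81 * (K * τ ^ 14) + K' * τ ^ 14) + 2 * (D * τ ^ 14 + K * τ ^ 14)) :=
        f₁.trans (mul_le_mul_of_nonneg_left (add_le_add g' (f₂.trans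
          (mul_le_mul_of_nonneg_left (add_le_add hd (hn.trans_le e₄)) zero_le_two))) zero_le_two)
    _ = 2 * (81 * K + K' + 2 * (D + K)) * (τ ^ 7) ^ 2 := by ring

end Assembly

end ExpPropagator

end

theorem mainTheorem2 :
    -- sixth order for the semi-discretized equation in `ℂᴺ`
    (∀ (N : ℕ) (T : Matrix (Fin N) (Fin N) ℂ) (V : ℝ → Fin N → ℝ)
        (U : ℝ → ℝ → Matrix (Fin N) (Fin N) ℂ),
      T.IsHermitian → ContDiff ℝ 6 V → IsPropagator T V U →
      ∀ a b : ℝ, ∃ C δ : ℝ, 0 < δ ∧ ∀ s ∈ Set.Icc a b, ∀ τ : ℝ, 0 < τ → τ ≤ δ →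
        ‖matrixStep T V s τ - U (s + τ) s‖ ≤ C * τ ^ 7) ∧
    -- the Schrödinger equation with periodic boundary conditions
    (∀ (d : ℕ) (L : Fin d → ℝ) (μ : ℝ) (V : ℝ → smoothPeriodic ℝ L),
      (∀ i, 0 < L i) → 0 < μ → JointlySmooth V →
      -- the double commutator is a multiplication operator
      (∀ s τ : ℝ,
        doubleComm
            (α₂ τ (mulOp (V (s + c₁ * τ))) (mulOp (V (s + c₃ * τ))))
            (α₁ τ (kineticOp L μ) (mulOp (V (s + c₂ * τ)))) =
          (-(Complex.I * (τ : ℂ))) • ((τ : ℂ) ^ 2) •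
            mulOp ((-(5 / (3 * μ))) • gradDiffSq (V (s + c₁ * τ)) (V (s + c₃ * τ)))) ∧
      -- the scheme in coordinates
      (∀ s τ : ℝ,
        commutatorExponent τ (kineticOp L μ) (mulOp (V (s + c₁ * τ)))
            (mulOp (V (s + c₂ * τ))) (mulOp (V (s + c₃ * τ))) =
          coordinateExponent τ (kineticOp L μ) (mulOp (V (s + c₁ * τ)))
            (mulOp (V (s + c₂ * τ))) (mulOp (V (s + c₃ * τ)))
            (mulOp (modifiedPotential μ (V (s + c₁ * τ)) (V (s + c₃ * τ))))) ∧
      -- sixth order of the scheme in coordinates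
      (∀ u : ℝ → smoothPeriodic ℂ L, IsSolution μ V u →
        ∀ a b : ℝ, ∃ C δ : ℝ, 0 < δ ∧ ∀ s ∈ Set.Icc a b, ∀ τ : ℝ, 0 < τ → τ ≤ δ →
          ∀ ψ : smoothPeriodic ℂ L,
            StepMaps
              (coordinateExponent τ (kineticOp L μ) (mulOp (V (s + c₁ * τ)))
                (mulOp (V (s + c₂ * τ))) (mulOp (V (s + c₃ * τ)))
                (mulOp (modifiedPotential μ (V (s + c₁ * τ)) (V (s + c₃ * τ)))))
              (u s) ψ →
            cellNorm (ψ - u (s + τ)) ≤ C * τ ^ 7)) := by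
  refine ⟨fun N T V U hT hV hU a b => matrixStep_order_six T V U hT hV hU a b,
    fun d L μ V hL hμ hV => ⟨fun s τ => doubleComm_α μ τ _ _ _,
      fun s τ => commutatorExponent_eq_coordinateExponent μ τ _ _ _, fun u hu a b => ?_⟩⟩
  simp only [← commutatorExponent_eq_coordinateExponent]
  exact coordinateStep_order_six hV hL hu a b
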